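/- **Setting.** Let $d\in\{2,3\}$, $T>0$, $p>d+2$, $\mathbb T^d=([-1,1]|_{\{-1,1\}})^d$, and let $R^{d\times d}_{\rm sym}$ be the space of real symmetric matrices with $A:B=\sum_{i,j}A_{ij}B_{ij}$, $|A|=(A:A)^{1/2}$. Let $F:R^{d\times d}_{\rm sym}\to[0,\infty)$ be convex with $F(0)=0$, with conjugate $F^*(\mathbb S)=\sup_{\mathbb D}[\mathbb S:\mathbb D-F(\mathbb D)]$ and asymptotic function $F_\infty(\mathbb D)=\lim_{s\to\infty}F(s\mathbb D)/s\in[0,\infty]$. Write $\mathrm{Dom}$ for the set where a function is finite. Assume that there is $r>0$ with $F^*(\mathbb S)<\infty$ whenever $|\mathbb S|<r$, and that there is $r>0$ with $\mathrm{Dom}(F^*)\subset\Lambda^0+B(r,0)$, where $\Lambda^0$ is the polar set of $\Lambda=\mathrm{Dom}(F_\infty)$ and $B(r,0)$ is the ball of radius $r$ centred at $0$. **Equations.** Write $\mathbb D\mathbf v=\frac12(\nabla_x\mathbf v+\nabla_x^t\mathbf v)$ and consider on $[0,T]\times\mathbb T^d$ $$\mathrm{div}_x\mathbf v=0,\quad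 \partial_t\mathbf v+\mathrm{div}_x(\mathbf v\otimes\mathbf v)+\nabla_x\Pi=\mathrm{div}_x\mathbb S,\quad \mathbb S:\mathbb D\mathbf v=F(\mathbb D\mathbf v)+F^*(\mathbb S),\quad \mathbf v(0,\cdot)=\mathbf v_0. \tag{1}$$ **Dissipative solutions.** Let $\mathcal M^+(\mathbb T^d;R^{d\times d}_{\rm sym})$ be the set of finite matrix-valued measures on $\mathbb T^d$ with values in the positive semidefinite symmetric matrices. A field $\mathbf v\in C_{\rm weak}([0,T];L^2(\mathbb T^d;\mathbb R^d))$, together with $\mathbb S\in L^1((0,T)\times\mathbb T^d;R^{d\times d}_{\rm sym})$ and $\mathfrak R_v\in L^\infty(0,T;\mathcal M^+(\mathbb T^d;R^{d\times d}_{\rm sym}))$ (essentially bounded and weakly-$*$ measurable), is a dissipative solution of (1) with datum $\mathbf v_0\in L^2(\mathbb T^d;\mathbb R^d)$ if the distribution $\mathbb D\mathbf v$ is a finite $R^{d\times d}_{\rm sym}$-valued measure on $(0,T)\times\mathbb T^d$ and the following hold. * $\int_0^T\!\int_{\mathbb T^d}\mathbf v\cdot\nabla_x\varphi\,dx\,dt=0$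 for all $\varphi\in C^1([0,T]\times\mathbb T^d)$. * For all $\tau\in[0,T]$ and all $\boldsymbol\varphi\in C^1([0,T]\times\mathbb T^d;\mathbb R^d)$ with $\mathrm{div}_x\boldsymbol\varphi=0$, $$\int_{\mathbb T^d}\mathbf v\cdot\boldsymbol\varphi(\tau,\cdot)\,dx-\int_{\mathbb T^d}\mathbf v_0\cdot\boldsymbol\varphi(0,\cdot)\,dx=\int_0^\tau\!\!\int_{\mathbb T^d}\big[\mathbf v\cdot\partial_t\boldsymbol\varphi+(\mathbf v\otimes\mathbf v):\nabla_x\boldsymbol\varphi-\mathbb S:\nabla_x\boldsymbol\varphi\big]dx\,dt+\int_0^\tau\!\!\int_{\mathbb T^d}\nabla_x\boldsymbol\varphi:d\mathfrak R_v\,dt.$$ * For a.a. $\tau\in(0,T)$, $$\int_{\mathbb T^d}\tfrac12|\mathbf v|^2(\tau,\cdot)\,dx+\tfrac12\,\mathrm{trace}[\mathfrak R_v(\tau)](\mathbb T^d)+F(\mathbb D\mathbf v)\big((0,\tau)\times\mathbb T^d\big)+\int_0^\tau\!\!\int_{\mathbb T^d}F^*(\mathbb S)\,dx\,dt\le\int_{\mathbb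 T^d}\tfrac12|\mathbf v_0|^2\,dx,$$ where for a measure $\mu=h\,dx\,dt+\mu^s$ with $\mu^s$ singular, $F(\mu)=F(h)\,dx\,dt+F_\infty\big(\tfrac{d\mu^s}{d|\mu^s|}\big)|\mu^s|$. **Theorem.** Let $\mathbf v_0\in W^{2-\frac2p,p}(\mathbb T^d;\mathbb R^d)$ with $\mathrm{div}_x\mathbf v_0=0$, and let $(\mathbf v,\mathbb S,\mathfrak R_v)$ be a dissipative solution of (1) on $[0,T]$ with datum $\mathbf v_0$ such that $$\mathbf v\in C([0,T];W^{2-\frac2p,p}(\mathbb T^d;\mathbb R^d)),\quad\partial_t\mathbf v\in L^p(0,T;L^p(\mathbb T^d;\mathbb R^d)),\quad\mathbf v\in L^p(0,T;W^{2,p}(\mathbb T^d;\mathbb R^d)).\tag{2}$$ Then $\mathfrak R_v(t)=0$ for a.a. $t\in(0,T)$, and $$\mathbb S:\mathbb D\mathbf v=F(\mathbb D\mathbf v)+F^*(\mathbb S)\quad\text{a.e. in }(0,T)\times\mathbb T^d.$$ Consequently $\mathbf v$ is a strong solution of (1) with viscous stress $\mathbb S$: it belongs to the class (2), $\mathbf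 v(0,\cdot)=\mathbf v_0$, $\mathrm{div}_x\mathbf v=0$ a.e., the above relation holds a.e., and $$\int_0^T\!\!\int_{\mathbb T^d}\big(\partial_t\mathbf v+(\mathbf v\cdot\nabla_x)\mathbf v\big)\cdot\boldsymbol\varphi\,dx\,dt=-\int_0^T\!\!\int_{\mathbb T^d}\mathbb S:\nabla_x\boldsymbol\varphi\,dx\,dt$$ for all $\boldsymbol\varphi\in C^1([0,T]\times\mathbb T^d;\mathbb R^d)$ with $\mathrm{div}_x\boldsymbol\varphi=0$. -/

import Mathlib

open MeasureTheory Set Filter Topology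
open scoped ENNReal NNReal ContDiff

noncomputable section

namespace DissipativeFluid

/-! ### The flat torus and differentiation on it -/

instance factTwoPos : Fact ((0 : ℝ) < 2) := ⟨by norm_num⟩

/-- The flat torus `([-1,1]/{-1,1})^d`. Its `volume` is Lebesgue measure, of total mass `2 ^ d`. -/
abbrev Torus (d : ℕ) : Type := Fin d → AddCircle (2 : ℝ)

/-- The covering map `ℝ^d → 𝕋^d`. -/
def toTorus {d : ℕ} (y : Fin d → ℝ) : Torus d := fun i => (y i : AddCircle (2 : ℝ))

/-- Classical partial derivative in the `j`-th coordinate of a function on the torus. -/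
def pderiv {d : ℕ} (j : Fin d) (f : Torus d → ℝ) (x : Torus d) : ℝ :=
  deriv (fun s : ℝ => f (x + Pi.single j (s : AddCircle (2 : ℝ)))) 0

/-- `f ∈ C^∞(𝕋^d)`. -/
def TorusSmooth {d : ℕ} (f : Torus d → ℝ) : Prop :=
  ContDiff ℝ ∞ (fun y : Fin d → ℝ => f (toTorus y))

/-- `φ ∈ C^n(ℝ × 𝕋^d)`. The restrictions of such functions to `[0,T] × 𝕋^d` are exactly the
functions in `C^n([0,T] × 𝕋^d)`. -/
def SpaceTimeContDiff {d : ℕ} (n : WithTop ℕ∞) (φ : ℝ → Torus d → ℝ) : Prop :=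
  ContDiff ℝ n (fun q : ℝ × (Fin d → ℝ) => φ q.1 (toTorus q.2))

/-- `φ ∈ C^∞_c((0,T) × 𝕋^d)`. -/
def IsInteriorTest {d : ℕ} (T : ℝ) (φ : ℝ → Torus d → ℝ) : Prop :=
  SpaceTimeContDiff ∞ φ ∧ ∃ a b : ℝ, 0 < a ∧ b < T ∧ ∀ t, t ∉ Icc a b → ∀ x, φ t x = 0

/-- `φ ∈ C¹([0,T] × 𝕋^d; ℝ^d)` with `div_x φ = 0`. -/
def IsSolenoidalTest {d : ℕ} (T : ℝ) (φ : ℝ → Torus d → Fin d → ℝ) : Prop :=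
  (∀ i, SpaceTimeContDiff 1 (fun t x => φ t x i)) ∧
    ∀ t ∈ Icc 0 T, ∀ x, ∑ i, pderiv i (fun y => φ t y i) x = 0

/-- Lebesgue measure on `(0,T) × 𝕋^d`. -/
def spaceTime (d : ℕ) (T : ℝ) : Measure (ℝ × Torus d) :=
  (volume.restrict (Ioo 0 T)).prod volume

/-! ### Weak derivatives and Sobolev classes on the torus -/

/-- `g = ∂_j f` in the sense of distributions on `𝕋^d`, with `f, g ∈ L¹`. -/
def HasWeakDeriv {d : ℕ} (j : Fin d) (f g : Torus d → ℝ) : Prop :=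
  Integrable f ∧ Integrable g ∧
    ∀ φ : Torus d → ℝ, TorusSmooth φ → ∫ x, f x * pderiv j φ x = - ∫ x, g x * φ x

/-- `div u = 0` in the sense of distributions on `𝕋^d`. -/
def WeaklyDivFree {d : ℕ} (u : Torus d → Fin d → ℝ) : Prop :=
  (∀ i, Integrable (fun x => u x i)) ∧
    ∀ φ : Torus d → ℝ, TorusSmooth φ → ∫ x, ∑ i, u x i * pderiv i φ x = 0

/-- The Slobodeckij (Gagliardo) seminorm of order `s ∈ (0,1)`,
`(∬ |g(x) - g(y)|^p / |x - y|^(d + s p) dx dy)^(1/p)`. Here `dist` is the maximum over the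
coordinates of the distances on the circle `ℝ/2ℤ`; it is comparable to the Euclidean distance, so
that the seminorm is comparable to the one for the Euclidean distance. -/
def slobodeckijSeminorm {d : ℕ} (s p : ℝ) (g : Torus d → ℝ) : ℝ≥0∞ :=
  (∫⁻ x, ∫⁻ y, ENNReal.ofReal (|g x - g y| ^ p / dist x y ^ ((d : ℝ) + s * p))) ^ (1 / p)

/-- The norm of `W^{2-2/p,p}(𝕋^d)` for `p > 2`, where `2 - 2/p = 1 + (1 - 2/p)`; its value is `∞` on
functions without a weak gradient in `L^p`. The weak gradient being unique up to null sets, the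
infimum is over mutually equal values. -/
def traceSpaceNorm {d : ℕ} (p : ℝ) (f : Torus d → ℝ) : ℝ≥0∞ :=
  ⨅ (g : Fin d → Torus d → ℝ)
    (_ : ∀ j, MemLp (g j) (ENNReal.ofReal p) volume ∧ HasWeakDeriv j f (g j)),
    eLpNorm f (ENNReal.ofReal p) volume +
      ∑ j, (eLpNorm (g j) (ENNReal.ofReal p) volume + slobodeckijSeminorm (1 - 2 / p) p (g j))

/-- `f ∈ W^{2-2/p,p}(𝕋^d)`. -/
def MemTraceSpace {d : ℕ} (p : ℝ) (f : Torus d → ℝ) : Prop :=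
  MemLp f (ENNReal.ofReal p) volume ∧ traceSpaceNorm p f < ⊤

/-- `G i j = ∂_j v_i` in the sense of distributions on `𝕋^d`, for almost every time. -/
def IsWeakGradient {d : ℕ} (T : ℝ) (v : ℝ → Torus d → Fin d → ℝ)
    (G : ℝ → Torus d → Matrix (Fin d) (Fin d) ℝ) : Prop :=
  ∀ᵐ t ∂(volume.restrict (Ioo 0 T)), ∀ i j,
    HasWeakDeriv j (fun x => v t x i) (fun x => G t x i j)

/-- `w = ∂_t v` in the sense of distributions on `(0,T) × 𝕋^d`. -/
def IsWeakTimeDeriv {d : ℕ} (T : ℝ) (v w : ℝ → Torus d → Fin d → ℝ) : Prop :=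
  ∀ i, Integrable (fun z : ℝ × Torus d => v z.1 z.2 i) (spaceTime d T) ∧
    Integrable (fun z : ℝ × Torus d => w z.1 z.2 i) (spaceTime d T) ∧
    ∀ φ : ℝ → Torus d → ℝ, IsInteriorTest T φ →
      ∫ t in (0)..T, ∫ x, v t x i * deriv (fun s => φ s x) t =
        - ∫ t in (0)..T, ∫ x, w t x i * φ t x

/-- The regularity class `v ∈ C([0,T]; W^{2-2/p,p})`, `∂_t v ∈ L^p(0,T; L^p)`,
`v ∈ L^p(0,T; W^{2,p})`. -/
structure InRegularityClass {d : ℕ} (p T : ℝ) (v : ℝ → Torus d → Fin d → ℝ) : Prop where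
  mem_traceSpace : ∀ t ∈ Icc 0 T, ∀ i, MemTraceSpace p (fun x => v t x i)
  continuous_traceSpace : ∀ t₀ ∈ Icc 0 T, ∀ i,
    Tendsto (fun t => traceSpaceNorm p (fun x => v t x i - v t₀ x i)) (𝓝[Icc 0 T] t₀) (𝓝 0)
  time_deriv : ∃ w : ℝ → Torus d → Fin d → ℝ,
    (∀ i, MemLp (fun z : ℝ × Torus d => w z.1 z.2 i) (ENNReal.ofReal p) (spaceTime d T)) ∧
    IsWeakTimeDeriv T v w
  second_derivs : ∃ (G : ℝ → Torus d → Matrix (Fin d) (Fin d) ℝ)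
      (H : ℝ → Torus d → Fin d → Fin d → Fin d → ℝ),
    (∀ i, MemLp (fun z : ℝ × Torus d => v z.1 z.2 i) (ENNReal.ofReal p) (spaceTime d T)) ∧
    (∀ i j, MemLp (fun z : ℝ × Torus d => G z.1 z.2 i j) (ENNReal.ofReal p) (spaceTime d T)) ∧
    (∀ i j k, MemLp (fun z : ℝ × Torus d => H z.1 z.2 i j k) (ENNReal.ofReal p)
      (spaceTime d T)) ∧
    IsWeakGradient T v G ∧
    ∀ᵐ t ∂(volume.restrict (Ioo 0 T)), ∀ i j k,
      HasWeakDeriv k (fun x => G t x i j) (fun x => H t x i j k)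

/-! ### The rheological potential -/

/-- The Frobenius product `A : B`. -/
def frob {d : ℕ} (A B : Matrix (Fin d) (Fin d) ℝ) : ℝ := ∑ i, ∑ j, A i j * B i j

/-- The symmetric part `(A + Aᵗ) / 2`. -/
def symPart {d : ℕ} (A : Matrix (Fin d) (Fin d) ℝ) : Matrix (Fin d) (Fin d) ℝ :=
  (1 / 2 : ℝ) • (A + A.transpose)

/-- The convex conjugate `F^*(S) = sup_D (S : D - F(D))` over symmetric `D`. -/
def conjugate {d : ℕ} (F : Matrix (Fin d) (Fin d) ℝ → ℝ) (S : Matrix (Fin d) (Fin d) ℝ) : EReal :=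
  ⨆ D ∈ {D : Matrix (Fin d) (Fin d) ℝ | D.IsSymm}, ((frob S D - F D : ℝ) : EReal)

/-- The asymptotic function `F_∞(D) = lim_{s → ∞} F(s D) / s ∈ [0, ∞]`. For `F ≥ 0` convex with
`F(0) = 0` the quotient is nonnegative and nondecreasing in `s > 0`, so that the limit exists and is
the upper limit. -/
def recession {d : ℕ} (F : Matrix (Fin d) (Fin d) ℝ → ℝ) (D : Matrix (Fin d) (Fin d) ℝ) : ℝ≥0∞ :=
  limsup (fun s : ℝ => ENNReal.ofReal (F (s • D) / s)) atTop

/-- The polar `Λ⁰` of `Λ = Dom F_∞` in the space of symmetric matrices. -/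
def recessionPolar {d : ℕ} (F : Matrix (Fin d) (Fin d) ℝ → ℝ) : Set (Matrix (Fin d) (Fin d) ℝ) :=
  {A | A.IsSymm ∧ ∀ D : Matrix (Fin d) (Fin d) ℝ, D.IsSymm → recession F D < ⊤ → frob A D ≤ 1}

/-- The hypotheses on `F : R^{d×d}_sym → [0,∞)`; only the values of `F` on symmetric matrices are
ever used. -/
structure IsPotential {d : ℕ} (F : Matrix (Fin d) (Fin d) ℝ → ℝ) : Prop where
  convex : ConvexOn ℝ {D : Matrix (Fin d) (Fin d) ℝ | D.IsSymm} F
  nonneg : ∀ D : Matrix (Fin d) (Fin d) ℝ, D.IsSymm → 0 ≤ F D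
  map_zero : F 0 = 0
  /-- `Dom F^*` contains a ball. -/
  conjugate_finite : ∃ r : ℝ, 0 < r ∧ ∀ S : Matrix (Fin d) (Fin d) ℝ, S.IsSymm →
    Real.sqrt (frob S S) < r → conjugate F S < ⊤
  /-- `Dom F^* ⊂ Λ⁰ + B(r,0)`. -/
  conjugate_dom : ∃ r : ℝ, 0 < r ∧ ∀ S : Matrix (Fin d) (Fin d) ℝ, S.IsSymm →
    conjugate F S < ⊤ → ∃ A B : Matrix (Fin d) (Fin d) ℝ,
      A ∈ recessionPolar F ∧ B.IsSymm ∧ Real.sqrt (frob B B) < r ∧ S = A + B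

/-! ### Matrix valued measures, given by their entries -/

/-- `μ = 𝔻v ∈ 𝓜((0,T) × 𝕋^d; R^{d×d}_sym)`: the finite symmetric matrix valued measure `μ`, carried
by `(0,T) × 𝕋^d`, is the distributional symmetric gradient of `v`. -/
structure IsSymGradientMeasure {d : ℕ} (T : ℝ) (v : ℝ → Torus d → Fin d → ℝ)
    (μ : Matrix (Fin d) (Fin d) (SignedMeasure (ℝ × Torus d))) : Prop where
  symm : ∀ i j, μ i j = μ j i
  carried : ∀ i j, (μ i j).totalVariation (Ioo 0 T ×ˢ univ)ᶜ = 0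
  deriv_eq : ∀ i j, ∀ φ : ℝ → Torus d → ℝ, IsInteriorTest T φ →
    (∫ᵛ z, φ z.1 z.2 ∂•(μ i j)) =
      - ∫ t in (0)..T, ∫ x,
        (1 / 2) * (v t x i * pderiv j (φ t) x + v t x j * pderiv i (φ t) x)

/-- The density of `μ` with respect to Lebesgue measure on space-time. -/
def acDensity {d : ℕ} (μ : Matrix (Fin d) (Fin d) (SignedMeasure (ℝ × Torus d)))
    (z : ℝ × Torus d) : Matrix (Fin d) (Fin d) ℝ :=
  Matrix.of fun i j => (μ i j).rnDeriv volume z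

/-- The sum of the total variations of the entries of the singular part `μ^s` of `μ`. -/
def singVariation {d : ℕ} (μ : Matrix (Fin d) (Fin d) (SignedMeasure (ℝ × Torus d))) :
    Measure (ℝ × Torus d) :=
  ∑ i, ∑ j, ((μ i j).singularPart volume).totalVariation

/-- The density of the singular part `μ^s` of `μ` with respect to `singVariation μ`. -/
def singDensity {d : ℕ} (μ : Matrix (Fin d) (Fin d) (SignedMeasure (ℝ × Torus d)))
    (z : ℝ × Torus d) : Matrix (Fin d) (Fin d) ℝ :=
  Matrix.of fun i j => ((μ i j).singularPart volume).rnDeriv (singVariation μ) z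

/-- The mass on `B` of the convex function `F(μ)` of the measure `μ = h dx dt + μ^s`, namely
`F(μ) = F(h) dx dt + F_∞(dμ^s/dλ) λ`. As `F_∞` is positively homogeneous of degree one, any `λ` with
`μ^s ≪ λ` gives the same measure; `λ = singVariation μ` is comparable to `|μ^s|`. -/
def convexMass {d : ℕ} (F : Matrix (Fin d) (Fin d) ℝ → ℝ)
    (μ : Matrix (Fin d) (Fin d) (SignedMeasure (ℝ × Torus d))) (B : Set (ℝ × Torus d)) : ℝ≥0∞ :=
  (∫⁻ z in B, ENNReal.ofReal (F (acDensity μ z))) +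
    ∫⁻ z in B, recession F (singDensity μ z) ∂(singVariation μ)

/-- `R ∈ L^∞(0,T; 𝓜⁺(𝕋^d; R^{d×d}_sym))`: a weakly-* measurable, essentially bounded family of finite
measures with values in the positive semidefinite symmetric matrices. -/
structure IsReynoldsStress {d : ℕ} (T : ℝ)
    (R : ℝ → Matrix (Fin d) (Fin d) (SignedMeasure (Torus d))) : Prop where
  measurable : ∀ i j, ∀ g : C(Torus d, ℝ),
    AEMeasurable (fun t => ∫ᵛ x, g x ∂•(R t i j)) (volume.restrict (Ioo 0 T))
  posSemidef : ∀ᵐ t ∂(volume.restrict (Ioo 0 T)), ∀ A : Set (Torus d), MeasurableSet A →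
    (Matrix.of fun i j => R t i j A).PosSemidef
  bounded : ∃ C : ℝ≥0, ∀ᵐ t ∂(volume.restrict (Ioo 0 T)), ∀ i j,
    (R t i j).totalVariation univ ≤ C

/-! ### Dissipative and strong solutions -/

/-- `v ∈ C_weak([0,T]; L²(𝕋^d; ℝ^d))`, represented by a measurable function of `(t,x)`. -/
structure IsWeaklyContinuous {d : ℕ} (T : ℝ) (v : ℝ → Torus d → Fin d → ℝ) : Prop where
  measurable : ∀ i, AEStronglyMeasurable (fun z : ℝ × Torus d => v z.1 z.2 i) (spaceTime d T)
  memLp : ∀ t ∈ Icc 0 T, ∀ i, MemLp (fun x => v t x i) 2 volume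
  continuous : ∀ w : Torus d → Fin d → ℝ, (∀ i, MemLp (fun x => w x i) 2 volume) →
    ContinuousOn (fun t => ∫ x, ∑ i, v t x i * w x i) (Icc 0 T)

/-- `v`, together with the viscous stress `S` and the Reynolds viscous stress `R`, is a dissipative
solution on `[0,T]` with potential `F` and initial datum `v₀`. -/
structure IsDissipativeSolution {d : ℕ} (F : Matrix (Fin d) (Fin d) ℝ → ℝ) (T : ℝ)
    (v₀ : Torus d → Fin d → ℝ) (v : ℝ → Torus d → Fin d → ℝ)
    (S : ℝ → Torus d → Matrix (Fin d) (Fin d) ℝ)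
    (R : ℝ → Matrix (Fin d) (Fin d) (SignedMeasure (Torus d))) : Prop where
  initial_memLp : ∀ i, MemLp (fun x => v₀ x i) 2 volume
  weakly_continuous : IsWeaklyContinuous T v
  stress_integrable : ∀ i j, Integrable (fun z : ℝ × Torus d => S z.1 z.2 i j) (spaceTime d T)
  stress_symm : ∀ᵐ z ∂(spaceTime d T), (S z.1 z.2).IsSymm
  reynolds : IsReynoldsStress T R
  incompressible : ∀ φ : ℝ → Torus d → ℝ, SpaceTimeContDiff 1 φ →
    ∫ t in (0)..T, ∫ x, ∑ i, v t x i * pderiv i (φ t) x = 0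
  momentum : ∀ τ ∈ Icc 0 T, ∀ φ : ℝ → Torus d → Fin d → ℝ, IsSolenoidalTest T φ →
    (∫ x, ∑ i, v τ x i * φ τ x i) - ∫ x, ∑ i, v₀ x i * φ 0 x i =
      (∫ t in (0)..τ, ∫ x, ((∑ i, v t x i * deriv (fun s => φ s x i) t) +
        ∑ i, ∑ j, v t x i * v t x j * pderiv j (fun y => φ t y i) x))
      - (∫ t in (0)..τ, ∫ x, ∑ i, ∑ j, S t x i j * pderiv j (fun y => φ t y i) x)
      + ∫ t in (0)..τ, ∑ i, ∑ j, ∫ᵛ x, pderiv j (fun y => φ t y i) x ∂•(R t i j)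
  energy : ∃ μ : Matrix (Fin d) (Fin d) (SignedMeasure (ℝ × Torus d)),
    IsSymGradientMeasure T v μ ∧
    ∀ᵐ τ ∂(volume.restrict (Ioo 0 T)),
      ENNReal.ofReal (∫ x, (1 / 2) * ∑ i, v τ x i ^ 2)
        + ENNReal.ofReal ((1 / 2) * ∑ i, R τ i i univ)
        + (convexMass F μ (Ioo 0 τ ×ˢ univ)
          + ∫⁻ z in Ioo 0 τ ×ˢ univ, (conjugate F (S z.1 z.2)).toENNReal)
      ≤ ENNReal.ofReal (∫ x, (1 / 2) * ∑ i, v₀ x i ^ 2)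

/-- `v`, with viscous stress `S`, is a strong solution on `[0,T]` with initial datum `v₀`: it is in
the regularity class, and with `w = ∂_t v` and `G = ∇_x v`, which are functions in `L^p`,
`div_x v = 0` and `S : 𝔻v = F(𝔻v) + F^*(S)` hold almost everywhere, and
`∂_t v + (v · ∇_x) v + ∇_x Π = div_x S` holds in the sense of distributions, where the pressure `Π`
is eliminated by solenoidal test functions. -/
structure IsStrongSolution {d : ℕ} (F : Matrix (Fin d) (Fin d) ℝ → ℝ) (p T : ℝ)
    (v₀ : Torus d → Fin d → ℝ) (v : ℝ → Torus d → Fin d → ℝ)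
    (S : ℝ → Torus d → Matrix (Fin d) (Fin d) ℝ) : Prop where
  regular : InRegularityClass p T v
  initial : ∀ i, (fun x => v 0 x i) =ᵐ[volume] (fun x => v₀ x i)
  equations : ∃ (w : ℝ → Torus d → Fin d → ℝ) (G : ℝ → Torus d → Matrix (Fin d) (Fin d) ℝ),
    (∀ i, MemLp (fun z : ℝ × Torus d => w z.1 z.2 i) (ENNReal.ofReal p) (spaceTime d T)) ∧
    (∀ i j, MemLp (fun z : ℝ × Torus d => G z.1 z.2 i j) (ENNReal.ofReal p) (spaceTime d T)) ∧
    IsWeakTimeDeriv T v w ∧ IsWeakGradient T v G ∧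
    (∀ᵐ z ∂(spaceTime d T), (G z.1 z.2).trace = 0) ∧
    (∀ φ : ℝ → Torus d → Fin d → ℝ, IsSolenoidalTest T φ →
      (∫ t in (0)..T, ∫ x, ∑ i, (w t x i + ∑ j, v t x j * G t x i j) * φ t x i) =
        - ∫ t in (0)..T, ∫ x, ∑ i, ∑ j, S t x i j * pderiv j (fun y => φ t y i) x) ∧
    ∀ᵐ z ∂(spaceTime d T),
      ((frob (S z.1 z.2) (symPart (G z.1 z.2)) : ℝ) : EReal) =
        (F (symPart (G z.1 z.2)) : EReal) + conjugate F (S z.1 z.2)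

end DissipativeFluid

end

/-! A solution of this regularity may be tested with itself in its own momentum equation, and this
yields the energy balance with the inequality sign opposite to the assumed one. What makes it
possible is that `∇v` is bounded: for `s = 1 - 2/p` one has `s p = p - 2 > d`, so `W^{s,p}` embeds
into `L^∞` (`exists_ae_bound_of_slobodeckijSeminorm`), and compactness of `[0,T]` gives a bound `M`
uniform in time (`InRegularityClass.exists_bound_pderiv_mollify`).

Let `r(t)` be the total mass of the trace of `R t`. Positive semidefiniteness bounds the total
variation of every entry of `R t` by `r(t)`, so the Reynolds term costs at most `d² M ∫ r`. The
convective term vanishes because `v` is solenoidal. Hence `½∫|v₀|² - ½∫|v(τ)|² ≤ ∫∫ S : ∇v + d² M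
∫₀^τ r` (`IsDissipativeSolution.energy_ge`). In the assumed energy inequality the absolutely
continuous part of the measure `𝔻v` is the symmetric part of `∇v`
(`IsSymGradientMeasure.acDensity_ae_eq`), and the singular contribution may be dropped. Adding the
two gives `½ r(τ) + ∫∫ (F(𝔻v) + F^*(S) - S : 𝔻v) ≤ d² M ∫₀^τ r`. The bracket is nonnegative by
Fenchel-Young, so Gronwall (`eq_zero_of_le_integral`) gives `r = 0` and therefore `R = 0`. Then the
nonnegative bracket has zero integral, which is the constitutive relation almost everywhere.

Since `v` is not `C¹`, the test field is a mollification in space followed by a backward Steklov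
average in time. The mollifier has finite rank, `ρ(x - y) = ∑ a_m(x) a_m(y)`, so the test field is a
finite sum `∑ σ_m(t) a_m(x)` and the time limits concern scalar functions. The pairing of `v` with
its mollification becomes a sum of squares of coefficients `c`, and the time term is handled by `c
(c - c') ≥ ½ (c² - c'²)`, without using `∂_t v`. The averaging parameter `h` goes to `0` first, then
the mollification index `n` to `∞`. As `M` bounds all approximate gradients, the Reynolds term never
requires a limit. The stress `S` is only integrable, so there the symmetric mollifier is moved from
the gradient onto `S`.

The initial value is identified from the momentum equation at `τ = 0`, tested with a mollification
of `v 0 - v₀`. Once `R = 0`, the strong form follows by integrating by parts in time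
(`integral_mul_deriv_time`) and in the convective term (`integral_convection_mul_pderiv`). -/

noncomputable section

namespace DissipativeFluid

variable {d : ℕ}

/-! ### Calculus on the torus -/

/-- `f ∈ C^n(𝕋^d)`. -/
def TorusContDiff (n : WithTop ℕ∞) (f : Torus d → ℝ) : Prop :=
  ContDiff ℝ n (fun y : Fin d → ℝ => f (toTorus y))

theorem TorusSmooth.contDiff {f : Torus d → ℝ} (hf : TorusSmooth f) : TorusContDiff ∞ f := hf

theorem TorusContDiff.of_le {m n : WithTop ℕ∞} {f : Torus d → ℝ} (hf : TorusContDiff n f)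
    (h : m ≤ n) : TorusContDiff m f :=
  ContDiff.of_le hf h

theorem TorusSmooth.one {f : Torus d → ℝ} (hf : TorusSmooth f) : TorusContDiff 1 f :=
  hf.contDiff.of_le (by exact_mod_cast le_top)

/-- Differentiability on the torus is expressed through lifts to `ℝ^d`; continuity descends from the
lift because the covering map is a quotient map. Openness is what makes its product with the time
axis a quotient map too. -/
theorem isOpenQuotientMap_toTorus : IsOpenQuotientMap (toTorus (d := d)) :=
  IsOpenQuotientMap.piMap (fun _ => QuotientAddGroup.isOpenQuotientMap_mk)

theorem isOpenQuotientMap_prodMap_toTorus :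
    IsOpenQuotientMap (Prod.map id (toTorus (d := d)) : ℝ × (Fin d → ℝ) → ℝ × Torus d) :=
  IsOpenQuotientMap.id.prodMap isOpenQuotientMap_toTorus

theorem toTorus_add_single (y : Fin d → ℝ) (j : Fin d) (s : ℝ) :
    toTorus y + Pi.single j (s : AddCircle (2 : ℝ)) = toTorus (y + s • Pi.single j (1 : ℝ)) := by
  funext i
  by_cases h : i = j
  · subst h; simp [toTorus]
  · simp [toTorus, h]

theorem toTorus_sub (y z : Fin d → ℝ) : toTorus (y - z) = toTorus y - toTorus z := by
  funext i; simp [toTorus]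

theorem TorusContDiff.continuous {n : WithTop ℕ∞} {f : Torus d → ℝ} (hf : TorusContDiff n f) :
    Continuous f :=
  isOpenQuotientMap_toTorus.isQuotientMap.continuous_iff.2 (ContDiff.continuous hf)

theorem SpaceTimeContDiff.continuous {n : WithTop ℕ∞} {φ : ℝ → Torus d → ℝ}
    (hφ : SpaceTimeContDiff n φ) : Continuous (fun z : ℝ × Torus d => φ z.1 z.2) :=
  isOpenQuotientMap_prodMap_toTorus.isQuotientMap.continuous_iff.2 (ContDiff.continuous hφ)

/-- A coordinate line through `toTorus y` lifts to the straight line `y + s e_j`, so the chain rule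
applies to the lift. This excludes the default value of `deriv` in `pderiv`. -/
theorem hasDerivAt_lift {f : Torus d → ℝ} (hf : TorusContDiff 1 f) (j : Fin d) (y : Fin d → ℝ) :
    HasDerivAt (fun s : ℝ => f (toTorus y + Pi.single j (s : AddCircle (2 : ℝ))))
      (fderiv ℝ (fun y : Fin d → ℝ => f (toTorus y)) y (Pi.single j 1)) 0 := by
  have h := ContDiff.differentiable hf one_ne_zero
  have h1 : HasDerivAt (fun s : ℝ => y + s • Pi.single j (1 : ℝ)) (Pi.single j (1 : ℝ)) 0 := by
    simpa using ((hasDerivAt_id (0 : ℝ)).smul_const (Pi.single j (1 : ℝ))).const_add y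
  have h2 := (h (y + (0 : ℝ) • Pi.single j (1 : ℝ))).hasFDerivAt.comp_hasDerivAt (0 : ℝ) h1
  simp only [zero_smul, add_zero] at h2
  refine h2.congr_of_eventuallyEq (Eventually.of_forall fun s => ?_)
  simp [toTorus_add_single]

theorem pderiv_toTorus {f : Torus d → ℝ} (hf : TorusContDiff 1 f) (j : Fin d) (y : Fin d → ℝ) :
    pderiv j f (toTorus y) =
      fderiv ℝ (fun y : Fin d → ℝ => f (toTorus y)) y (Pi.single j 1) :=
  (hasDerivAt_lift hf j y).deriv

theorem TorusContDiff.hasDerivAt {f : Torus d → ℝ} (hf : TorusContDiff 1 f) (j : Fin d)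
    (x : Torus d) :
    HasDerivAt (fun s : ℝ => f (x + Pi.single j (s : AddCircle (2 : ℝ)))) (pderiv j f x) 0 := by
  obtain ⟨y, rfl⟩ := isOpenQuotientMap_toTorus.surjective x
  rw [pderiv_toTorus hf]
  exact hasDerivAt_lift hf j y

theorem TorusSmooth.pderiv {f : Torus d → ℝ} (hf : TorusSmooth f) (j : Fin d) :
    TorusSmooth (pderiv j f) := by
  have h : (fun y : Fin d → ℝ => DissipativeFluid.pderiv j f (toTorus y)) =
      fun y => fderiv ℝ (fun y : Fin d → ℝ => f (toTorus y)) y (Pi.single j 1) :=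
    funext fun y => pderiv_toTorus hf.one j y
  unfold TorusSmooth
  rw [h]
  exact (ContDiff.fderiv_right hf (by simp)).clm_apply contDiff_const

theorem TorusContDiff.continuous_pderiv {f : Torus d → ℝ} (hf : TorusContDiff 1 f) (j : Fin d) :
    Continuous (DissipativeFluid.pderiv j f) := by
  refine isOpenQuotientMap_toTorus.isQuotientMap.continuous_iff.2 ?_
  have h : DissipativeFluid.pderiv j f ∘ toTorus =
      fun y => fderiv ℝ (fun y : Fin d → ℝ => f (toTorus y)) y (Pi.single j 1) :=
    funext fun y => pderiv_toTorus hf j y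
  rw [h]
  exact (ContDiff.continuous_fderiv hf one_ne_zero).clm_apply continuous_const

theorem SpaceTimeContDiff.slice {n : WithTop ℕ∞} {φ : ℝ → Torus d → ℝ}
    (hφ : SpaceTimeContDiff n φ) (t : ℝ) : TorusContDiff n (φ t) :=
  ContDiff.comp (g := fun q : ℝ × (Fin d → ℝ) => φ q.1 (toTorus q.2)) hφ
    (contDiff_const.prodMk contDiff_id)

theorem SpaceTimeContDiff.continuous_pderiv {φ : ℝ → Torus d → ℝ}
    (hφ : SpaceTimeContDiff 1 φ) (j : Fin d) :
    Continuous (fun z : ℝ × Torus d => DissipativeFluid.pderiv j (φ z.1) z.2) := by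
  refine isOpenQuotientMap_prodMap_toTorus.isQuotientMap.continuous_iff.2 ?_
  have h : (fun z : ℝ × Torus d => DissipativeFluid.pderiv j (φ z.1) z.2) ∘ Prod.map id toTorus =
      fun q => fderiv ℝ (fun q : ℝ × (Fin d → ℝ) => φ q.1 (toTorus q.2)) q
        ((0 : ℝ), (Pi.single j 1 : Fin d → ℝ)) := by
    funext q
    have h1 := pderiv_toTorus (hφ.slice q.1) j q.2
    have h2 : HasFDerivAt (fun y : Fin d → ℝ => (q.1, y))
        (ContinuousLinearMap.inr ℝ ℝ (Fin d → ℝ)) q.2 := hasFDerivAt_prodMk_right q.1 q.2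
    have h3 := ((ContDiff.differentiable hφ one_ne_zero) (q.1, q.2)).hasFDerivAt.comp q.2 h2
    simp only [Function.comp_apply, Prod.map, id]
    rw [h1]
    exact congrArg (fun L : (Fin d → ℝ) →L[ℝ] ℝ => L (Pi.single j 1)) h3.fderiv
  rw [h]
  exact (ContDiff.continuous_fderiv hφ one_ne_zero).clm_apply continuous_const

theorem SpaceTimeContDiff.hasDerivAt_time {φ : ℝ → Torus d → ℝ}
    (hφ : SpaceTimeContDiff 1 φ) (t : ℝ) (x : Torus d) :
    HasDerivAt (fun s => φ s x) (deriv (fun s => φ s x) t) t := by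
  obtain ⟨y, rfl⟩ := isOpenQuotientMap_toTorus.surjective x
  have h : ContDiff ℝ 1 (fun s : ℝ => φ s (toTorus y)) :=
    ContDiff.comp (g := fun q : ℝ × (Fin d → ℝ) => φ q.1 (toTorus q.2)) hφ
      (contDiff_id.prodMk contDiff_const)
  exact ((h.differentiable one_ne_zero) t).hasDerivAt

theorem SpaceTimeContDiff.continuous_deriv_time {φ : ℝ → Torus d → ℝ}
    (hφ : SpaceTimeContDiff 1 φ) :
    Continuous (fun z : ℝ × Torus d => deriv (fun s => φ s z.2) z.1) := by
  refine isOpenQuotientMap_prodMap_toTorus.isQuotientMap.continuous_iff.2 ?_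
  have h : (fun z : ℝ × Torus d => deriv (fun s => φ s z.2) z.1) ∘ Prod.map id toTorus =
      fun q => fderiv ℝ (fun q : ℝ × (Fin d → ℝ) => φ q.1 (toTorus q.2)) q
        ((1 : ℝ), (0 : Fin d → ℝ)) := by
    funext q
    have h2 : HasDerivAt (fun s : ℝ => (s, q.2)) ((1 : ℝ), (0 : Fin d → ℝ)) q.1 :=
      (hasDerivAt_id q.1).prodMk (hasDerivAt_const q.1 q.2)
    have h3 := ((ContDiff.differentiable hφ one_ne_zero) (q.1, q.2)).hasFDerivAt.comp_hasDerivAt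
      q.1 h2
    exact h3.deriv
  rw [h]
  exact (ContDiff.continuous_fderiv hφ one_ne_zero).clm_apply continuous_const

theorem TorusContDiff.mul {n : WithTop ℕ∞} {f g : Torus d → ℝ} (hf : TorusContDiff n f)
    (hg : TorusContDiff n g) : TorusContDiff n (fun x => f x * g x) :=
  ContDiff.mul hf hg

theorem TorusContDiff.sum {n : WithTop ℕ∞} {ι : Type*} {s : Finset ι} {f : ι → Torus d → ℝ}
    (hf : ∀ m ∈ s, TorusContDiff n (f m)) : TorusContDiff n (fun x => ∑ m ∈ s, f m x) :=
  ContDiff.sum hf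

theorem torusContDiff_const {n : WithTop ℕ∞} (c : ℝ) : TorusContDiff n (fun _ : Torus d => c) :=
  contDiff_const

theorem pderiv_mul {f g : Torus d → ℝ} (hf : TorusContDiff 1 f) (hg : TorusContDiff 1 g)
    (j : Fin d) (x : Torus d) :
    pderiv j (fun y => f y * g y) x = pderiv j f x * g x + f x * pderiv j g x := by
  have h := ((hf.hasDerivAt j x).fun_mul (hg.hasDerivAt j x)).deriv
  simp only [AddCircle.coe_zero, Pi.single_zero, add_zero] at h
  exact h

theorem pderiv_const_mul {f : Torus d → ℝ} (c : ℝ) (hf : TorusContDiff 1 f)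
    (j : Fin d) (x : Torus d) :
    pderiv j (fun y => c * f y) x = c * pderiv j f x :=
  ((hf.hasDerivAt j x).const_mul c).deriv

theorem pderiv_sum {ι : Type*} {s : Finset ι} {f : ι → Torus d → ℝ}
    (hf : ∀ m ∈ s, TorusContDiff 1 (f m)) (j : Fin d) (x : Torus d) :
    pderiv j (fun y => ∑ m ∈ s, f m y) x = ∑ m ∈ s, pderiv j (f m) x := by
  exact (HasDerivAt.fun_sum fun m hm => (hf m hm).hasDerivAt j x).deriv

theorem pderiv_sub_right {f : Torus d → ℝ} (j : Fin d) (x z : Torus d) :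
    pderiv j (fun y => f (y - z)) x = pderiv j f (x - z) := by
  unfold pderiv
  congr 1
  funext s
  simp only [add_sub_right_comm]

theorem pderiv_sub_left {f : Torus d → ℝ} (hf : TorusContDiff 1 f) (j : Fin d)
    (x z : Torus d) : pderiv j (fun y => f (z - y)) x = - pderiv j f (z - x) := by
  have h := hf.hasDerivAt j (z - x)
  rw [← neg_zero] at h
  have h2 := HasDerivAt.comp_of_eq (0 : ℝ) h (hasDerivAt_neg (0 : ℝ)) rfl
  have h3 : (fun s : ℝ => f (z - (x + Pi.single j (s : AddCircle (2 : ℝ))))) =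
      (fun s : ℝ => f (z - x + Pi.single j (s : AddCircle (2 : ℝ)))) ∘ fun s => -s := by
    funext s
    simp only [Function.comp_apply, AddCircle.coe_neg, Pi.single_neg]
    congr 1; abel
  unfold DissipativeFluid.pderiv at h2 ⊢
  rw [h3, h2.deriv]
  simp

theorem TorusContDiff.comp_sub_left {n : WithTop ℕ∞} {f : Torus d → ℝ} (hf : TorusContDiff n f)
    (z : Torus d) : TorusContDiff n (fun y => f (z - y)) := by
  obtain ⟨w, rfl⟩ := isOpenQuotientMap_toTorus.surjective z
  have : (fun y : Fin d → ℝ => f (toTorus w - toTorus y)) = fun y => f (toTorus (w - y)) := by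
    funext y; rw [toTorus_sub]
  unfold TorusContDiff
  rw [this]
  exact ContDiff.comp (g := fun y : Fin d → ℝ => f (toTorus y)) hf (contDiff_const.sub contDiff_id)

theorem spaceTimeContDiff_mul {n : WithTop ℕ∞} {χ : ℝ → ℝ} {f : Torus d → ℝ}
    (hχ : ContDiff ℝ n χ) (hf : TorusContDiff n f) : SpaceTimeContDiff n (fun t x => χ t * f x) :=
  (hχ.comp contDiff_fst).mul (ContDiff.comp (g := fun y : Fin d → ℝ => f (toTorus y)) hf contDiff_snd)

/-- Invariance under `x ↦ -x` is what permits the substitution `y ↦ x - y` in convolutions. -/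
instance isNegInvariant_volume_torus : (volume : Measure (Torus d)).IsNegInvariant :=
  Measure.IsAddHaarMeasure.isNegInvariant_of_regular volume

/-! ### A smooth approximate identity on the torus with kernels of finite rank -/

/-- The function `cos (π y)` on the circle `ℝ/2ℤ`. -/
def circleCos : AddCircle (2 : ℝ) → ℝ :=
  Function.Periodic.lift (f := fun y : ℝ => Real.cos (Real.pi * y)) (fun y => by
    simp only [mul_add]; rw [mul_comm Real.pi 2, Real.cos_add_two_pi])

/-- The function `sin (π y)` on the circle `ℝ/2ℤ`. -/
def circleSin : AddCircle (2 : ℝ) → ℝ :=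
  Function.Periodic.lift (f := fun y : ℝ => Real.sin (Real.pi * y)) (fun y => by
    simp only [mul_add]; rw [mul_comm Real.pi 2, Real.sin_add_two_pi])

@[simp] theorem circleCos_coe (y : ℝ) :
    circleCos (y : AddCircle (2 : ℝ)) = Real.cos (Real.pi * y) := rfl

theorem circleCos_sub (x y : AddCircle (2 : ℝ)) :
    circleCos (x - y) = circleCos x * circleCos y + circleSin x * circleSin y := by
  induction x using QuotientAddGroup.induction_on with | _ x
  induction y using QuotientAddGroup.induction_on with | _ y
  have := Real.cos_sub (Real.pi * x) (Real.pi * y)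
  rw [← mul_sub] at this
  exact this

theorem circleCos_le_one (x : AddCircle (2 : ℝ)) : circleCos x ≤ 1 := by
  induction x using QuotientAddGroup.induction_on with | _ x
  exact Real.cos_le_one _

theorem neg_one_le_circleCos (x : AddCircle (2 : ℝ)) : -1 ≤ circleCos x := by
  induction x using QuotientAddGroup.induction_on with | _ x
  exact Real.neg_one_le_cos _

theorem circleCos_eq_one {x : AddCircle (2 : ℝ)} (h : circleCos x = 1) : x = 0 := by
  induction x using QuotientAddGroup.induction_on with | _ x
  obtain ⟨k, hk⟩ := (Real.cos_eq_one_iff (Real.pi * x)).1 h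
  refine (AddCircle.coe_eq_zero_iff (2 : ℝ)).2 ⟨k, ?_⟩
  have hpi := Real.pi_pos.ne'
  have : Real.pi * (k * 2) = Real.pi * x := by linarith
  simpa using mul_left_cancel₀ hpi this

/-- A smooth function on the torus with values in `[0,1]` which is `1` at the origin only. -/
def peak (x : Torus d) : ℝ := ∏ i, (1 + circleCos (x i)) / 2

theorem torusSmooth_circleCos (i : Fin d) : TorusSmooth (fun x : Torus d => circleCos (x i)) := by
  change ContDiff ℝ ∞ (fun y : Fin d → ℝ => Real.cos (Real.pi * y i))
  fun_prop

theorem torusSmooth_circleSin (i : Fin d) : TorusSmooth (fun x : Torus d => circleSin (x i)) := by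
  change ContDiff ℝ ∞ (fun y : Fin d → ℝ => Real.sin (Real.pi * y i))
  fun_prop

theorem torusSmooth_peak : TorusSmooth (peak (d := d)) := by
  change ContDiff ℝ ∞ (fun y : Fin d → ℝ => ∏ i, (1 + Real.cos (Real.pi * y i)) / 2)
  fun_prop

theorem continuous_peak : Continuous (peak (d := d)) := torusSmooth_peak.one.continuous

theorem peak_nonneg (x : Torus d) : 0 ≤ peak x :=
  Finset.prod_nonneg fun i _ => by linarith [neg_one_le_circleCos (x i)]

theorem peak_zero : peak (0 : Torus d) = 1 := by
  have h : circleCos 0 = 1 := by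
    rw [← AddCircle.coe_zero, circleCos_coe]; simp
  simp [peak, h]

theorem peak_lt_one {x : Torus d} (hx : x ≠ 0) : peak x < 1 := by
  obtain ⟨i, hi⟩ := Function.ne_iff.1 hx
  have h1 : (1 + circleCos (x i)) / 2 < 1 := by
    have := lt_of_le_of_ne (circleCos_le_one (x i)) (fun h => hi (circleCos_eq_one h))
    linarith
  unfold peak
  rw [← Finset.mul_prod_erase _ _ (Finset.mem_univ i)]
  refine lt_of_le_of_lt (mul_le_of_le_one_right ?_ (Finset.prod_le_one ?_ ?_)) h1
  · linarith [neg_one_le_circleCos (x i)]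
  · intro k _; linarith [neg_one_le_circleCos (x k)]
  · intro k _; linarith [circleCos_le_one (x k)]

theorem integral_peak_pow_pos (n : ℕ) : 0 < ∫ x : Torus d, peak x ^ n := by
  refine (continuous_peak.pow n).integral_pos_of_hasCompactSupport_nonneg_nonzero
    (HasCompactSupport.of_compactSpace _) (fun x => pow_nonneg (peak_nonneg x) n) (x := 0) ?_
  simp [peak_zero]

/-- The normalized powers of `peak`. -/
def kernel (n : ℕ) (x : Torus d) : ℝ := (∫ y : Torus d, peak y ^ n)⁻¹ * peak x ^ n

theorem kernel_nonneg (n : ℕ) (x : Torus d) : 0 ≤ kernel n x :=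
  mul_nonneg (inv_nonneg.2 (integral_peak_pow_pos n).le) (pow_nonneg (peak_nonneg x) n)

theorem torusSmooth_kernel (n : ℕ) : TorusSmooth (kernel (d := d) n) :=
  contDiff_const.mul (ContDiff.pow torusSmooth_peak n)

theorem continuous_kernel (n : ℕ) : Continuous (kernel (d := d) n) :=
  (torusSmooth_kernel n).one.continuous

theorem integral_kernel (n : ℕ) : ∫ x : Torus d, kernel n x = 1 := by
  simp only [kernel, integral_const_mul]
  exact inv_mul_cancel₀ (integral_peak_pow_pos n).ne'

/-- `k (x - y) = ∑ a_m(x) a_m(y)` with finitely many smooth `a_m`. -/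
def HasFiniteRank (k : Torus d → ℝ) : Prop :=
  ∃ (ι : Type) (_ : Fintype ι) (a : ι → Torus d → ℝ), (∀ m, TorusSmooth (a m)) ∧
    ∀ x y, k (x - y) = ∑ m, a m x * a m y

theorem hasFiniteRank_const {c : ℝ} (hc : 0 ≤ c) : HasFiniteRank (fun _ : Torus d => c) :=
  ⟨Unit, inferInstance, fun _ _ => Real.sqrt c, fun _ => torusContDiff_const _, by simp [hc]⟩

theorem HasFiniteRank.mul {k l : Torus d → ℝ} (hk : HasFiniteRank k) (hl : HasFiniteRank l) :
    HasFiniteRank (fun x => k x * l x) := by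
  obtain ⟨ι, _, a, ha, hka⟩ := hk
  obtain ⟨κ, _, b, hb, hlb⟩ := hl
  refine ⟨ι × κ, inferInstance, fun m x => a m.1 x * b m.2 x,
    fun m => TorusContDiff.mul (ha m.1).contDiff (hb m.2).contDiff, fun x y => ?_⟩
  simp only [hka, hlb, Finset.sum_mul_sum, Fintype.sum_prod_type]
  exact Finset.sum_congr rfl fun m _ => Finset.sum_congr rfl fun m' _ => by ring

theorem HasFiniteRank.pow {k : Torus d → ℝ} (hk : HasFiniteRank k) (n : ℕ) :
    HasFiniteRank (fun x => k x ^ n) := by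
  induction n with
  | zero => simpa using hasFiniteRank_const (d := d) zero_le_one
  | succ n ih => simpa only [pow_succ] using ih.mul hk

theorem HasFiniteRank.prod {ι : Type*} {s : Finset ι} {k : ι → Torus d → ℝ}
    (hk : ∀ i, HasFiniteRank (k i)) : HasFiniteRank (fun x => ∏ i ∈ s, k i x) := by
  classical
  induction s using Finset.induction_on with
  | empty => simpa using hasFiniteRank_const (d := d) zero_le_one
  | insert i s hi ih => simpa only [Finset.prod_insert hi] using (hk i).mul ih

/-- Each factor is `(1 + cos π(x - y)) / 2 = 1/2 + (cos πx cos πy + sin πx sin πy) / 2`, and finite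
rank is stable under products. Every mollification is thereby a finite sum of fixed smooth functions
with scalar coefficients, which is how smoothness, symmetry and the separation of time and space are
obtained later. -/
theorem hasFiniteRank_kernel (n : ℕ) : HasFiniteRank (kernel (d := d) n) := by
  refine (hasFiniteRank_const (inv_nonneg.2 (integral_peak_pow_pos n).le)).mul
    (HasFiniteRank.pow (HasFiniteRank.prod fun i => ?_) n)
  -- The weight `1/2` is split evenly because the same functions must appear in both variables.
  have hs : Real.sqrt (1 / 2) * Real.sqrt (1 / 2) = 1 / 2 :=
    Real.mul_self_sqrt (by norm_num)
  refine ⟨Fin 3, inferInstance, ![fun _ => Real.sqrt (1 / 2),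
    fun x => Real.sqrt (1 / 2) * circleCos (x i), fun x => Real.sqrt (1 / 2) * circleSin (x i)],
    fun m => ?_, fun x y => ?_⟩
  · fin_cases m
    · exact torusContDiff_const _
    · exact TorusContDiff.mul (torusContDiff_const _) (torusSmooth_circleCos i).contDiff
    · exact TorusContDiff.mul (torusContDiff_const _) (torusSmooth_circleSin i).contDiff
  · simp only [Fin.sum_univ_three, Pi.sub_apply, circleCos_sub, Matrix.cons_val_zero,
      Matrix.cons_val_one, Matrix.cons_val]
    linear_combination (-(1 + circleCos (x i) * circleCos (y i) +
      circleSin (x i) * circleSin (y i))) * hs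

/-- The convolution of `f` with `kernel n`. -/
def mollify (n : ℕ) (f : Torus d → ℝ) (x : Torus d) : ℝ := ∫ y, kernel n (x - y) * f y

theorem integral_kernel_sub_left (n : ℕ) (x : Torus d) : ∫ y, kernel n (x - y) = 1 := by
  rw [integral_sub_left_eq_self (kernel n) volume x, integral_kernel]

theorem lintegral_kernel (n : ℕ) : ∫⁻ x : Torus d, ENNReal.ofReal (kernel n x) = 1 := by
  rw [← ofReal_integral_eq_lintegral_ofReal ((continuous_kernel n).integrable_of_hasCompactSupport
    (HasCompactSupport.of_compactSpace _)) (Eventually.of_forall (kernel_nonneg n)),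
    integral_kernel, ENNReal.ofReal_one]

/-- Normalized powers of a continuous nonnegative function with a unique maximum concentrate at that
maximum, which for `peak` is the origin. -/
theorem tendsto_mollify_of_continuous {f : Torus d → ℝ} (hf : Continuous f) (x : Torus d) :
    Tendsto (fun n => mollify n f x) atTop (𝓝 (f x)) := by
  have h := tendsto_setIntegral_pow_smul_of_unique_maximum_of_isCompact_of_continuousOn
    (μ := (volume : Measure (Torus d))) (s := univ) (x₀ := 0) (c := peak)
    (g := fun y => f (x - y)) isCompact_univ continuous_peak.continuousOn
    (fun y _ hy => by rw [peak_zero]; exact peak_lt_one hy) (fun y _ => peak_nonneg y)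
    (by rw [peak_zero]; exact one_pos) (by simp) (by fun_prop)
  simp only [sub_zero, Measure.restrict_univ] at h
  refine h.congr fun n => ?_
  unfold mollify
  rw [← integral_sub_left_eq_self (fun y => peak y ^ n • f (x - y)) volume x, smul_eq_mul,
    ← integral_const_mul]
  simp [kernel, mul_assoc]

/-- Hölder's inequality against the constant `1`, whose dual norm is `1` for a probability measure.
-/
theorem rpow_lintegral_le_lintegral_rpow {α : Type*} {m : MeasurableSpace α} {P : Measure α}
    [IsProbabilityMeasure P] {q : ℝ} (hq : 1 ≤ q) {f : α → ℝ≥0∞} (hf : AEMeasurable f P) :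
    (∫⁻ x, f x ∂P) ^ q ≤ ∫⁻ x, f x ^ q ∂P := by
  rcases hq.eq_or_lt with rfl | hq1
  · simp
  have h := ENNReal.lintegral_mul_le_Lp_mul_Lq P (Real.HolderConjugate.conjExponent hq1) hf
    (aemeasurable_const (b := 1))
  simp only [Pi.mul_apply, mul_one, ENNReal.one_rpow, lintegral_const, measure_univ] at h
  calc (∫⁻ x, f x ∂P) ^ q ≤ ((∫⁻ x, f x ^ q ∂P) ^ (1 / q)) ^ q := by gcongr
    _ = _ := by
      rw [← ENNReal.rpow_mul, one_div_mul_cancel (by positivity), ENNReal.rpow_one]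

theorem exists_bound_of_continuous {f : Torus d → ℝ} (hf : Continuous f) :
    ∃ C, 0 ≤ C ∧ ∀ x, |f x| ≤ C := by
  obtain ⟨C, hC⟩ := isCompact_univ.exists_bound_of_continuousOn (f := f) hf.continuousOn
  exact ⟨max C 0, le_max_right _ _, fun x => (hC x (mem_univ x)).trans (le_max_left _ _)⟩

theorem integrable_continuous_mul {f g : Torus d → ℝ} (hf : Continuous f) (hg : Integrable g) :
    Integrable (fun x => f x * g x) := by
  obtain ⟨C, -, hC⟩ := exists_bound_of_continuous hf
  exact hg.bdd_mul hf.aestronglyMeasurable (c := C) (Eventually.of_forall hC)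

theorem integrable_of_continuous {f : Torus d → ℝ} (hf : Continuous f) : Integrable f :=
  hf.integrable_of_hasCompactSupport (HasCompactSupport.of_compactSpace _)

theorem integrable_kernel_mul (n : ℕ) (x : Torus d) {f : Torus d → ℝ} (hf : Integrable f) :
    Integrable (fun y => kernel n (x - y) * f y) :=
  integrable_continuous_mul ((continuous_kernel n).comp (by fun_prop)) hf

theorem mollify_eq_sum {n : ℕ} {ι : Type} [Fintype ι] {a : ι → Torus d → ℝ}
    (ha : ∀ m, TorusSmooth (a m)) (hk : ∀ x y, kernel n (x - y) = ∑ m, a m x * a m y)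
    {f : Torus d → ℝ} (hf : Integrable f) (x : Torus d) :
    mollify n f x = ∑ m, (∫ y, f y * a m y) * a m x := by
  simp only [mollify, hk, Finset.sum_mul]
  rw [integral_finsetSum]
  · refine Finset.sum_congr rfl fun m _ => ?_
    rw [← integral_mul_const]
    congr 1; funext y; ring
  · intro m _
    simpa only [mul_assoc] using (integrable_continuous_mul (ha m).one.continuous hf).const_mul _

theorem torusSmooth_mollify (n : ℕ) {f : Torus d → ℝ} (hf : Integrable f) :
    TorusSmooth (mollify n f) := by
  obtain ⟨ι, _, a, ha, hk⟩ := hasFiniteRank_kernel (d := d) n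
  rw [show mollify n f = fun x => ∑ m, (∫ y, f y * a m y) * a m x from
    funext fun x => mollify_eq_sum ha hk hf x]
  exact TorusContDiff.sum fun m _ => TorusContDiff.mul (torusContDiff_const _) (ha m).contDiff

theorem continuous_mollify (n : ℕ) {f : Torus d → ℝ} (hf : Integrable f) :
    Continuous (mollify n f) := (torusSmooth_mollify n hf).one.continuous

theorem mollify_sub (n : ℕ) {f g : Torus d → ℝ} (hf : Integrable f) (hg : Integrable g)
    (x : Torus d) : mollify n (fun y => f y - g y) x = mollify n f x - mollify n g x := by
  simp only [mollify, mul_sub]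
  exact integral_sub (integrable_kernel_mul n x hf) (integrable_kernel_mul n x hg)

/-- The mollification is symmetric. -/
theorem integral_mollify_mul (n : ℕ) {f g : Torus d → ℝ} (hf : Integrable f) (hg : Integrable g) :
    ∫ x, mollify n f x * g x = ∫ x, f x * mollify n g x := by
  obtain ⟨ι, _, a, ha, hk⟩ := hasFiniteRank_kernel (d := d) n
  have hi : ∀ {u : Torus d → ℝ}, Integrable u → ∀ m, Integrable (fun x => u x * a m x) := by
    intro u hu m
    simpa only [mul_comm] using integrable_continuous_mul (ha m).one.continuous hu
  simp only [mollify_eq_sum ha hk hf, mollify_eq_sum ha hk hg, Finset.sum_mul, Finset.mul_sum]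
  rw [integral_finsetSum, integral_finsetSum]
  · refine Finset.sum_congr rfl fun m _ => ?_
    have h1 : ∀ x, (∫ y, f y * a m y) * a m x * g x = (∫ y, f y * a m y) * (g x * a m x) :=
      fun x => by ring
    have h2 : ∀ x, f x * ((∫ y, g y * a m y) * a m x) = (∫ y, g y * a m y) * (f x * a m x) :=
      fun x => by ring
    simp only [h1, h2, integral_const_mul]
    ring
  · intro m _
    refine ((hi hf m).const_mul (∫ y, g y * a m y)).congr (Eventually.of_forall fun x => ?_)
    ring
  · intro m _
    refine ((hi hg m).const_mul (∫ y, f y * a m y)).congr (Eventually.of_forall fun x => ?_)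
    ring

/-- Jensen's inequality for the probability density `y ↦ ρ(x - y)`, then Tonelli and the unit mass
of `ρ` in the other variable. -/
theorem lintegral_mollify_rpow_le (n : ℕ) {q : ℝ} (hq : 1 ≤ q) {f : Torus d → ℝ}
    (hf : AEStronglyMeasurable f) :
    ∫⁻ x, ‖mollify n f x‖ₑ ^ q ≤ ∫⁻ x, ‖f x‖ₑ ^ q := by
  have hkm : ∀ x : Torus d, Measurable (fun y => ENNReal.ofReal (kernel n (x - y))) := fun x =>
    ((continuous_kernel n).comp (by fun_prop : Continuous fun y => x - y)).measurable.ennreal_ofReal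
  have h1 : ∀ x : Torus d, ‖mollify n f x‖ₑ ^ q ≤
      ∫⁻ y, ENNReal.ofReal (kernel n (x - y)) * ‖f y‖ₑ ^ q := by
    intro x
    have hP : IsProbabilityMeasure
        ((volume : Measure (Torus d)).withDensity fun y => ENNReal.ofReal (kernel n (x - y))) := by
      refine ⟨?_⟩
      rw [withDensity_apply _ MeasurableSet.univ, Measure.restrict_univ,
        lintegral_sub_left_eq_self (fun y => ENNReal.ofReal (kernel n y)) x, lintegral_kernel]
    have hfm : AEMeasurable (fun y => ‖f y‖ₑ)
        ((volume : Measure (Torus d)).withDensity fun y => ENNReal.ofReal (kernel n (x - y))) :=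
      hf.enorm.mono_ac (withDensity_absolutelyContinuous _ _)
    calc ‖mollify n f x‖ₑ ^ q
        ≤ (∫⁻ y, ENNReal.ofReal (kernel n (x - y)) * ‖f y‖ₑ) ^ q := by
          gcongr
          refine (enorm_integral_le_lintegral_enorm _).trans (le_of_eq ?_)
          refine lintegral_congr fun y => ?_
          rw [enorm_mul, Real.enorm_of_nonneg (kernel_nonneg n _)]
      _ = (∫⁻ y, ‖f y‖ₑ ∂((volume : Measure (Torus d)).withDensity
            fun y => ENNReal.ofReal (kernel n (x - y)))) ^ q := by
          rw [lintegral_withDensity_eq_lintegral_mul₀ (hkm x).aemeasurable hf.enorm]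
          rfl
      _ ≤ ∫⁻ y, ‖f y‖ₑ ^ q ∂((volume : Measure (Torus d)).withDensity
            fun y => ENNReal.ofReal (kernel n (x - y))) :=
          rpow_lintegral_le_lintegral_rpow hq hfm
      _ = _ := by
          rw [lintegral_withDensity_eq_lintegral_mul₀ (hkm x).aemeasurable (hf.enorm.pow_const q)]
          rfl
  calc ∫⁻ x, ‖mollify n f x‖ₑ ^ q
      ≤ ∫⁻ x, ∫⁻ y, ENNReal.ofReal (kernel n (x - y)) * ‖f y‖ₑ ^ q := lintegral_mono h1
    _ = ∫⁻ y, ∫⁻ x, ENNReal.ofReal (kernel n (x - y)) * ‖f y‖ₑ ^ q := by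
        refine lintegral_lintegral_swap (AEMeasurable.mul ?_ ?_)
        · exact ((continuous_kernel n).comp (by fun_prop :
            Continuous fun z : Torus d × Torus d => z.1 - z.2)).measurable.ennreal_ofReal.aemeasurable
        · exact (hf.enorm.pow_const q).comp_quasiMeasurePreserving Measure.quasiMeasurePreserving_snd
    _ = ∫⁻ y, ‖f y‖ₑ ^ q := by
        refine lintegral_congr fun y => ?_
        have hm : Measurable (fun x => ENNReal.ofReal (kernel n (x - y))) :=
          ((continuous_kernel n).comp
            (by fun_prop : Continuous fun x => x - y)).measurable.ennreal_ofReal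
        rw [lintegral_mul_const _ hm,
          lintegral_sub_right_eq_self (fun x => ENNReal.ofReal (kernel n x)) y, lintegral_kernel,
          one_mul]

theorem eLpNorm_mollify_le (n : ℕ) {q : ℝ} (hq : 1 ≤ q) {f : Torus d → ℝ}
    (hf : AEStronglyMeasurable f) :
    eLpNorm (mollify n f) (ENNReal.ofReal q) volume ≤ eLpNorm f (ENNReal.ofReal q) volume := by
  have h0 : ENNReal.ofReal q ≠ 0 := by simp; linarith
  rw [eLpNorm_eq_lintegral_rpow_enorm_toReal h0 ENNReal.ofReal_ne_top,
    eLpNorm_eq_lintegral_rpow_enorm_toReal h0 ENNReal.ofReal_ne_top,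
    ENNReal.toReal_ofReal (by linarith)]
  exact ENNReal.rpow_le_rpow (lintegral_mollify_rpow_le n hq hf) (by positivity)

theorem abs_mollify_le (n : ℕ) {f : Torus d → ℝ} {C : ℝ} (hf : ∀ᵐ x, |f x| ≤ C) (x : Torus d) :
    |mollify n f x| ≤ C := by
  have hi : Integrable (fun y => kernel n (x - y)) :=
    integrable_of_continuous ((continuous_kernel n).comp (by fun_prop : Continuous fun y => x - y))
  calc |mollify n f x| = ‖∫ y, kernel n (x - y) * f y‖ := rfl
    _ ≤ ∫ y, kernel n (x - y) * C := by
        refine norm_integral_le_of_norm_le (hi.mul_const C) ?_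
        filter_upwards [hf] with y hy
        rw [norm_mul, Real.norm_of_nonneg (kernel_nonneg n _)]
        exact mul_le_mul_of_nonneg_left hy (kernel_nonneg n _)
    _ = C := by rw [integral_mul_const, integral_kernel_sub_left, one_mul]

theorem tendsto_eLpNorm_mollify_sub_of_continuous {q : ℝ} (hq : 1 ≤ q) {f : Torus d → ℝ}
    (hf : Continuous f) :
    Tendsto (fun n => eLpNorm (fun x => mollify n f x - f x) (ENNReal.ofReal q) volume) atTop
      (𝓝 0) := by
  have h0 : ENNReal.ofReal q ≠ 0 := by simp; linarith
  have hq0 : 0 < q := by linarith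
  obtain ⟨C, hC0, hC⟩ := exists_bound_of_continuous hf
  have h : Tendsto (fun n => ∫⁻ x, ‖mollify n f x - f x‖ₑ ^ q) atTop (𝓝 (∫⁻ _ : Torus d, 0)) := by
    refine tendsto_lintegral_of_dominated_convergence (fun _ => ENNReal.ofReal (2 * C) ^ q)
      (fun n => ?_) (fun n => Eventually.of_forall fun x => ?_) ?_
      (Eventually.of_forall fun x => ?_)
    · exact ((continuous_mollify n (integrable_of_continuous hf)).sub
        hf).measurable.enorm.pow_const q
    · refine ENNReal.rpow_le_rpow ?_ hq0.le
      rw [← ofReal_norm]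
      refine ENNReal.ofReal_le_ofReal ((norm_sub_le _ _).trans ?_)
      have h1 := abs_mollify_le n (Eventually.of_forall hC) x
      have h2 := hC x
      rw [Real.norm_eq_abs, Real.norm_eq_abs]
      linarith
    · rw [lintegral_const]
      exact ENNReal.mul_ne_top (ENNReal.rpow_ne_top_of_nonneg hq0.le ENNReal.ofReal_ne_top)
        (measure_ne_top _ _)
    · have h1 : Tendsto (fun n => mollify n f x - f x) atTop (𝓝 0) := by
        simpa using (tendsto_mollify_of_continuous hf x).sub_const (f x)
      have h2 := (ENNReal.continuous_rpow_const (y := q)).tendsto 0 |>.comp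
        (by simpa using h1.enorm : Tendsto (fun n => ‖mollify n f x - f x‖ₑ) atTop (𝓝 0))
      simpa [ENNReal.zero_rpow_of_pos hq0, Function.comp_def] using h2
  have h3 := (ENNReal.continuous_rpow_const (y := 1 / q)).tendsto _ |>.comp h
  simp only [lintegral_zero, ENNReal.zero_rpow_of_pos (one_div_pos.2 hq0)] at h3
  refine h3.congr fun n => ?_
  rw [eLpNorm_eq_lintegral_rpow_enorm_toReal h0 ENNReal.ofReal_ne_top,
    ENNReal.toReal_ofReal (by linarith)]
  rfl

/-- Continuous functions are dense in `L^q` and mollification is a contraction there. The three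
errors, from mollifying `f - g`, from `g` itself and from `f - g`, are each at most `ε / 4`. -/
theorem tendsto_eLpNorm_mollify_sub {q : ℝ} (hq : 1 ≤ q) {f : Torus d → ℝ}
    (hf : MemLp f (ENNReal.ofReal q) volume) :
    Tendsto (fun n => eLpNorm (fun x => mollify n f x - f x) (ENNReal.ofReal q) volume) atTop
      (𝓝 0) := by
  have hq1 : 1 ≤ ENNReal.ofReal q := by simpa using hq
  rw [ENNReal.tendsto_nhds_zero]
  intro ε hε
  have hε4 : ε / 4 ≠ 0 := by simp [hε.ne']
  obtain ⟨g, hg, hgm⟩ := hf.exists_boundedContinuous_eLpNorm_sub_le ENNReal.ofReal_ne_top hε4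
  filter_upwards [ENNReal.tendsto_nhds_zero.1
    (tendsto_eLpNorm_mollify_sub_of_continuous hq g.continuous) (ε / 4) (pos_iff_ne_zero.2 hε4)]
    with n hn
  have hfi : Integrable f := hf.integrable hq1
  have hgi : Integrable g := integrable_of_continuous g.continuous
  have hd : (fun x => mollify n f x - f x) = (mollify n (fun y => f y - g y) +
      ((fun x => mollify n g x - g x) - (fun x => f x - g x))) := by
    funext x
    simp only [Pi.add_apply, Pi.sub_apply, mollify_sub n hfi hgi]
    ring
  have hm : AEStronglyMeasurable (fun x => f x - g x) := hf.1.sub hgi.1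
  rw [hd]
  calc _ ≤ eLpNorm (mollify n (fun y => f y - g y)) (ENNReal.ofReal q) volume +
        (eLpNorm (fun x => mollify n g x - g x) (ENNReal.ofReal q) volume +
          eLpNorm (fun x => f x - g x) (ENNReal.ofReal q) volume) := by
        refine (eLpNorm_add_le (continuous_mollify n (hfi.sub hgi)).aestronglyMeasurable
          (((continuous_mollify n hgi).sub g.continuous).aestronglyMeasurable.sub hm) hq1).trans ?_
        exact add_le_add le_rfl
          (eLpNorm_sub_le ((continuous_mollify n hgi).sub g.continuous).aestronglyMeasurable hm hq1)
    _ ≤ ε / 4 + (ε / 4 + ε / 4) :=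
        add_le_add ((eLpNorm_mollify_le n hq hm).trans hg) (add_le_add hn hg)
    _ ≤ ε / 4 + (ε / 4 + ε / 4) + ε / 4 := le_self_add
    _ = ε / 4 * 4 := by ring
    _ = ε := ENNReal.div_mul_cancel (by norm_num) (by norm_num)

/-! ### Derivatives of mollified functions -/

theorem pderiv_mollify_eq_sum {n : ℕ} {ι : Type} [Fintype ι] {a : ι → Torus d → ℝ}
    (ha : ∀ m, TorusSmooth (a m)) (hk : ∀ x y, kernel n (x - y) = ∑ m, a m x * a m y)
    {f : Torus d → ℝ} (hf : Integrable f) (j : Fin d) (x : Torus d) :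
    pderiv j (mollify n f) x = ∑ m, (∫ y, f y * a m y) * pderiv j (a m) x := by
  rw [show mollify n f = fun x => ∑ m, (∫ y, f y * a m y) * a m x from
    funext fun x => mollify_eq_sum ha hk hf x,
    pderiv_sum (fun m _ => TorusContDiff.mul (torusContDiff_const _) (ha m).one)]
  exact Finset.sum_congr rfl fun m _ => pderiv_const_mul _ (ha m).one j x

theorem pderiv_mollify (n : ℕ) {f : Torus d → ℝ} (hf : Integrable f) (j : Fin d) (x : Torus d) :
    pderiv j (mollify n f) x = ∫ y, pderiv j (kernel n) (x - y) * f y := by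
  obtain ⟨ι, _, a, ha, hk⟩ := hasFiniteRank_kernel (d := d) n
  rw [pderiv_mollify_eq_sum ha hk hf]
  have h : ∀ y, pderiv j (kernel n) (x - y) = ∑ m, a m y * pderiv j (a m) x := by
    intro y
    rw [← pderiv_sub_right j x y]
    have : (fun x => kernel n (x - y)) = fun x => ∑ m, a m y * a m x := by
      funext x; rw [hk]; exact Finset.sum_congr rfl fun m _ => mul_comm _ _
    rw [this, pderiv_sum (fun m _ => TorusContDiff.mul (torusContDiff_const _) (ha m).one)]
    exact Finset.sum_congr rfl fun m _ => pderiv_const_mul _ (ha m).one j x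
  simp only [h, Finset.sum_mul]
  rw [integral_finsetSum]
  · refine Finset.sum_congr rfl fun m _ => ?_
    rw [← integral_mul_const]
    congr 1; funext y; ring
  · intro m _
    refine ((integrable_continuous_mul (ha m).one.continuous hf).mul_const
      (pderiv j (a m) x)).congr (Eventually.of_forall fun y => ?_)
    ring

/-- The function `y ↦ ρ(x - y)` is an admissible test function; its derivative in `y` carries a
minus sign that cancels the one in the definition of the weak derivative. -/
theorem HasWeakDeriv.pderiv_mollify {j : Fin d} {f g : Torus d → ℝ} (h : HasWeakDeriv j f g)
    (n : ℕ) (x : Torus d) : pderiv j (mollify n f) x = mollify n g x := by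
  rw [DissipativeFluid.pderiv_mollify n h.1]
  have h1 := h.2.2 (fun y => kernel n (x - y))
    (TorusContDiff.comp_sub_left (torusSmooth_kernel n).contDiff x)
  simp only [pderiv_sub_left (torusSmooth_kernel n).one, mul_neg, integral_neg, neg_inj] at h1
  simp only [mollify, mul_comm (kernel n _), ← h1]
  congr 1; funext y; ring

/-- Again `ρ(x - ·)` is the test function. Mollified solenoidal fields are therefore solenoidal in
the classical sense, hence admissible in the momentum equation. -/
theorem WeaklyDivFree.sum_pderiv_mollify {u : Torus d → Fin d → ℝ} (hu : WeaklyDivFree u)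
    (n : ℕ) (x : Torus d) : ∑ i, pderiv i (mollify n fun y => u y i) x = 0 := by
  simp only [fun i => DissipativeFluid.pderiv_mollify n (hu.1 i)]
  have h1 := hu.2 (fun y => kernel n (x - y))
    (TorusContDiff.comp_sub_left (torusSmooth_kernel n).contDiff x)
  have hi : ∀ i ∈ Finset.univ, Integrable (fun y => pderiv i (kernel n) (x - y) * u y i) :=
    fun i _ => integrable_continuous_mul
      (((torusSmooth_kernel n).pderiv i).one.continuous.comp (by fun_prop)) (hu.1 i)
  rw [← integral_finsetSum _ hi]
  simp only [pderiv_sub_left (torusSmooth_kernel n).one, mul_neg, Finset.sum_neg_distrib,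
    integral_neg, neg_eq_zero] at h1
  rw [← h1]
  congr 1; funext y
  exact Finset.sum_congr rfl fun i _ => mul_comm _ _

/-! ### Limits of integrals containing mollifications -/

theorem tendsto_integral_abs_mollify_sub {f : Torus d → ℝ} (hf : Integrable f) :
    Tendsto (fun n => ∫ x, |mollify n f x - f x|) atTop (𝓝 0) := by
  have h := tendsto_eLpNorm_mollify_sub (le_refl (1 : ℝ)) (f := f)
    (by simpa using memLp_one_iff_integrable.2 hf)
  have h2 := (ENNReal.tendsto_toReal ENNReal.zero_ne_top).comp h
  simp only [ENNReal.toReal_zero] at h2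
  refine h2.congr fun n => ?_
  have hm : AEStronglyMeasurable (fun x => mollify n f x - f x) :=
    (continuous_mollify n hf).aestronglyMeasurable.sub hf.1
  simp only [Function.comp_apply, ENNReal.ofReal_one]
  rw [eLpNorm_one_eq_lintegral_enorm, ← integral_norm_eq_lintegral_enorm hm]
  rfl

theorem integrable_of_memLp_two {f : Torus d → ℝ} (hf : MemLp f 2 volume) : Integrable f :=
  hf.integrable (by norm_num)

theorem memLp_two_of_continuous {f : Torus d → ℝ} (hf : Continuous f) : MemLp f 2 volume := by
  obtain ⟨C, -, hC⟩ := exists_bound_of_continuous hf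
  exact MemLp.of_bound hf.aestronglyMeasurable C (Eventually.of_forall hC)

theorem integral_abs_mul_le {f g : Torus d → ℝ} (hf : MemLp f 2 volume) (hg : MemLp g 2 volume) :
    ∫ x, |f x * g x| ≤ (eLpNorm f 2 volume).toReal * (eLpNorm g 2 volume).toReal := by
  have h := eLpNorm_smul_le_mul_eLpNorm (p := 2) (q := 2) (r := 1) hg.1 hf.1
  rw [← ENNReal.toReal_mul]
  have h1 := integral_norm_eq_lintegral_enorm (hf.1.mul hg.1)
  simp only [Real.norm_eq_abs, Pi.mul_apply] at h1
  rw [h1]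
  refine ENNReal.toReal_mono (ENNReal.mul_ne_top hf.2.ne hg.2.ne) ?_
  rw [eLpNorm_one_eq_lintegral_enorm] at h
  exact h

theorem tendsto_integral_abs_mul_mollify_sub {f g : Torus d → ℝ} (hf : MemLp f 2 volume)
    (hg : MemLp g 2 volume) :
    Tendsto (fun n => ∫ x, |g x * (mollify n f x - f x)|) atTop (𝓝 0) := by
  have h := tendsto_eLpNorm_mollify_sub one_le_two (f := f) (by simpa using hf)
  have h2 := ((ENNReal.tendsto_toReal ENNReal.zero_ne_top).comp h).const_mul
    (eLpNorm g 2 volume).toReal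
  simp only [ENNReal.toReal_zero, mul_zero] at h2
  refine squeeze_zero (fun n => integral_nonneg fun x => abs_nonneg _) (fun n => ?_) h2
  have := integral_abs_mul_le hg
    ((memLp_two_of_continuous (continuous_mollify n (integrable_of_memLp_two hf))).sub hf)
  simp only [Function.comp_apply, ENNReal.ofReal_ofNat]
  exact this

/-- Products of sequences converging in `L¹` with bounded sequences. -/
theorem tendsto_integral_mul_of_bounded {h b : ℕ → Torus d → ℝ} {M : ℝ}
    (hh : Tendsto (fun n => ∫ x, |h n x|) atTop (𝓝 0)) (hi : ∀ n, Integrable (h n))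
    (hb : ∀ n, ∀ᵐ x, |b n x| ≤ M) : Tendsto (fun n => ∫ x, h n x * b n x) atTop (𝓝 0) := by
  rw [tendsto_zero_iff_norm_tendsto_zero]
  have h2 := hh.mul_const M
  rw [zero_mul] at h2
  refine squeeze_zero (fun n => norm_nonneg _) (fun n => ?_) h2
  rw [← integral_mul_const]
  refine norm_integral_le_of_norm_le ((hi n).abs.mul_const M) ?_
  filter_upwards [hb n] with x hx
  rw [norm_mul]
  exact mul_le_mul_of_nonneg_left hx (abs_nonneg _)

theorem tendsto_integral_mollify_mul {f g : Torus d → ℝ} (hf : MemLp f 2 volume)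
    (hg : MemLp g 2 volume) :
    Tendsto (fun n => ∫ x, g x * mollify n f x) atTop (𝓝 (∫ x, g x * f x)) := by
  have hi : ∀ n, MemLp (mollify n f) 2 volume := fun n =>
    memLp_two_of_continuous (continuous_mollify n (integrable_of_memLp_two hf))
  have h := tendsto_integral_mul_of_bounded (b := fun _ _ => 1) (M := 1)
    (tendsto_integral_abs_mul_mollify_sub hf hg)
    (fun n => hg.integrable_mul ((hi n).sub hf)) (fun n => by simp)
  rw [← sub_zero (∫ x, g x * f x), ← tendsto_sub_nhds_zero_iff]
  refine h.congr fun n => ?_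
  have h3 : Integrable (fun x => g x * mollify n f x) := hg.integrable_mul (hi n)
  have h4 : Integrable (fun x => g x * f x) := hg.integrable_mul hf
  rw [sub_zero, ← integral_sub h3 h4]
  simp [mul_sub]

/-- If all mollifications are bounded by `M`, so is the function. -/
theorem ae_abs_le_of_abs_mollify_le {f : Torus d → ℝ} (hf : Integrable f) {M : ℝ}
    (h : ∀ n x, |mollify n f x| ≤ M) : ∀ᵐ x, |f x| ≤ M := by
  have h1 := tendsto_eLpNorm_mollify_sub (le_refl (1 : ℝ)) (f := f)
    (by simpa using memLp_one_iff_integrable.2 hf)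
  rw [ENNReal.ofReal_one] at h1
  obtain ⟨ns, -, hns⟩ := (tendstoInMeasure_of_tendsto_eLpNorm one_ne_zero
    (fun n => (continuous_mollify n hf).aestronglyMeasurable) hf.1 h1).exists_seq_tendsto_ae
  filter_upwards [hns] with x hx
  exact le_of_tendsto hx.abs (Eventually.of_forall fun k => h _ x)

/-! ### Boundedness of functions in fractional Sobolev spaces -/

/-- For the maximum distance balls are products of arcs of length `2 r`; `r ≤ 1` prevents the arcs
from wrapping around the circle of length `2`. -/
theorem volume_closedBall_torus (x : Torus d) {r : ℝ} (h0 : 0 ≤ r) (h1 : r ≤ 1) :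
    volume (Metric.closedBall x r) = ENNReal.ofReal ((2 * r) ^ d) := by
  rw [volume_pi_closedBall _ h0]
  simp only [AddCircle.volume_closedBall]
  rw [min_eq_right (by linarith), Finset.prod_const, Finset.card_univ, Fintype.card_fin,
    ENNReal.ofReal_pow (by linarith)]

theorem enorm_sub_average_rpow_le {α : Type*} {m : MeasurableSpace α} {P : Measure α}
    [IsProbabilityMeasure P] {q : ℝ} (hq : 1 ≤ q) {g : α → ℝ} (hg : Integrable g P) (c : ℝ) :
    ‖c - ∫ y, g y ∂P‖ₑ ^ q ≤ ∫⁻ y, ‖c - g y‖ₑ ^ q ∂P := by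
  have h : c - ∫ y, g y ∂P = ∫ y, (c - g y) ∂P := by
    rw [integral_sub (integrable_const c) hg]; simp
  rw [h]
  exact (ENNReal.rpow_le_rpow (enorm_integral_le_lintegral_enorm _) (by linarith)).trans
    (rpow_lintegral_le_lintegral_rpow hq (aestronglyMeasurable_const.sub hg.1).enorm)

/-- Jensen in both variables bounds the left side by the mean of `|g y - g z|^q` over `B × B'`.
There `dist y z ^ e ≤ r ^ e`, so the Gagliardo quotient can be inserted, and the integrals are then
enlarged to the whole torus. -/
theorem enorm_average_sub_average_rpow_le {B B' : Set (Torus d)} (hB : MeasurableSet B)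
    (hB' : MeasurableSet B') (hB0 : volume B ≠ 0) (hB'0 : volume B' ≠ 0) {r e q : ℝ}
    (he : 0 ≤ e) (hq : 1 ≤ q) (hdist : ∀ y ∈ B, ∀ z ∈ B', dist y z ≤ r)
    {g : Torus d → ℝ} (hg : Integrable g) :
    ‖(⨍ y in B, g y) - ⨍ z in B', g z‖ₑ ^ q ≤ (volume B)⁻¹ * ((volume B')⁻¹ *
      (ENNReal.ofReal (r ^ e) *
        ∫⁻ y, ∫⁻ z, ENNReal.ofReal (|g y - g z| ^ q / dist y z ^ e))) := by
  have hq0 : 0 < q := by linarith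
  have hprob : ∀ {A : Set (Torus d)}, volume A ≠ 0 →
      IsProbabilityMeasure ((volume A)⁻¹ • (volume : Measure (Torus d)).restrict A) := by
    intro A hA
    refine ⟨?_⟩
    rw [Measure.smul_apply, Measure.restrict_apply_univ, smul_eq_mul,
      ENNReal.inv_mul_cancel hA (measure_ne_top _ _)]
  have := hprob hB0
  have := hprob hB'0
  have hi : ∀ {A : Set (Torus d)}, volume A ≠ 0 →
      Integrable g ((volume A)⁻¹ • (volume : Measure (Torus d)).restrict A) := fun hA =>
    (hg.mono_measure Measure.restrict_le_self).smul_measure (ENNReal.inv_ne_top.2 hA)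
  rw [setAverage_eq' volume g B, setAverage_eq' volume g B', ← neg_sub, enorm_neg]
  refine (enorm_sub_average_rpow_le hq (hi hB0) _).trans ?_
  rw [lintegral_smul_measure, smul_eq_mul]
  gcongr
  have hpt : ∀ y ∈ B, ∀ z ∈ B', ‖g y - g z‖ₑ ^ q ≤
      ENNReal.ofReal (r ^ e) * ENNReal.ofReal (|g y - g z| ^ q / dist y z ^ e) := by
    intro y hy z hz
    -- On the diagonal the quotient has no meaning, but the left side is zero.
    rcases eq_or_ne y z with rfl | hyz
    · simp [hq0]
    have hd : 0 < dist y z := dist_pos.2 hyz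
    have hr : 0 ≤ r := hd.le.trans (hdist y hy z hz)
    rw [← ENNReal.ofReal_mul (by positivity), ← ofReal_norm, Real.norm_eq_abs,
      ENNReal.ofReal_rpow_of_nonneg (abs_nonneg _) hq0.le]
    refine ENNReal.ofReal_le_ofReal ?_
    rw [← mul_div_assoc, le_div_iff₀ (by positivity), mul_comm]
    gcongr
    exact hdist y hy z hz
  calc ∫⁻ y in B, ‖(∫ z, g z ∂(volume B')⁻¹ • volume.restrict B') - g y‖ₑ ^ q
      ≤ ∫⁻ y in B, (volume B')⁻¹ * (ENNReal.ofReal (r ^ e) *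
          ∫⁻ z, ENNReal.ofReal (|g y - g z| ^ q / dist y z ^ e)) := by
        refine setLIntegral_mono' hB fun y hy => ?_
        rw [← enorm_neg, neg_sub]
        refine (enorm_sub_average_rpow_le hq (hi hB'0) _).trans ?_
        rw [lintegral_smul_measure, smul_eq_mul, ← lintegral_const_mul' _ _ ENNReal.ofReal_ne_top]
        refine mul_le_mul_right ?_ _
        exact (setLIntegral_mono' hB' (hpt y hy)).trans (setLIntegral_le_lintegral _ _)
    _ ≤ ∫⁻ y, (volume B')⁻¹ * (ENNReal.ofReal (r ^ e) *
          ∫⁻ z, ENNReal.ofReal (|g y - g z| ^ q / dist y z ^ e)) := setLIntegral_le_lintegral _ _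
    _ = _ := by
        rw [lintegral_const_mul' _ _ (ENNReal.inv_ne_top.2 hB'0),
          lintegral_const_mul' _ _ ENNReal.ofReal_ne_top]

/-- The embedding `W^{s,p}(𝕋^d) ⊂ L^∞(𝕋^d)` for `s = 1 - 2/p` and `p > d + 2`. -/
theorem exists_ae_bound_of_slobodeckijSeminorm {p : ℝ} (hp : (d : ℝ) + 2 < p) {K : ℝ≥0∞}
    (hK : K ≠ ⊤) : ∃ C : ℝ, 0 ≤ C ∧ ∀ g : Torus d → ℝ, AEStronglyMeasurable g →
      eLpNorm g (ENNReal.ofReal p) volume ≤ K → slobodeckijSeminorm (1 - 2 / p) p g ≤ K →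
      ∀ᵐ x, |g x| ≤ C := by
  have hd0 : (0 : ℝ) ≤ d := Nat.cast_nonneg d
  have hp0 : 0 < p := by linarith
  have hp1 : 1 ≤ p := by linarith
  -- `β = (1 - 2/p) p - d > 0` is the excess over the critical exponent. Averages over balls of
  -- radius `2^{-k}` and `2^{-k-1}` differ by at most `K D θ^k` with `θ = 2^{-β/p} < 1`, so they
  -- stay bounded by a geometric series, and at almost every point they converge to the value of
  -- `g`.
  set β : ℝ := p - 2 - d with hβ
  have hβ0 : 0 < β := by linarith
  set θ : ℝ := (1 / 2) ^ (β / p) with hθ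
  have hθ0 : 0 < θ := by positivity
  have hθ1 : θ < 1 := Real.rpow_lt_one (by norm_num) (by norm_num) (by positivity)
  -- With `r = r k`, the two balls have volumes `(2r)^d` and `r^d`, and the exponent of the distance
  -- is `2d + β`; the quotient `(2r)^(2d+β) / ((2r)^d r^d)` equals `2^d 2^β r^β`, which is `D^p
  -- (θ^k)^p`.
  set D : ℝ := (2 ^ d * 2 ^ β) ^ (1 / p) with hD
  have hD0 : 0 ≤ D := by positivity
  refine ⟨K.toReal + K.toReal * D / (1 - θ), ?_, fun g hgm hgp hgs => ?_⟩
  · have : 0 < 1 - θ := by linarith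
    positivity
  have hmem : MemLp g (ENNReal.ofReal p) volume := ⟨hgm, hgp.trans_lt hK.lt_top⟩
  have hgi : Integrable g := hmem.integrable (by simpa using hp1)
  set r : ℕ → ℝ := fun k => (1 / 2) ^ k with hr
  have hr0 : ∀ k, 0 < r k := fun k => by simp only [hr]; positivity
  have hr1 : ∀ k, r k ≤ 1 := fun k => pow_le_one₀ (by norm_num) (by norm_num)
  have hvol : ∀ k (x : Torus d), volume (Metric.closedBall x (r k)) =
      ENNReal.ofReal ((2 * r k) ^ d) := fun k x =>
    volume_closedBall_torus x (hr0 k).le (hr1 k)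
  have hvol0 : ∀ k (x : Torus d), volume (Metric.closedBall x (r k)) ≠ 0 := fun k x => by
    rw [hvol]
    have := hr0 k
    simp only [ne_eq, ENNReal.ofReal_eq_zero, not_le]
    positivity
  have hstep : ∀ (x : Torus d) k, |(⨍ y in Metric.closedBall x (r k), g y) -
      ⨍ y in Metric.closedBall x (r (k + 1)), g y| ≤ K.toReal * D * θ ^ k := by
    intro x k
    have hk := hr0 k
    have hk1 : r (k + 1) = r k / 2 := by simp only [hr, pow_succ]; ring
    have h1 := enorm_average_sub_average_rpow_le (B := Metric.closedBall x (r k))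
      (B' := Metric.closedBall x (r (k + 1))) measurableSet_closedBall measurableSet_closedBall
      (hvol0 k x) (hvol0 (k + 1) x) (r := 2 * r k) (e := d + (1 - 2 / p) * p) (q := p)
      (by
        have : (1 - 2 / p) * p = p - 2 := by field_simp
        rw [this]; linarith) hp1
      (fun y hy z hz => by
        have h1 := Metric.mem_closedBall.1 hy
        have h2 := Metric.mem_closedBall.1 hz
        have := dist_triangle_right y z x
        rw [hk1] at h2
        linarith) hgi
    have hJ : ∫⁻ y, ∫⁻ z, ENNReal.ofReal (|g y - g z| ^ p /
        dist y z ^ ((d : ℝ) + (1 - 2 / p) * p)) ≤ ENNReal.ofReal (K.toReal ^ p) := by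
      rw [← ENNReal.ofReal_rpow_of_nonneg ENNReal.toReal_nonneg hp0.le, ENNReal.ofReal_toReal hK]
      refine le_trans (le_of_eq ?_) (ENNReal.rpow_le_rpow hgs hp0.le)
      unfold slobodeckijSeminorm
      rw [← ENNReal.rpow_mul, one_div_mul_cancel hp0.ne', ENNReal.rpow_one]
    have h2 : ‖(⨍ y in Metric.closedBall x (r k), g y) -
        ⨍ y in Metric.closedBall x (r (k + 1)), g y‖ₑ ^ p ≤
        ENNReal.ofReal ((K.toReal * D * θ ^ k) ^ p) := by
      refine h1.trans ?_
      rw [hvol, hvol, ← ENNReal.ofReal_inv_of_pos (by positivity),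
        ← ENNReal.ofReal_inv_of_pos (by have := hr0 (k + 1); positivity)]
      refine (mul_le_mul_right (mul_le_mul_right (mul_le_mul_right hJ _) _) _).trans (le_of_eq ?_)
      rw [← ENNReal.ofReal_mul (by positivity), ← ENNReal.ofReal_mul
        (by have := hr0 (k + 1); positivity), ← ENNReal.ofReal_mul (by positivity)]
      congr 1
      have he : (d : ℝ) + (1 - 2 / p) * p = d + d + β := by
        rw [hβ]; field_simp; ring
      have e1 : (K.toReal * D * θ ^ k) ^ p = K.toReal ^ p * D ^ p * (θ ^ k) ^ p := by
        rw [Real.mul_rpow (by positivity) (by positivity),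
          Real.mul_rpow ENNReal.toReal_nonneg hD0]
      have e2 : D ^ p = 2 ^ d * 2 ^ β := by
        rw [hD, ← Real.rpow_mul (by positivity), one_div_mul_cancel hp0.ne', Real.rpow_one]
      have e3 : (θ ^ k) ^ p = r k ^ β := by
        rw [hθ, ← Real.rpow_natCast, ← Real.rpow_mul (by positivity),
          ← Real.rpow_mul (by norm_num)]
        simp only [hr]
        rw [← Real.rpow_natCast, ← Real.rpow_mul (by norm_num)]
        congr 1
        field_simp
      rw [e1, e2, e3, he, hk1, Real.rpow_add (by positivity), Real.rpow_add (by positivity),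
        Real.rpow_natCast, Real.mul_rpow (x := 2) (by norm_num) hk.le]
      have : 2 * (r k / 2) = r k := by ring
      rw [this, mul_pow]
      have h3 : r k ^ d ≠ 0 := by positivity
      field_simp
    have h3 := (ENNReal.rpow_le_rpow_iff hp0).1 (h2.trans_eq (ENNReal.ofReal_rpow_of_nonneg
      (by positivity : 0 ≤ K.toReal * D * θ ^ k) hp0.le).symm)
    rw [← ofReal_norm] at h3
    exact (ENNReal.ofReal_le_ofReal_iff (by positivity)).1 h3
  -- The ball of radius `1` has volume `2^d ≥ 1`, so its average is controlled by the `L^p` norm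
  -- without a further constant.
  have hzero : ∀ x : Torus d, |⨍ y in Metric.closedBall x (r 0), g y| ≤ K.toReal := by
    intro x
    have hv : (1 : ℝ≥0∞) ≤ volume (Metric.closedBall x (r 0)) := by
      rw [hvol]
      simp only [hr, pow_zero, mul_one]
      rw [ENNReal.one_le_ofReal]
      exact one_le_pow₀ (by norm_num)
    have hP : IsProbabilityMeasure ((volume (Metric.closedBall x (r 0)))⁻¹ •
        (volume : Measure (Torus d)).restrict (Metric.closedBall x (r 0))) := by
      refine ⟨?_⟩
      rw [Measure.smul_apply, Measure.restrict_apply_univ, smul_eq_mul,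
        ENNReal.inv_mul_cancel (hvol0 0 x) (measure_ne_top _ _)]
    have h1 := enorm_sub_average_rpow_le hp1
      ((hgi.mono_measure (Measure.restrict_le_self (s := Metric.closedBall x (r 0)))).smul_measure
        (ENNReal.inv_ne_top.2 (hvol0 0 x))) 0
    simp only [zero_sub, enorm_neg] at h1
    rw [← setAverage_eq', lintegral_smul_measure, smul_eq_mul] at h1
    have h2 : ‖⨍ y in Metric.closedBall x (r 0), g y‖ₑ ^ p ≤ K ^ p := by
      refine h1.trans ?_
      calc _ ≤ 1 * ∫⁻ y, ‖g y‖ₑ ^ p :=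
            mul_le_mul' (ENNReal.inv_le_one.2 hv) (setLIntegral_le_lintegral _ _)
        _ = (eLpNorm g (ENNReal.ofReal p) volume) ^ p := by
            rw [eLpNorm_eq_lintegral_rpow_enorm_toReal (by simpa using hp0) ENNReal.ofReal_ne_top,
              ENNReal.toReal_ofReal hp0.le, ← ENNReal.rpow_mul, one_div_mul_cancel hp0.ne',
              ENNReal.rpow_one, one_mul]
        _ ≤ K ^ p := ENNReal.rpow_le_rpow hgp hp0.le
    have h3 := (ENNReal.rpow_le_rpow_iff hp0).1 h2
    have h4 := ENNReal.toReal_mono hK h3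
    simpa using h4
  have hbound : ∀ (x : Torus d) k, |⨍ y in Metric.closedBall x (r k), g y| ≤
      K.toReal + K.toReal * D * ∑ i ∈ Finset.range k, θ ^ i := by
    intro x k
    induction k with
    | zero => simpa using hzero x
    | succ k ih =>
      have h := hstep x k
      rw [Finset.sum_range_succ, mul_add]
      have h2 := abs_sub_abs_le_abs_sub (⨍ y in Metric.closedBall x (r (k + 1)), g y)
        (⨍ y in Metric.closedBall x (r k), g y)
      rw [abs_sub_comm] at h2
      linarith
  filter_upwards [IsUnifLocDoublingMeasure.ae_tendsto_average volume hgi.locallyIntegrable 1] with x hx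
  have hlim := hx (fun _ : ℕ => x) r
    (tendsto_nhdsWithin_iff.2 ⟨tendsto_pow_atTop_nhds_zero_of_lt_one (by norm_num) (by norm_num),
      Eventually.of_forall hr0⟩)
    (Eventually.of_forall fun k => Metric.mem_closedBall_self (by have := hr0 k; linarith))
  refine le_of_tendsto hlim.abs (Eventually.of_forall fun k => (hbound x k).trans ?_)
  have hgeom : ∑ i ∈ Finset.range k, θ ^ i ≤ 1 / (1 - θ) := by
    have h1 := geom_sum_eq hθ1.ne k
    have : 0 < 1 - θ := by linarith
    rw [h1, ← neg_div_neg_eq, neg_sub, neg_sub]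
    gcongr
    have : 0 ≤ θ ^ k := by positivity
    linarith
  rw [mul_div_assoc, div_eq_mul_one_div D]
  rw [mul_assoc]
  have : 0 ≤ K.toReal := ENNReal.toReal_nonneg
  gcongr

/-! ### Consequences of the regularity class -/

theorem eLpNorm_le_traceSpaceNorm {p : ℝ} (f : Torus d → ℝ) :
    eLpNorm f (ENNReal.ofReal p) volume ≤ traceSpaceNorm p f :=
  le_iInf₂ fun _ _ => le_self_add

/-- The strict inequality extracts one weak gradient from the infimum; the embedding bounds it
almost everywhere and mollification preserves the bound. Stated for mollifications, the bound is
pointwise and independent of the choice of a gradient. -/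
theorem exists_bound_pderiv_mollify {p : ℝ} (hp : (d : ℝ) + 2 < p) {K : ℝ≥0∞} (hK : K ≠ ⊤) :
    ∃ C : ℝ, 0 ≤ C ∧ ∀ f : Torus d → ℝ, traceSpaceNorm p f < K →
      ∀ n j x, |pderiv j (mollify n f) x| ≤ C := by
  obtain ⟨C, hC0, hC⟩ := exists_ae_bound_of_slobodeckijSeminorm hp hK
  refine ⟨C, hC0, fun f hf n j x => ?_⟩
  simp only [traceSpaceNorm, iInf_lt_iff] at hf
  obtain ⟨g, hg, hlt⟩ := hf
  rw [(hg j).2.pderiv_mollify]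
  have h : eLpNorm (g j) (ENNReal.ofReal p) volume + slobodeckijSeminorm (1 - 2 / p) p (g j) ≤ K :=
    (Finset.single_le_sum (f := fun j => eLpNorm (g j) (ENNReal.ofReal p) volume +
      slobodeckijSeminorm (1 - 2 / p) p (g j)) (fun _ _ => zero_le) (Finset.mem_univ j)).trans
        (le_add_self.trans hlt.le)
  exact abs_mollify_le n (hC (g j) (hg j).1.1 (le_self_add.trans h) (le_add_self.trans h)) x

/-- Continuity on `I` with values in `L²(𝕋^d)`. -/
def L2ContinuousOn (f : ℝ → Torus d → ℝ) (I : Set ℝ) : Prop :=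
  (∀ t ∈ I, MemLp (f t) 2 volume) ∧
    ∀ t₀ ∈ I, Tendsto (fun t => eLpNorm (fun x => f t x - f t₀ x) 2 volume) (𝓝[I] t₀) (𝓝 0)

theorem L2ContinuousOn.tendsto_eLpNorm {f : ℝ → Torus d → ℝ} {I : Set ℝ} (hf : L2ContinuousOn f I)
    {t₀ : ℝ} (ht₀ : t₀ ∈ I) :
    Tendsto (fun t => (eLpNorm (fun x => f t x - f t₀ x) 2 volume).toReal) (𝓝[I] t₀) (𝓝 0) := by
  have h := (ENNReal.tendsto_toReal ENNReal.zero_ne_top).comp (hf.2 t₀ ht₀)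
  simpa only [ENNReal.toReal_zero] using! h

theorem abs_integral_mul_le {f g : Torus d → ℝ} (hf : MemLp f 2 volume) (hg : MemLp g 2 volume) :
    |∫ x, f x * g x| ≤ (eLpNorm f 2 volume).toReal * (eLpNorm g 2 volume).toReal :=
  (abs_integral_le_integral_abs).trans (integral_abs_mul_le hf hg)

theorem L2ContinuousOn.continuousOn_integral_mul {f g : ℝ → Torus d → ℝ} {I : Set ℝ}
    (hf : L2ContinuousOn f I) (hg : L2ContinuousOn g I) :
    ContinuousOn (fun t => ∫ x, f t x * g t x) I := by
  intro t₀ ht₀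
  have hF := hf.tendsto_eLpNorm ht₀
  have hG := hg.tendsto_eLpNorm ht₀
  have hlim := ((hF.mul hG).add (hF.mul_const (eLpNorm (g t₀) 2 volume).toReal)).add
    (hG.const_mul (eLpNorm (f t₀) 2 volume).toReal)
  simp only [mul_zero, zero_mul, add_zero] at hlim
  rw [ContinuousWithinAt, tendsto_iff_norm_sub_tendsto_zero]
  refine squeeze_zero' (Eventually.of_forall fun _ => norm_nonneg _) ?_ hlim
  filter_upwards [self_mem_nhdsWithin] with t ht
  have hft := hf.1 t ht
  have hf0 := hf.1 t₀ ht₀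
  have hgt := hg.1 t ht
  have hg0 := hg.1 t₀ ht₀
  have hfd : MemLp (fun x => f t x - f t₀ x) 2 volume := hft.sub hf0
  have hgd : MemLp (fun x => g t x - g t₀ x) 2 volume := hgt.sub hg0
  have i1 : Integrable (fun x => (f t x - f t₀ x) * (g t x - g t₀ x)) := hfd.integrable_mul hgd
  have i2 : Integrable (fun x => (f t x - f t₀ x) * g t₀ x) := hfd.integrable_mul hg0
  have i3 : Integrable (fun x => f t₀ x * (g t x - g t₀ x)) := hf0.integrable_mul hgd
  have i4 : Integrable (fun x => f t x * g t x) := hft.integrable_mul hgt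
  have i5 : Integrable (fun x => f t₀ x * g t₀ x) := hf0.integrable_mul hg0
  have i12 : Integrable (fun x => (f t x - f t₀ x) * (g t x - g t₀ x) +
    (f t x - f t₀ x) * g t₀ x) := i1.add i2
  have heq : (∫ x, f t x * g t x) - ∫ x, f t₀ x * g t₀ x =
      (∫ x, (f t x - f t₀ x) * (g t x - g t₀ x)) + (∫ x, (f t x - f t₀ x) * g t₀ x) +
        ∫ x, f t₀ x * (g t x - g t₀ x) := by
    rw [← integral_add i1 i2, ← integral_add i12 i3, ← integral_sub i4 i5]
    congr 1; funext x; ring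
  rw [heq, Real.norm_eq_abs]
  refine (abs_add_three _ _ _).trans (add_le_add_three ?_ ?_ ?_)
  · exact abs_integral_mul_le hfd hgd
  · exact abs_integral_mul_le hfd hg0
  · exact abs_integral_mul_le hf0 hgd

theorem eLpNorm_continuous_mul_le {b f : Torus d → ℝ} {C : ℝ} (hb : ∀ x, |b x| ≤ C) :
    eLpNorm (fun x => b x * f x) 2 volume ≤ ENNReal.ofReal C * eLpNorm f 2 volume := by
  refine eLpNorm_le_mul_eLpNorm_of_ae_le_mul (Eventually.of_forall fun x => ?_) 2
  rw [norm_mul]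
  exact mul_le_mul_of_nonneg_right (hb x) (norm_nonneg _)

theorem memLp_two_continuous_mul {b f : Torus d → ℝ} (hb : Continuous b)
    (hf : MemLp f 2 volume) : MemLp (fun x => b x * f x) 2 volume := by
  obtain ⟨C, -, hC⟩ := exists_bound_of_continuous hb
  exact ⟨hb.aestronglyMeasurable.mul hf.1, (eLpNorm_continuous_mul_le hC).trans_lt
    (ENNReal.mul_lt_top ENNReal.ofReal_lt_top hf.2)⟩

theorem eventually_abs_sub_le_of_continuous {φ : ℝ → Torus d → ℝ}
    (hφ : Continuous (fun z : ℝ × Torus d => φ z.1 z.2)) (t₀ : ℝ) {ε : ℝ} (hε : 0 < ε) :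
    ∀ᶠ t in 𝓝 t₀, ∀ x, |φ t x - φ t₀ x| ≤ ε := by
  have h : ContinuousOn (Function.uncurry fun t x => φ t x) (univ ×ˢ univ) := hφ.continuousOn
  have h2 := (isCompact_univ (X := Torus d)).mem_uniformity_of_prod (s := univ) (q := t₀) h
    (mem_univ t₀) (Metric.dist_mem_uniformity hε)
  obtain ⟨v, hv, hv2⟩ := h2
  rw [nhdsWithin_univ] at hv
  filter_upwards [hv] with t ht x
  have := hv2 t ht x (mem_univ x)
  exact le_of_lt this

theorem L2ContinuousOn.continuous_mul {f φ : ℝ → Torus d → ℝ} {I : Set ℝ}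
    (hf : L2ContinuousOn f I) (hφ : Continuous (fun z : ℝ × Torus d => φ z.1 z.2)) :
    L2ContinuousOn (fun t x => φ t x * f t x) I := by
  have hφt : ∀ t, Continuous (φ t) := fun t => hφ.comp (continuous_const.prodMk continuous_id)
  refine ⟨fun t ht => memLp_two_continuous_mul (hφt t) (hf.1 t ht), fun t₀ ht₀ => ?_⟩
  obtain ⟨C, hC0, hC⟩ := exists_bound_of_continuous (hφt t₀)
  have hf0 := hf.1 t₀ ht₀
  rw [ENNReal.tendsto_nhds_zero]
  intro ε hε
  have hlim : Tendsto (fun δ : ℝ => ENNReal.ofReal δ * eLpNorm (f t₀) 2 volume) (𝓝[>] 0) (𝓝 0) := by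
    have h1 : Tendsto (fun δ : ℝ => ENNReal.ofReal δ) (𝓝[>] 0) (𝓝 0) := by
      simpa using (ENNReal.continuous_ofReal.tendsto 0).mono_left nhdsWithin_le_nhds
    simpa using ENNReal.Tendsto.mul_const h1 (Or.inr hf0.2.ne)
  have hε2 : 0 < ε / 2 := ENNReal.half_pos hε.ne'
  -- `δ` is so small that replacing `φ t` by `φ t₀` costs at most `ε / 2` on `f t₀`. The constant `C
  -- + 1` below bounds `φ t` as soon as it is uniformly within `1` of `φ t₀`; both uniform estimates
  -- come from compactness of the torus.
  obtain ⟨δ, hδ, hδ0⟩ := ((ENNReal.tendsto_nhds_zero.1 hlim _ hε2).and self_mem_nhdsWithin).exists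
  have hlim2 : Tendsto (fun t => ENNReal.ofReal (C + 1) *
      eLpNorm (fun x => f t x - f t₀ x) 2 volume) (𝓝[I] t₀) (𝓝 0) := by
    simpa using ENNReal.Tendsto.const_mul (hf.2 t₀ ht₀) (Or.inr ENNReal.ofReal_ne_top)
  filter_upwards [self_mem_nhdsWithin, ENNReal.tendsto_nhds_zero.1 hlim2 _ hε2,
    nhdsWithin_le_nhds (eventually_abs_sub_le_of_continuous hφ t₀ hδ0),
    nhdsWithin_le_nhds (eventually_abs_sub_le_of_continuous hφ t₀ one_pos)] with t ht h1 h2 h3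
  have hft := hf.1 t ht
  have hd : (fun x => φ t x * f t x - φ t₀ x * f t₀ x) =
      (fun x => φ t x * (f t x - f t₀ x)) + fun x => (φ t x - φ t₀ x) * f t₀ x := by
    funext x; simp only [Pi.add_apply]; ring
  rw [hd]
  calc _ ≤ _ := eLpNorm_add_le ((hφt t).aestronglyMeasurable.mul (hft.1.sub hf0.1))
        (((hφt t).sub (hφt t₀)).aestronglyMeasurable.mul hf0.1) (by norm_num)
    _ ≤ ε / 2 + ε / 2 := by
        refine add_le_add ((eLpNorm_continuous_mul_le fun x => ?_).trans h1)
          ((eLpNorm_continuous_mul_le h2).trans hδ)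
        have h4 := abs_sub_abs_le_abs_sub (φ t x) (φ t₀ x)
        linarith [h3 x, hC x]
    _ = ε := ENNReal.add_halves ε

theorem L2ContinuousOn.continuousOn_integral_mul_continuous {f φ : ℝ → Torus d → ℝ} {I : Set ℝ}
    (hf : L2ContinuousOn f I) (hφ : Continuous (fun z : ℝ × Torus d => φ z.1 z.2)) :
    ContinuousOn (fun t => ∫ x, f t x * φ t x) I := by
  have h1 : L2ContinuousOn (fun (_ : ℝ) (_ : Torus d) => (1 : ℝ)) I :=
    ⟨fun t _ => memLp_two_of_continuous continuous_const, fun t _ => by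
      simpa using tendsto_const_nhds⟩
  refine (h1.continuousOn_integral_mul (hf.continuous_mul hφ)).congr fun t _ => ?_
  simp [mul_comm]

section Regularity

variable {p T : ℝ} {v : ℝ → Torus d → Fin d → ℝ}

theorem InRegularityClass.integrable (hp : (d : ℝ) + 2 < p) (h : InRegularityClass p T v) {t : ℝ}
    (ht : t ∈ Icc 0 T) (i : Fin d) : Integrable (fun x => v t x i) := by
  refine (h.mem_traceSpace t ht i).1.integrable ?_
  have hd0 : (0 : ℝ) ≤ d := Nat.cast_nonneg d
  rw [ENNReal.one_le_ofReal]; linarith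

theorem InRegularityClass.l2ContinuousOn (hp : (d : ℝ) + 2 < p) (h : InRegularityClass p T v)
    (i : Fin d) : L2ContinuousOn (fun t x => v t x i) (Icc 0 T) := by
  have hd0 : (0 : ℝ) ≤ d := Nat.cast_nonneg d
  have hp2 : (2 : ℝ≥0∞) ≤ ENNReal.ofReal p := by
    rw [← ENNReal.ofReal_ofNat 2]
    exact ENNReal.ofReal_le_ofReal (by linarith)
  refine ⟨fun t ht => (h.mem_traceSpace t ht i).1.mono_exponent hp2, fun t₀ ht₀ => ?_⟩
  set c : ℝ≥0∞ := (volume (univ : Set (Torus d))) ^ (1 / (2 : ℝ≥0∞).toReal -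
    1 / (ENNReal.ofReal p).toReal) with hc
  have hctop : c ≠ ⊤ := by
    refine ENNReal.rpow_ne_top_of_nonneg ?_ (measure_ne_top _ _)
    rw [ENNReal.toReal_ofReal (by linarith)]
    simp only [ENNReal.toReal_ofNat, sub_nonneg]
    exact one_div_le_one_div_of_le (by norm_num) (by linarith)
  have hlim : Tendsto (fun t => traceSpaceNorm p (fun x => v t x i - v t₀ x i) * c)
      (𝓝[Icc 0 T] t₀) (𝓝 0) := by
    simpa using ENNReal.Tendsto.mul_const (h.continuous_traceSpace t₀ ht₀ i) (Or.inr hctop)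
  refine tendsto_of_tendsto_of_tendsto_of_le_of_le' tendsto_const_nhds hlim
    (Eventually.of_forall fun _ => zero_le) ?_
  filter_upwards [self_mem_nhdsWithin] with t ht
  refine (eLpNorm_le_eLpNorm_mul_rpow_measure_univ hp2
    ((h.mem_traceSpace t ht i).1.1.sub (h.mem_traceSpace t₀ ht₀ i).1.1)).trans ?_
  gcongr
  exact eLpNorm_le_traceSpaceNorm _

/-- Near `t₀` write `v t = (v t - v t₀) + v t₀`: the first term has trace norm below `1`, the second
a fixed finite one. Mollification is linear, so the two gradient bounds add and no triangle
inequality for the trace norm is needed. Compactness of `[0,T]` makes the bound uniform. -/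
theorem InRegularityClass.exists_bound_pderiv_mollify (hp : (d : ℝ) + 2 < p)
    (h : InRegularityClass p T v) : ∃ M : ℝ, 0 ≤ M ∧ ∀ t ∈ Icc 0 T, ∀ i j n x,
      |pderiv j (mollify n fun y => v t y i) x| ≤ M := by
  have hi : ∀ i, ∃ M : ℝ, 0 ≤ M ∧ ∀ t ∈ Icc 0 T, ∀ j n x,
      |pderiv j (mollify n fun y => v t y i) x| ≤ M := by
    intro i
    obtain ⟨C₁, hC₁0, hC₁⟩ := DissipativeFluid.exists_bound_pderiv_mollify hp ENNReal.one_ne_top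
    -- Membership in `[0,T]` occurs twice because the compactness induction replaces only the first
    -- occurrence, by sets that need not lie in `[0,T]`.
    have hcomp : ∃ M : ℝ, 0 ≤ M ∧ ∀ t ∈ Icc 0 T, t ∈ Icc 0 T → ∀ j n x,
        |pderiv j (mollify n fun y => v t y i) x| ≤ M := by
      refine IsCompact.induction_on (p := fun s => ∃ M : ℝ, 0 ≤ M ∧ ∀ t ∈ s, t ∈ Icc 0 T →
        ∀ j n x, |pderiv j (mollify n fun y => v t y i) x| ≤ M) (isCompact_Icc (a := 0) (b := T))
        ⟨0, le_rfl, by simp⟩ ?_ ?_ ?_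
      · rintro s s' hs ⟨M, hM0, hM⟩
        exact ⟨M, hM0, fun t ht => hM t (hs ht)⟩
      · rintro s s' ⟨M, hM0, hM⟩ ⟨M', hM'0, hM'⟩
        refine ⟨max M M', hM0.trans (le_max_left _ _), fun t ht htT j n x => ?_⟩
        rcases ht with ht | ht
        · exact (hM t ht htT j n x).trans (le_max_left _ _)
        · exact (hM' t ht htT j n x).trans (le_max_right _ _)
      · intro t₀ ht₀
        have hfin := (h.mem_traceSpace t₀ ht₀ i).2
        -- Adding `1` to the finite norm provides the strict inequality that the bound requires.
        obtain ⟨C₂, hC₂0, hC₂⟩ := DissipativeFluid.exists_bound_pderiv_mollify (d := d) hp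
          (ENNReal.add_ne_top.2 ⟨hfin.ne, ENNReal.one_ne_top⟩)
        refine ⟨_, (h.continuous_traceSpace t₀ ht₀ i).eventually (gt_mem_nhds one_pos),
          C₁ + C₂, by positivity, fun t ht htT j n x => ?_⟩
        have h1 := hC₁ _ ht n j x
        have h2 := hC₂ _ (ENNReal.lt_add_right hfin.ne one_ne_zero) n j x
        have it := h.integrable hp htT i
        have it0 := h.integrable hp ht₀ i
        have hcont : Continuous fun y => pderiv j (kernel n) (x - y) :=
          ((torusSmooth_kernel n).pderiv j).one.continuous.comp (by fun_prop)
        have its : Integrable (fun y => v t y i - v t₀ y i) := it.sub it0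
        rw [pderiv_mollify n its] at h1
        rw [pderiv_mollify n it0] at h2
        rw [pderiv_mollify n it]
        have heq : ∫ y, pderiv j (kernel n) (x - y) * v t y i =
            (∫ y, pderiv j (kernel n) (x - y) * (v t y i - v t₀ y i)) +
              ∫ y, pderiv j (kernel n) (x - y) * v t₀ y i := by
          rw [← integral_add (integrable_continuous_mul hcont its)
            (integrable_continuous_mul hcont it0)]
          congr 1; funext y; ring
        rw [heq]
        exact (abs_add_le _ _).trans (add_le_add h1 h2)
    obtain ⟨M, hM0, hM⟩ := hcomp
    exact ⟨M, hM0, fun t ht => hM t ht ht⟩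
  choose M hM0 hM using hi
  refine ⟨∑ i, M i, Finset.sum_nonneg fun i _ => hM0 i, fun t ht i j n x =>
    (hM i t ht j n x).trans ?_⟩
  exact Finset.single_le_sum (f := M) (fun i _ => hM0 i) (Finset.mem_univ i)

end Regularity

/-! ### Steklov averages, weak derivatives and Gronwall's inequality on an interval -/

/-- The backward Steklov average of `c`. -/
def steklov (c : ℝ → ℝ) (h t : ℝ) : ℝ := h⁻¹ * ∫ s in (t - h)..t, c s

/-- Rescaled to a fixed interval, the average is a parametric integral that is continuous up to `h =
0`. -/
theorem steklov_eq_integral_unit (c : ℝ → ℝ) {h : ℝ} (hh : 0 < h) (t : ℝ) :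
    steklov c h t = ∫ s in (0 : ℝ)..1, c (t - h * s) := by
  rw [intervalIntegral.integral_comp_sub_mul _ hh.ne']
  simp [steklov]

theorem tendsto_steklov {c : ℝ → ℝ} (hc : Continuous c) (t : ℝ) :
    Tendsto (fun h => steklov c h t) (𝓝[>] 0) (𝓝 (c t)) := by
  have h1 : Continuous (fun h : ℝ => ∫ s in (0 : ℝ)..1, c (t - h * s)) :=
    intervalIntegral.continuous_parametric_intervalIntegral_of_continuous' (by fun_prop) 0 1
  have h2 := (h1.tendsto 0).mono_left (nhdsWithin_le_nhds (s := Ioi 0))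
  simp only [zero_mul, sub_zero, intervalIntegral.integral_const, one_smul] at h2
  refine h2.congr' ?_
  filter_upwards [self_mem_nhdsWithin] with h hh
  exact (steklov_eq_integral_unit c hh t).symm

theorem abs_steklov_le {c : ℝ → ℝ} {C : ℝ} (hC : ∀ t, |c t| ≤ C) {h : ℝ} (hh : 0 < h) (t : ℝ) :
    |steklov c h t| ≤ C := by
  rw [steklov_eq_integral_unit c hh]
  simpa using intervalIntegral.norm_integral_le_of_norm_le_const (a := (0 : ℝ)) (b := 1)
    (f := fun s => c (t - h * s)) (C := C) (fun s _ => hC _)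

theorem steklov_sum_mul {ι : Type*} [Fintype ι] {c : ι → ℝ → ℝ} (hc : ∀ m, Continuous (c m))
    (w : ι → ℝ) (h t : ℝ) :
    steklov (fun s => ∑ m, c m s * w m) h t = ∑ m, steklov (c m) h t * w m := by
  unfold steklov
  have hi : ∀ m ∈ Finset.univ, IntervalIntegrable (fun s => c m s * w m) volume (t - h) t :=
    fun m _ => ((hc m).mul continuous_const).intervalIntegrable _ _
  rw [intervalIntegral.integral_finsetSum hi, Finset.mul_sum]
  refine Finset.sum_congr rfl fun m _ => ?_
  rw [intervalIntegral.integral_mul_const, mul_assoc]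

theorem hasDerivAt_steklov {c : ℝ → ℝ} (hc : Continuous c) (h t : ℝ) :
    HasDerivAt (steklov c h) (h⁻¹ * (c t - c (t - h))) t := by
  have h1 : ∀ t, HasDerivAt (fun u => ∫ s in (0 : ℝ)..u, c s) (c t) t := fun t =>
    intervalIntegral.integral_hasDerivAt_right (hc.intervalIntegrable _ _)
      (hc.stronglyMeasurableAtFilter _ _) hc.continuousAt
  have h2 : HasDerivAt (fun u => ∫ s in (0 : ℝ)..(u - h), c s) (c (t - h)) t :=
    HasDerivAt.comp_sub_const t h (h1 (t - h))
  refine (((h1 t).sub h2).const_mul h⁻¹).congr_of_eventuallyEq (Eventually.of_forall fun u => ?_)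
  simp only [steklov, Pi.sub_apply]
  rw [← intervalIntegral.integral_interval_sub_left (hc.intervalIntegrable 0 u)
    (hc.intervalIntegrable 0 (u - h))]

theorem contDiff_steklov {c : ℝ → ℝ} (hc : Continuous c) (h : ℝ) : ContDiff ℝ 1 (steklov c h) := by
  rw [contDiff_one_iff_deriv]
  refine ⟨fun t => (hasDerivAt_steklov hc h t).differentiableAt, ?_⟩
  rw [show deriv (steklov c h) = fun t => h⁻¹ * (c t - c (t - h)) from
    funext fun t => (hasDerivAt_steklov hc h t).deriv]
  fun_prop

/-- With `c' = c (t - h)`, the difference of `c (c - c')` and `½ (c² - c'²)` is `½ (c - c')² ≥ 0`;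
the integral of `c² - c'²` telescopes to the ends of the interval. This takes the place of `c c' = ½
(c²)'` for a function that is merely continuous, at the price of an inequality in the useful
direction. -/
theorem le_integral_mul_deriv_steklov {c : ℝ → ℝ} (hc : Continuous c) {h τ : ℝ} (hh : 0 < h)
    (hτ : 0 ≤ τ) :
    (1 / 2) * (steklov (fun t => c t ^ 2) h τ - steklov (fun t => c t ^ 2) h 0) ≤
      ∫ t in (0)..τ, c t * (h⁻¹ * (c t - c (t - h))) := by
  have hc2 : Continuous fun t => c t ^ 2 := hc.pow 2
  have hi : ∀ a b, IntervalIntegrable (fun t => c t ^ 2) volume a b := fun a b =>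
    hc2.intervalIntegrable a b
  have h1 : ∫ t in (0)..τ, (2 * h)⁻¹ * (c t ^ 2 - c (t - h) ^ 2) ≤
      ∫ t in (0)..τ, c t * (h⁻¹ * (c t - c (t - h))) := by
    refine intervalIntegral.integral_mono_on hτ
      (Continuous.intervalIntegrable (by fun_prop) _ _)
      (Continuous.intervalIntegrable (by fun_prop) _ _) fun t _ => ?_
    have h3 : c t * (h⁻¹ * (c t - c (t - h))) - (2 * h)⁻¹ * (c t ^ 2 - c (t - h) ^ 2) =
        (2 * h)⁻¹ * (c t - c (t - h)) ^ 2 := by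
      field_simp; ring
    have : 0 ≤ (2 * h)⁻¹ * (c t - c (t - h)) ^ 2 := by positivity
    linarith
  refine le_trans (le_of_eq ?_) h1
  rw [intervalIntegral.integral_const_mul, intervalIntegral.integral_sub (hi _ _)
    (Continuous.intervalIntegrable (by fun_prop) _ _),
    intervalIntegral.integral_comp_sub_right (fun t => c t ^ 2) h]
  have h4 := intervalIntegral.integral_add_adjacent_intervals (hi (0 - h) 0) (hi 0 τ)
  have h5 := intervalIntegral.integral_add_adjacent_intervals (hi (0 - h) (τ - h)) (hi (τ - h) τ)
  simp only [steklov]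
  rw [← mul_sub, ← mul_assoc, mul_inv]
  have : (∫ s in (τ - h)..τ, c s ^ 2) - ∫ s in (0 - h)..0, c s ^ 2 =
    (∫ s in (0)..τ, c s ^ 2) - ∫ s in (0 - h)..(τ - h), c s ^ 2 := by linarith
  rw [this]
  norm_num

/-- As `r` is only integrable, the hypothesis is integrated once more: `ρ = ∫ r` is continuous with
`ρ ≤ K ∫ ρ`, and `y = ∫ ρ` is differentiable with `y' ≤ K y` and `y 0 = 0`. So `exp(-Kτ) y`
decreases from `0`, whence `y ≤ 0`, then `ρ ≤ 0`, then `r ≤ 0`. -/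
theorem eq_zero_of_le_integral {r : ℝ → ℝ} {T K : ℝ} (hT : 0 ≤ T) (hK : 0 ≤ K)
    (hi : IntervalIntegrable r volume 0 T) (h0 : ∀ᵐ t ∂(volume.restrict (Ioo 0 T)), 0 ≤ r t)
    (hr : ∀ᵐ τ ∂(volume.restrict (Ioo 0 T)), r τ ≤ K * ∫ t in (0)..τ, r t) :
    ∀ᵐ t ∂(volume.restrict (Ioo 0 T)), r t = 0 := by
  have hcont : ContinuousOn (fun τ => ∫ t in (0)..τ, r t) (Icc 0 T) :=
    intervalIntegral.continuousOn_primitive_interval'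
      (by simpa [uIcc_of_le hT] using hi) (by simp) |>.mono (by simp [uIcc_of_le hT])
  set ρ : ℝ → ℝ := fun τ => ∫ t in (0)..τ, r t with hρ
  have hρi : ∀ {τ}, τ ∈ Icc 0 T → IntervalIntegrable ρ volume 0 τ := fun {τ} hτ =>
    (hcont.mono (by rw [uIcc_of_le hτ.1]; exact Icc_subset_Icc_right hτ.2)).intervalIntegrable
  have hri : ∀ {τ}, τ ∈ Icc 0 T → IntervalIntegrable r volume 0 τ := fun {τ} hτ =>
    hi.mono_set (by rw [uIcc_of_le hτ.1, uIcc_of_le hT]; exact Icc_subset_Icc_right hτ.2)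
  have hae : ∀ {P : ℝ → Prop}, (∀ᵐ t ∂(volume.restrict (Ioo 0 T)), P t) → ∀ τ ∈ Icc 0 T,
      ∀ᵐ t ∂(volume.restrict (Icc 0 τ)), P t := by
    intro P hP τ hτ
    rw [restrict_Ioo_eq_restrict_Icc] at hP
    exact ae_mono (Measure.restrict_mono (Icc_subset_Icc_right hτ.2) le_rfl) hP
  have h1 : ∀ τ ∈ Icc 0 T, ρ τ ≤ K * ∫ t in (0)..τ, ρ t := by
    intro τ hτ
    rw [← intervalIntegral.integral_const_mul]
    exact intervalIntegral.integral_mono_ae_restrict hτ.1 (hri hτ) ((hρi hτ).const_mul K)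
      (hae hr τ hτ)
  set y : ℝ → ℝ := fun τ => ∫ t in (0)..τ, ρ t with hy
  have hycont : ContinuousOn y (Icc 0 T) :=
    intervalIntegral.continuousOn_primitive_interval'
      (by simpa [uIcc_of_le hT] using hρi (right_mem_Icc.2 hT)) (by simp)
      |>.mono (by simp [uIcc_of_le hT])
  have hyd : ∀ τ ∈ Ioo 0 T, HasDerivAt y (ρ τ) τ := by
    intro τ hτ
    have hn : Icc 0 T ∈ 𝓝 τ := Icc_mem_nhds hτ.1 hτ.2
    exact intervalIntegral.integral_hasDerivAt_right (hρi (Ioo_subset_Icc_self hτ))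
      (hcont.stronglyMeasurableAtFilter_nhdsWithin measurableSet_Icc τ |>.filter_mono
        (by rw [nhdsWithin_eq_nhds.2 hn])) (hcont.continuousAt hn)
  have hanti : AntitoneOn (fun τ => Real.exp (-(K * τ)) * y τ) (Icc 0 T) := by
    refine antitoneOn_of_deriv_nonpos (convex_Icc 0 T)
      ((Continuous.continuousOn (by fun_prop)).mul hycont) ?_ ?_
    · intro τ hτ
      rw [interior_Icc] at hτ
      have := (hyd τ hτ).differentiableAt
      exact (DifferentiableAt.mul (by fun_prop) this).differentiableWithinAt
    · intro τ hτ
      rw [interior_Icc] at hτ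
      have he : HasDerivAt (fun τ => Real.exp (-(K * τ))) (Real.exp (-(K * τ)) * -(K * 1)) τ :=
        (((hasDerivAt_id τ).const_mul K).neg).exp
      rw [(he.fun_mul (hyd τ hτ)).deriv]
      have h2 := h1 τ (Ioo_subset_Icc_self hτ)
      have : 0 < Real.exp (-(K * τ)) := Real.exp_pos _
      nlinarith
  have hy0 : ∀ τ ∈ Icc 0 T, y τ ≤ 0 := by
    intro τ hτ
    have h2 := hanti (left_mem_Icc.2 hT) hτ hτ.1
    simp only [hy, intervalIntegral.integral_same, mul_zero] at h2
    exact nonpos_of_mul_nonpos_right h2 (Real.exp_pos _)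
  filter_upwards [h0, hr, ae_restrict_mem measurableSet_Ioo] with t ht0 htr ht
  have htT := Ioo_subset_Icc_self ht
  have h3 : ρ t ≤ 0 := (h1 t htT).trans (mul_nonpos_of_nonneg_of_nonpos hK (hy0 t htT))
  exact le_antisymm (htr.trans (mul_nonpos_of_nonneg_of_nonpos hK h3)) ht0

/-! ### Smooth steps in time and primitives of weak derivatives -/

theorem deriv_smoothTransition_of_nonpos {u : ℝ} (hu : u ≤ 0) :
    deriv Real.smoothTransition u = 0 := by
  refine IsLocalMin.deriv_eq_zero (Eventually.of_forall fun x => ?_)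
  rw [Real.smoothTransition.zero_of_nonpos hu]
  exact Real.smoothTransition.nonneg x

theorem deriv_smoothTransition_of_one_le {u : ℝ} (hu : 1 ≤ u) :
    deriv Real.smoothTransition u = 0 := by
  refine IsLocalMax.deriv_eq_zero (Eventually.of_forall fun x => ?_)
  rw [Real.smoothTransition.one_of_one_le hu]
  exact Real.smoothTransition.le_one x

theorem contDiff_smoothTransition : ContDiff ℝ ∞ Real.smoothTransition :=
  Real.smoothTransition.contDiff

theorem continuous_deriv_smoothTransition : Continuous (deriv Real.smoothTransition) :=
  contDiff_smoothTransition.continuous_deriv (by simp)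

/-- A smooth transition from `0` to `1` on the interval `[s, s + ε]`. -/
def smoothStep (s ε r : ℝ) : ℝ := Real.smoothTransition ((r - s) / ε)

theorem contDiff_smoothStep (s ε : ℝ) : ContDiff ℝ ∞ (smoothStep s ε) :=
  contDiff_smoothTransition.comp ((contDiff_id.sub contDiff_const).div_const ε)

theorem deriv_smoothStep (s ε r : ℝ) :
    deriv (smoothStep s ε) r = deriv Real.smoothTransition ((r - s) / ε) * (1 / ε) := by
  have h1 : HasDerivAt (fun r : ℝ => (r - s) / ε) (1 / ε) r :=
    ((hasDerivAt_id r).sub_const s).div_const ε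
  have h2 := (contDiff_smoothTransition.differentiable (by simp)
    ((r - s) / ε)).hasDerivAt.comp r h1
  exact h2.deriv

theorem abs_smoothStep_le_one (s ε r : ℝ) : |smoothStep s ε r| ≤ 1 := by
  rw [smoothStep, abs_of_nonneg (Real.smoothTransition.nonneg _)]
  exact Real.smoothTransition.le_one _

theorem smoothStep_of_le {s ε r : ℝ} (hε : 0 < ε) (h : r ≤ s) : smoothStep s ε r = 0 :=
  Real.smoothTransition.zero_of_nonpos (div_nonpos_of_nonpos_of_nonneg (by linarith) hε.le)

theorem smoothStep_of_ge {s ε r : ℝ} (hε : 0 < ε) (h : s + ε ≤ r) : smoothStep s ε r = 1 :=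
  Real.smoothTransition.one_of_one_le ((one_le_div hε).2 (by linarith))

/-- Substitution `u = (r - s) / ε`. The hypotheses keep `[s, s + ε]` inside `[0,T]`, and the
derivative of the transition vanishes for `u ≤ 0` and `u ≥ 1`. As `ε → 0` the derivative of the step
thus acts as a unit mass at `s`. -/
theorem integral_mul_deriv_smoothStep {a : ℝ → ℝ} (ha : Continuous a) {s ε T : ℝ} (hε : 0 < ε)
    (hs : 0 ≤ s) (hsT : s + ε ≤ T) :
    ∫ r in (0)..T, a r * deriv (smoothStep s ε) r =
      ∫ u in (0 : ℝ)..1, a (s + ε * u) * deriv Real.smoothTransition u := by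
  set f : ℝ → ℝ := fun u => a (s + ε * u) * deriv Real.smoothTransition u with hf
  have hfc : Continuous f := (by fun_prop : Continuous fun u => a (s + ε * u)).mul
    continuous_deriv_smoothTransition
  have h1 : ∀ r, a r * deriv (smoothStep s ε) r = ε⁻¹ * f (r / ε - s / ε) := by
    intro r
    rw [deriv_smoothStep, hf]
    simp only [← sub_div]
    rw [show s + ε * ((r - s) / ε) = r by field_simp; ring]
    ring
  simp only [h1]
  rw [intervalIntegral.integral_const_mul, intervalIntegral.integral_comp_div_sub f hε.ne',
    smul_eq_mul, inv_mul_cancel_left₀ hε.ne',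
    ← intervalIntegral.integral_add_adjacent_intervals (hfc.intervalIntegrable (0 / ε - s / ε) 0)
      (hfc.intervalIntegrable 0 _),
    ← intervalIntegral.integral_add_adjacent_intervals (hfc.intervalIntegrable 0 1)
      (hfc.intervalIntegrable 1 _)]
  have hz1 : ∫ u in (0 / ε - s / ε)..0, f u = 0 := by
    refine (intervalIntegral.integral_congr fun u hu => ?_).trans intervalIntegral.integral_zero
    have : 0 ≤ s / ε := by positivity
    rw [uIcc_of_le (by rw [zero_div]; linarith)] at hu
    simp [hf, deriv_smoothTransition_of_nonpos hu.2]
  have hz2 : ∫ u in (1)..(T / ε - s / ε), f u = 0 := by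
    refine (intervalIntegral.integral_congr fun u hu => ?_).trans intervalIntegral.integral_zero
    have : 1 ≤ T / ε - s / ε := by
      rw [← sub_div, one_le_div hε]; linarith
    rw [uIcc_of_le this] at hu
    simp [hf, deriv_smoothTransition_of_one_le hu.1]
  rw [hz1, hz2, zero_add, add_zero]

theorem tendsto_integral_mul_deriv_smoothStep {a : ℝ → ℝ} (ha : Continuous a) {s T : ℝ}
    (hs : 0 ≤ s) (hsT : s < T) :
    Tendsto (fun ε => ∫ r in (0)..T, a r * deriv (smoothStep s ε) r) (𝓝[>] 0) (𝓝 (a s)) := by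
  have h1 : Continuous (fun ε : ℝ =>
      ∫ u in (0 : ℝ)..1, a (s + ε * u) * deriv Real.smoothTransition u) := by
    refine intervalIntegral.continuous_parametric_intervalIntegral_of_continuous' ?_ 0 1
    have := continuous_deriv_smoothTransition
    exact (by fun_prop : Continuous fun z : ℝ × ℝ => a (s + z.1 * z.2)).mul
      (this.comp continuous_snd)
  have h2 := (h1.tendsto 0).mono_left (nhdsWithin_le_nhds (s := Ioi 0))
  simp only [zero_mul, add_zero, intervalIntegral.integral_const_mul] at h2
  rw [intervalIntegral.integral_deriv_eq_sub
    (fun u _ => contDiff_smoothTransition.differentiable (by simp) u)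
    (continuous_deriv_smoothTransition.intervalIntegrable _ _), Real.smoothTransition.one,
    Real.smoothTransition.zero, sub_zero, mul_one] at h2
  refine h2.congr' ?_
  filter_upwards [self_mem_nhdsWithin, nhdsWithin_le_nhds (Iio_mem_nhds (sub_pos.2 hsT))]
    with ε hε hεT
  exact (integral_mul_deriv_smoothStep ha hε hs (by simp only [mem_Iio] at hεT; linarith)).symm

theorem tendsto_smoothStep (s r : ℝ) :
    Tendsto (fun ε => smoothStep s ε r) (𝓝[>] 0) (𝓝 ((Ioi s).indicator 1 r)) := by
  by_cases h : r ≤ s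
  · rw [indicator_of_notMem (by simpa using h)]
    refine tendsto_const_nhds.congr' ?_
    filter_upwards [self_mem_nhdsWithin] with ε hε
    exact (smoothStep_of_le hε h).symm
  · push Not at h
    rw [indicator_of_mem (by simpa using h), Pi.one_apply]
    refine tendsto_const_nhds.congr' ?_
    filter_upwards [self_mem_nhdsWithin, nhdsWithin_le_nhds (Iio_mem_nhds (sub_pos.2 h))]
      with ε hε hεT
    simp only [mem_Iio] at hεT
    exact (smoothStep_of_ge hε (by linarith)).symm

theorem tendsto_integral_mul_smoothStep {b : ℝ → ℝ} {s T : ℝ} (hs : 0 ≤ s) (hsT : s ≤ T)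
    (hb : IntervalIntegrable b volume 0 T) :
    Tendsto (fun ε => ∫ r in (0)..T, b r * smoothStep s ε r) (𝓝[>] 0)
      (𝓝 (∫ r in s..T, b r)) := by
  have h0T := hs.trans hsT
  have heq : ∫ r in s..T, b r = ∫ r in (0)..T, b r * (Ioi s).indicator 1 r := by
    rw [intervalIntegral.integral_of_le hsT, intervalIntegral.integral_of_le h0T]
    have : (fun r => b r * (Ioi s).indicator 1 r) = (Ioi s).indicator b := by
      funext r
      by_cases hr : r ∈ Ioi s <;> simp [hr]
    rw [this, setIntegral_indicator measurableSet_Ioi]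
    congr 2
    ext r
    simp only [mem_Ioc, mem_inter_iff, mem_Ioi]
    constructor
    · rintro ⟨h1, h2⟩; exact ⟨⟨by linarith, h2⟩, h1⟩
    · rintro ⟨⟨h1, h2⟩, h3⟩; exact ⟨h3, h2⟩
  rw [heq]
  refine intervalIntegral.tendsto_integral_filter_of_dominated_convergence (fun r => |b r|) ?_ ?_
    hb.abs ?_
  · refine Eventually.of_forall fun ε => ?_
    exact hb.aestronglyMeasurable_restrict_uIoc.mul
      (contDiff_smoothStep s ε).continuous.aestronglyMeasurable
  · refine Eventually.of_forall fun ε => Eventually.of_forall fun r _ => ?_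
    rw [norm_mul]
    exact mul_le_of_le_one_right (norm_nonneg _) (abs_smoothStep_le_one s ε r)
  · exact Eventually.of_forall fun r _ => (tendsto_smoothStep s r).const_mul _

/-- A continuous function on `[0,T]` with an integrable weak derivative is its primitive. -/
theorem sub_eq_integral_of_weak_deriv {a b : ℝ → ℝ} {T : ℝ} (hT : 0 < T)
    (ha : ContinuousOn a (Icc 0 T)) (hb : IntervalIntegrable b volume 0 T)
    (h : ∀ χ : ℝ → ℝ, ContDiff ℝ ∞ χ →
      (∃ α β, 0 < α ∧ β < T ∧ ∀ t, t ∉ Icc α β → χ t = 0) →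
      ∫ t in (0)..T, a t * deriv χ t = - ∫ t in (0)..T, b t * χ t) :
    ∀ t ∈ Icc 0 T, a t - a 0 = ∫ r in (0)..t, b r := by
  set A : ℝ → ℝ := IccExtend hT.le ((Icc 0 T).domRestrict a) with hA
  have hAc : Continuous A := (continuousOn_iff_continuous_domRestrict.1 ha).Icc_extend'
  have hAa : ∀ t ∈ Icc 0 T, A t = a t := fun t ht => by
    rw [hA, IccExtend_of_mem _ _ ht]; rfl
  have hbi : ∀ {x y}, x ∈ Icc 0 T → y ∈ Icc 0 T → IntervalIntegrable b volume x y :=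
    fun hx hy => hb.mono_set (by rw [uIcc_of_le hT.le]; exact uIcc_subset_Icc hx hy)
  have hT0 : (0 : ℝ) ∈ Icc 0 T := left_mem_Icc.2 hT.le
  have hTT : T ∈ Icc 0 T := right_mem_Icc.2 hT.le
  -- The test function is the difference of the steps at `s` and at `t`. For small `ε` it has
  -- support inside `(0,T)`; as `ε → 0` it tends to the indicator of `(s, t]` and its derivative to
  -- the difference of unit masses at `s` and `t`.
  have key : ∀ s ∈ Ioo 0 T, ∀ t ∈ Ioo 0 T, s < t →
      A s - A t = - ((∫ r in s..T, b r) - ∫ r in t..T, b r) := by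
    intro s hs t ht hst
    have l1 := (tendsto_integral_mul_deriv_smoothStep hAc hs.1.le hs.2).sub
      (tendsto_integral_mul_deriv_smoothStep hAc ht.1.le ht.2)
    have l2 := ((tendsto_integral_mul_smoothStep hs.1.le hs.2.le hb).sub
      (tendsto_integral_mul_smoothStep ht.1.le ht.2.le hb)).neg
    refine tendsto_nhds_unique (l1.congr' ?_) l2
    filter_upwards [self_mem_nhdsWithin,
      nhdsWithin_le_nhds (Iio_mem_nhds (sub_pos.2 ht.2))] with ε hε hεT
    simp only [mem_Ioi, mem_Iio] at hε hεT
    have hcd : ∀ s, ContDiff ℝ ∞ (smoothStep s ε) := fun s => contDiff_smoothStep s ε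
    have hdc : ∀ s, Continuous (deriv (smoothStep s ε)) := fun s =>
      (hcd s).continuous_deriv (by simp)
    have h1 := h (fun r => smoothStep s ε r - smoothStep t ε r) ((hcd s).sub (hcd t))
      ⟨s, t + ε, hs.1, by linarith, fun r hr => by
        simp only [mem_Icc, not_and_or, not_le] at hr
        rcases hr with hr | hr
        · simp [smoothStep_of_le hε hr.le, smoothStep_of_le hε (hr.le.trans hst.le)]
        · simp [smoothStep_of_ge hε hr.le,
            smoothStep_of_ge (s := s) hε (by linarith : s + ε ≤ r)]⟩
    have hd : ∀ r, deriv (fun r => smoothStep s ε r - smoothStep t ε r) r =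
        deriv (smoothStep s ε) r - deriv (smoothStep t ε) r := fun r =>
      deriv_fun_sub ((hcd s).differentiable (by simp) r) ((hcd t).differentiable (by simp) r)
    have hAi : ∀ s, IntervalIntegrable (fun r => A r * deriv (smoothStep s ε) r) volume 0 T :=
      fun s => (hAc.mul (hdc s)).intervalIntegrable _ _
    have hBi : ∀ s, IntervalIntegrable (fun r => b r * smoothStep s ε r) volume 0 T :=
      fun s => hb.mul_continuousOn (hcd s).continuous.continuousOn
    rw [← intervalIntegral.integral_sub (hAi s) (hAi t),
      ← intervalIntegral.integral_sub (hBi s) (hBi t)]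
    simp only [← mul_sub]
    rw [← h1]
    refine intervalIntegral.integral_congr fun r hr => ?_
    rw [uIcc_of_le hT.le] at hr
    simp only [hd, hAa r hr]
  have hconst : EqOn (fun t => A t - ∫ r in (0)..t, b r)
      (fun _ => A (T / 2) - ∫ r in (0)..(T / 2), b r) (Icc 0 T) := by
    have hprim : ContinuousOn (fun t => ∫ r in (0)..t, b r) (Icc 0 T) :=
      intervalIntegral.continuousOn_primitive_interval'
        (by simpa [uIcc_of_le hT.le] using hb) (by simp) |>.mono (by simp [uIcc_of_le hT.le])
    refine EqOn.of_subset_closure (s := Ioo 0 T) ?_ (hAc.continuousOn.sub hprim)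
      continuousOn_const Ioo_subset_Icc_self (by rw [closure_Ioo hT.ne])
    have hmid : T / 2 ∈ Ioo 0 T := ⟨by linarith, by linarith⟩
    have hgen : ∀ s ∈ Ioo 0 T, ∀ t ∈ Ioo 0 T, s < t →
        A s - ∫ r in (0)..s, b r = A t - ∫ r in (0)..t, b r := by
      intro s hs t ht hst
      have h1 := key s hs t ht hst
      have hs' := Ioo_subset_Icc_self hs
      have ht' := Ioo_subset_Icc_self ht
      have h2 := intervalIntegral.integral_add_adjacent_intervals (hbi hT0 hs') (hbi hs' hTT)
      have h3 := intervalIntegral.integral_add_adjacent_intervals (hbi hT0 ht') (hbi ht' hTT)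
      linarith
    intro t ht
    rcases lt_trichotomy t (T / 2) with hlt | heq | hgt
    · exact hgen t ht _ hmid hlt
    · simp only [heq]
    · exact (hgen _ hmid t ht hgt).symm
  intro t ht
  have h1 := hconst ht
  have h2 := hconst hT0
  simp only [intervalIntegral.integral_same, sub_zero] at h1 h2
  rw [← hAa t ht, ← hAa 0 hT0]
  linarith

/-- Integration by parts for a weakly differentiable function and a `C¹` function. -/
theorem integral_mul_deriv_of_weak_deriv {a b f : ℝ → ℝ} {T : ℝ} (hT : 0 < T)
    (ha : ContinuousOn a (Icc 0 T)) (hb : IntervalIntegrable b volume 0 T)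
    (h : ∀ χ : ℝ → ℝ, ContDiff ℝ ∞ χ →
      (∃ α β, 0 < α ∧ β < T ∧ ∀ t, t ∉ Icc α β → χ t = 0) →
      ∫ t in (0)..T, a t * deriv χ t = - ∫ t in (0)..T, b t * χ t) (hf : ContDiff ℝ 1 f) :
    ∫ t in (0)..T, a t * deriv f t = a T * f T - a 0 * f 0 - ∫ t in (0)..T, b t * f t := by
  have hsub := sub_eq_integral_of_weak_deriv hT ha hb h
  -- Since `a` is `a 0` plus the primitive of `b`, it suffices to integrate by parts with this
  -- absolutely continuous primitive.
  have hac : AbsolutelyContinuousOnInterval (fun x => ∫ r in (0)..x, b r) 0 T :=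
    hb.absolutelyContinuousOnInterval_intervalIntegral (by simp)
  have hfac : AbsolutelyContinuousOnInterval f 0 T :=
    hf.contDiffOn.absolutelyContinuousOnInterval
  have h1 := hac.integral_mul_deriv_eq_deriv_mul hfac
  have hfd : Continuous (deriv f) := hf.continuous_deriv le_rfl
  have h2 : ∫ t in (0)..T, a t * deriv f t =
      ∫ t in (0)..T, (a 0 * deriv f t + (∫ r in (0)..t, b r) * deriv f t) := by
    refine intervalIntegral.integral_congr fun t ht => ?_
    rw [uIcc_of_le hT.le] at ht
    rw [← hsub t ht]; ring
  have h3 : ∫ x in (0)..T, deriv (fun x => ∫ r in (0)..x, b r) x * f x =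
      ∫ t in (0)..T, b t * f t := by
    refine intervalIntegral.integral_congr_ae ?_
    filter_upwards [hb.ae_hasDerivAt_integral] with x hx hxm
    rw [(hx (uIoc_subset_uIcc hxm) 0 (by simp)).deriv]
  have hci : ContinuousOn (fun t => ∫ r in (0)..t, b r) (uIcc 0 T) := hac.continuousOn
  have i1 : IntervalIntegrable (fun t => a 0 * deriv f t) volume 0 T :=
    (continuous_const.mul hfd).intervalIntegrable _ _
  have i2 : IntervalIntegrable (fun t => (∫ r in (0)..t, b r) * deriv f t) volume 0 T :=
    (hci.mul hfd.continuousOn).intervalIntegrable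
  rw [h2, intervalIntegral.integral_add i1 i2, h1, h3, intervalIntegral.integral_const_mul,
    intervalIntegral.integral_deriv_eq_sub (fun u _ => hf.differentiable one_ne_zero u)
      (hfd.intervalIntegrable _ _), ← hsub T (right_mem_Icc.2 hT.le)]
  simp only [intervalIntegral.integral_same, zero_mul]
  ring

/-! ### Matrix valued measures with positive semidefinite values -/

section PosSemidef

variable {α : Type*} {mα : MeasurableSpace α}

instance isFiniteMeasure_variation (μ : SignedMeasure α) : IsFiniteMeasure μ.variation := by
  rw [← SignedMeasure.totalVariation_eq_variation]; infer_instance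

/-- Testing with `e_i ± e_j` gives `2 |A i j| ≤ A i i + A j j`, and each diagonal entry is at most
the trace. -/
theorem abs_apply_le_sum_diag_of_posSemidef {A : Matrix (Fin d) (Fin d) ℝ}
    (hA : A.PosSemidef) (i j : Fin d) : |A i j| ≤ ∑ k, A k k := by
  have hdiag : ∀ k, 0 ≤ A k k := fun k => hA.diag_nonneg
  have hi : A i i ≤ ∑ k, A k k := Finset.single_le_sum (fun k _ => hdiag k) (Finset.mem_univ i)
  have hj : A j j ≤ ∑ k, A k k := Finset.single_le_sum (fun k _ => hdiag k) (Finset.mem_univ j)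
  have hsymm : A j i = A i j := by
    have := hA.1.apply i j
    simpa using this
  have h1 := hA.dotProduct_mulVec_nonneg (Pi.single i 1 + Pi.single j 1)
  have h2 := hA.dotProduct_mulVec_nonneg (Pi.single i 1 - Pi.single j 1)
  simp only [star_trivial, Matrix.mulVec_add, Matrix.mulVec_sub, add_dotProduct, sub_dotProduct,
    dotProduct_add, dotProduct_sub, Matrix.mulVec_single_one, single_one_dotProduct,
    Matrix.col_apply, hsymm] at h1 h2
  rw [abs_le]
  constructor <;> linarith

theorem norm_vectorIntegral_le {μ : SignedMeasure α} {f : α → ℝ} {C : ℝ} (hf : ∀ x, |f x| ≤ C) :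
    |∫ᵛ x, f x ∂•μ| ≤ C * (μ.totalVariation univ).toReal := by
  have h := VectorMeasure.norm_integral_le_of_norm_le_const (μ := μ) (f := f)
    (B := ContinuousLinearMap.lsmul ℝ ℝ) (C := C) (Eventually.of_forall hf)
  rwa [ContinuousLinearMap.opNorm_lsmul, mul_one, Measure.real,
    ← SignedMeasure.totalVariation_eq_variation] at h

variable {R : Matrix (Fin d) (Fin d) (SignedMeasure α)}

/-- On the two sets of a Hahn decomposition of `R i j` the variation is plus or minus the value,
hence at most the trace on that set; the trace is additive over the two sets. -/
theorem totalVariation_univ_le_of_posSemidef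
    (hR : ∀ A : Set α, MeasurableSet A → (Matrix.of fun i j => R i j A).PosSemidef)
    (i j : Fin d) : ((R i j).totalVariation univ).toReal ≤ ∑ k, R k k univ := by
  obtain ⟨P, hP, hP1, hP2, hpos, hneg⟩ := (R i j).toJordanDecomposition_spec
  have h1 := (abs_apply_le_sum_diag_of_posSemidef (hR P hP) i j)
  have h2 := (abs_apply_le_sum_diag_of_posSemidef (hR Pᶜ hP.compl) i j)
  simp only [Matrix.of_apply] at h1 h2
  rw [SignedMeasure.totalVariation, ← Measure.real, measureReal_add_apply, hpos, hneg,
    SignedMeasure.toMeasureOfZeroLE_real_apply _ hP1 hP MeasurableSet.univ,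
    SignedMeasure.toMeasureOfLEZero_real_apply _ hP2 hP.compl MeasurableSet.univ, inter_univ,
    inter_univ]
  have h3 : ∑ k, R k k univ = ∑ k, R k k P + ∑ k, R k k Pᶜ := by
    rw [← Finset.sum_add_distrib]
    refine Finset.sum_congr rfl fun k _ => ?_
    rw [← VectorMeasure.of_union disjoint_compl_right hP hP.compl, union_compl_self]
  rw [h3]
  exact add_le_add ((le_abs_self _).trans h1) ((neg_le_abs _).trans h2)

theorem sum_diag_nonneg_of_posSemidef
    (hR : ∀ A : Set α, MeasurableSet A → (Matrix.of fun i j => R i j A).PosSemidef) :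
    0 ≤ ∑ k, R k k univ :=
  Finset.sum_nonneg fun _ _ => (hR univ MeasurableSet.univ).diag_nonneg

/-- The traces on `A` and on its complement are nonnegative and sum to zero, and the trace dominates
every entry. -/
theorem eq_zero_of_posSemidef
    (hR : ∀ A : Set α, MeasurableSet A → (Matrix.of fun i j => R i j A).PosSemidef)
    (h0 : ∑ k, R k k univ = 0) (i j : Fin d) : R i j = 0 := by
  ext A hA
  have hdiag : ∀ {B : Set α}, MeasurableSet B → 0 ≤ ∑ k, R k k B := fun hB =>
    Finset.sum_nonneg fun _ _ => (hR _ hB).diag_nonneg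
  have h1 := abs_apply_le_sum_diag_of_posSemidef (hR A hA) i j
  have h3 : ∑ k, R k k univ = ∑ k, R k k A + ∑ k, R k k Aᶜ := by
    rw [← Finset.sum_add_distrib]
    refine Finset.sum_congr rfl fun k _ => ?_
    rw [← VectorMeasure.of_union disjoint_compl_right hA hA.compl, union_compl_self]
  have h4 := hdiag hA.compl
  simp only [Matrix.of_apply] at h1
  exact abs_nonpos_iff.1 (by linarith)

/-- Each of the `d²` entries contributes at most `C` times the trace. The constant is crude, but any
constant serves in Gronwall's inequality. -/
theorem abs_sum_vectorIntegral_le_of_posSemidef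
    (hR : ∀ A : Set α, MeasurableSet A → (Matrix.of fun i j => R i j A).PosSemidef)
    {f : Fin d → Fin d → α → ℝ} {C : ℝ} (hf : ∀ i j x, |f i j x| ≤ C) (hC : 0 ≤ C) :
    |∑ i, ∑ j, ∫ᵛ x, f i j x ∂•(R i j)| ≤ (d : ℝ) ^ 2 * C * ∑ k, R k k univ := by
  calc |∑ i, ∑ j, ∫ᵛ x, f i j x ∂•(R i j)|
      ≤ ∑ i : Fin d, ∑ j : Fin d, C * ∑ k, R k k univ := by
        refine (Finset.abs_sum_le_sum_abs _ _).trans (Finset.sum_le_sum fun i _ => ?_)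
        refine (Finset.abs_sum_le_sum_abs _ _).trans (Finset.sum_le_sum fun j _ => ?_)
        exact (norm_vectorIntegral_le (hf i j)).trans
          (mul_le_mul_of_nonneg_left (totalVariation_univ_le_of_posSemidef hR i j) hC)
    _ = _ := by simp; ring

end PosSemidef

/-- Weak-* measurability tested with the constant `1` gives measurability of the total masses. -/
theorem IsReynoldsStress.aemeasurable_sum_diag {T : ℝ}
    {R : ℝ → Matrix (Fin d) (Fin d) (SignedMeasure (Torus d))} (hR : IsReynoldsStress T R) :
    AEMeasurable (fun t => ∑ k, R t k k univ) (volume.restrict (Ioo 0 T)) := by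
  refine Finset.aemeasurable_fun_sum _ fun k _ => (hR.measurable k k 1).congr ?_
  refine Eventually.of_forall fun t => ?_
  have := VectorMeasure.integral_const (μ := R t k k) (B := ContinuousLinearMap.lsmul ℝ ℝ) (1 : ℝ)
  simp [this]

theorem IsReynoldsStress.integrable_sum_diag {T : ℝ}
    {R : ℝ → Matrix (Fin d) (Fin d) (SignedMeasure (Torus d))} (hR : IsReynoldsStress T R) :
    Integrable (fun t => ∑ k, R t k k univ) (volume.restrict (Ioo 0 T)) := by
  obtain ⟨C, hC⟩ := hR.bounded
  refine Integrable.of_bound hR.aemeasurable_sum_diag.aestronglyMeasurable (d * C : ℝ) ?_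
  filter_upwards [hC] with t ht
  calc |∑ k, R t k k univ| ≤ ∑ _k : Fin d, (C : ℝ) := by
        refine (Finset.abs_sum_le_sum_abs _ _).trans (Finset.sum_le_sum fun k _ => ?_)
        refine ((R t k k).norm_le_totalVariation univ).trans ?_
        exact ENNReal.toReal_mono ENNReal.coe_ne_top (ht k k)
    _ = d * C := by simp

/-! ### Signed measures on space-time and interior test functions -/

section Uniqueness

variable {α : Type*} {mα : MeasurableSpace α}

theorem lsmul_flip_eq : (ContinuousLinearMap.lsmul ℝ ℝ : ℝ →L[ℝ] ℝ →L[ℝ] ℝ).flip =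
    ContinuousLinearMap.lsmul ℝ ℝ := by
  ext; simp

theorem vectorIntegral_toSignedMeasure {P : Measure α} [IsFiniteMeasure P] (f : α → ℝ) :
    ∫ᵛ x, f x ∂•P.toSignedMeasure = ∫ x, f x ∂P := by
  rw [← VectorMeasure.integral_toSignedMeasure, lsmul_flip_eq]

theorem vectorIntegral_toSignedMeasure_sub {P N : Measure α} [IsFiniteMeasure P]
    [IsFiniteMeasure N] {f : α → ℝ} (hP : Integrable f P) (hN : Integrable f N) :
    ∫ᵛ x, f x ∂•(P.toSignedMeasure - N.toSignedMeasure) = ∫ x, f x ∂P - ∫ x, f x ∂N := by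
  rw [VectorMeasure.integral_sub_vectorMeasure, vectorIntegral_toSignedMeasure,
    vectorIntegral_toSignedMeasure]
  · rwa [VectorMeasure.Integrable, Measure.variation_toSignedMeasure]
  · rwa [VectorMeasure.Integrable, Measure.variation_toSignedMeasure]

/-- Splitting `g` into positive and negative part reduces the claim to measures with nonnegative
densities. -/
theorem vectorIntegral_withDensity {P : Measure α} {g f : α → ℝ} {C : ℝ} (hg : Integrable g P)
    (hf : AEStronglyMeasurable f P) (hC : ∀ x, |f x| ≤ C) :
    ∫ᵛ x, f x ∂•(P.withDensityᵥ g) = ∫ x, g x * f x ∂P := by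
  have hfin1 : IsFiniteMeasure (P.withDensity fun x => ENNReal.ofReal (g x)) :=
    isFiniteMeasure_withDensity_ofReal hg.2
  have hfin2 : IsFiniteMeasure (P.withDensity fun x => ENNReal.ofReal (-g x)) :=
    isFiniteMeasure_withDensity_ofReal hg.neg.2
  have hneg : AEMeasurable (fun x => ENNReal.ofReal (-g x)) P :=
    hg.1.aemeasurable.neg.ennreal_ofReal
  rw [withDensityᵥ_eq_withDensity_pos_part_sub_withDensity_neg_part hg,
    vectorIntegral_toSignedMeasure_sub,
    integral_withDensity_eq_integral_toReal_smul₀ hg.1.aemeasurable.ennreal_ofReal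
      (Eventually.of_forall fun _ => ENNReal.ofReal_lt_top),
    integral_withDensity_eq_integral_toReal_smul₀ hneg
      (Eventually.of_forall fun _ => ENNReal.ofReal_lt_top), ← integral_sub]
  · congr 1; funext x
    simp only [ENNReal.toReal_ofReal', smul_eq_mul, ← sub_mul]
    rcases le_total 0 (g x) with h | h
    · rw [max_eq_left h, max_eq_right (by linarith)]; ring
    · rw [max_eq_right h, max_eq_left (by linarith)]; ring
  · refine (hg.pos_part.mul_bdd (c := C) hf (Eventually.of_forall hC)).congr
      (Eventually.of_forall fun x => ?_)
    simp [ENNReal.toReal_ofReal']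
  · refine (hg.neg_part.mul_bdd (c := C) hf (Eventually.of_forall hC)).congr
      (Eventually.of_forall fun x => ?_)
    simp [ENNReal.toReal_ofReal']
  · exact Integrable.of_bound (hf.mono_ac (withDensity_absolutelyContinuous _ _)) C
      (Eventually.of_forall hC)
  · exact Integrable.of_bound (hf.mono_ac (withDensity_absolutelyContinuous _ _)) C
      (Eventually.of_forall hC)

end Uniqueness

/-- A smooth cutoff in time, supported in `[T/(k+3), T - T/(k+3)]`. -/
def timeCutoff (T : ℝ) (k : ℕ) (t : ℝ) : ℝ :=
  smoothStep (T / (k + 3)) (T / (k + 3)) t * (1 - smoothStep (T - 2 * (T / (k + 3))) (T / (k + 3)) t)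

theorem contDiff_timeCutoff (T : ℝ) (k : ℕ) : ContDiff ℝ ∞ (timeCutoff T k) :=
  (contDiff_smoothStep _ _).mul (contDiff_const.sub (contDiff_smoothStep _ _))

theorem abs_timeCutoff_le_two (T : ℝ) (k : ℕ) (t : ℝ) : |timeCutoff T k t| ≤ 2 := by
  rw [timeCutoff, abs_mul]
  have h1 := abs_smoothStep_le_one (T / (k + 3)) (T / (k + 3)) t
  have h2 := abs_smoothStep_le_one (T - 2 * (T / (k + 3))) (T / (k + 3)) t
  have h3 : |1 - smoothStep (T - 2 * (T / (k + 3))) (T / (k + 3)) t| ≤ 2 := by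
    refine (abs_sub _ _).trans ?_
    rw [abs_one]; linarith
  nlinarith [abs_nonneg (smoothStep (T / (k + 3)) (T / (k + 3)) t)]

theorem timeCutoff_eq_zero {T : ℝ} (hT : 0 < T) (k : ℕ) {t : ℝ}
    (ht : t ∉ Icc (T / (k + 3)) (T - T / (k + 3))) : timeCutoff T k t = 0 := by
  have hε : 0 < T / ((k : ℝ) + 3) := by positivity
  rw [mem_Icc, not_and_or, not_le, not_le] at ht
  rcases ht with h | h
  · rw [timeCutoff, smoothStep_of_le hε h.le, zero_mul]
  · rw [timeCutoff, smoothStep_of_ge (s := T - 2 * (T / (k + 3))) hε (by linarith), sub_self,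
      mul_zero]

theorem tendsto_timeCutoff {T : ℝ} (hT : 0 < T) {t : ℝ} (ht : t ∈ Ioo 0 T) :
    Tendsto (fun k => timeCutoff T k t) atTop (𝓝 1) := by
  have hlim : Tendsto (fun k : ℕ => 2 * (T / ((k : ℝ) + 3))) atTop (𝓝 0) := by
    have : Tendsto (fun k : ℕ => T / ((k : ℝ) + 3)) atTop (𝓝 0) :=
      tendsto_const_nhds.div_atTop (tendsto_atTop_add_const_right _ _ tendsto_natCast_atTop_atTop)
    simpa using this.const_mul 2
  refine tendsto_const_nhds.congr' ?_
  filter_upwards [hlim.eventually_le_const ht.1,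
    hlim.eventually_le_const (sub_pos.2 ht.2)] with k h1 h2
  have hε : 0 < T / ((k : ℝ) + 3) := by positivity
  rw [timeCutoff, smoothStep_of_ge hε (by linarith), smoothStep_of_le hε (by linarith)]
  simp

theorem isInteriorTest_timeCutoff_mul {T : ℝ} (hT : 0 < T) (k : ℕ) {χ : ℝ → ℝ}
    (hχ : ContDiff ℝ ∞ χ) {f : Torus d → ℝ} (hf : TorusSmooth f) :
    IsInteriorTest T (fun t x => timeCutoff T k t * χ t * f x) := by
  have hε : 0 < T / ((k : ℝ) + 3) := by positivity
  refine ⟨spaceTimeContDiff_mul ((contDiff_timeCutoff T k).mul hχ) hf, T / (k + 3),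
    T - T / (k + 3), hε, by linarith, fun t ht x => ?_⟩
  simp only [timeCutoff_eq_zero hT k ht, zero_mul]

theorem IsInteriorTest.exists_bound {T : ℝ} {φ : ℝ → Torus d → ℝ} (hφ : IsInteriorTest T φ) :
    ∃ C, ∀ t x, |φ t x| ≤ C := by
  obtain ⟨a, b, ha, hb, hab⟩ := hφ.2
  obtain ⟨C, hC⟩ := ((isCompact_Icc (a := a) (b := b)).prod
    (isCompact_univ (X := Torus d))).exists_bound_of_continuousOn hφ.1.continuous.continuousOn
  refine ⟨max C 0, fun t x => ?_⟩
  by_cases ht : t ∈ Icc a b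
  · exact (hC (t, x) ⟨ht, mem_univ _⟩).trans (le_max_left _ _)
  · rw [hab t ht, abs_zero]; exact le_max_right _ _

/-- Integrals of products `f(t) g(x)` determine a finite measure. Such a product is a bounded
pointwise limit, on the strip carrying both measures, of a time cutoff times a polynomial times a
mollification of `g`, the polynomials approximating `f` on `[0,T]` by Weierstrass. -/
theorem measure_ext_of_isInteriorTest {T : ℝ} (hT : 0 < T) {P N : Measure (ℝ × Torus d)}
    [IsFiniteMeasure P] [IsFiniteMeasure N] (hP : P (Ioo 0 T ×ˢ univ)ᶜ = 0)
    (hN : N (Ioo 0 T ×ˢ univ)ᶜ = 0)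
    (h : ∀ φ : ℝ → Torus d → ℝ, IsInteriorTest T φ →
      ∫ z, φ z.1 z.2 ∂P = ∫ z, φ z.1 z.2 ∂N) : P = N := by
  refine Measure.ext_of_integral_mul_boundedContinuousFunction fun f g => ?_
  have hq : ∀ k : ℕ, ∃ q : Polynomial ℝ, ∀ t ∈ Icc 0 T, |q.eval t - f t| < 1 / ((k : ℝ) + 1) :=
    fun k => exists_polynomial_near_of_continuousOn 0 T f f.continuous.continuousOn _
      (by positivity)
  choose q hq using hq
  set φ : ℕ → ℝ → Torus d → ℝ :=
    fun k t x => timeCutoff T k t * (q k).eval t * mollify k g x with hφ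
  have hgi : Integrable (g : Torus d → ℝ) := integrable_of_continuous g.continuous
  have hφt : ∀ k, IsInteriorTest T (φ k) := fun k =>
    isInteriorTest_timeCutoff_mul hT k (by simpa using (q k).contDiff_aeval (𝕜 := ℝ) ∞)
      (torusSmooth_mollify k hgi)
  have key : ∀ M : Measure (ℝ × Torus d), IsFiniteMeasure M → M (Ioo 0 T ×ˢ univ)ᶜ = 0 →
      Tendsto (fun k => ∫ z, φ k z.1 z.2 ∂M) atTop (𝓝 (∫ z, f z.1 * g z.2 ∂M)) := by
    intro M _ hM
    have hae : ∀ᵐ z ∂M, z.1 ∈ Ioo 0 T := by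
      filter_upwards [compl_mem_ae_iff.2 hM] with z hz
      simpa using hz
    refine tendsto_integral_of_dominated_convergence (fun _ => 2 * (‖f‖ + 1) * ‖g‖)
      (fun k => (hφt k).1.continuous.aestronglyMeasurable) (integrable_const _) (fun k => ?_) ?_
    · filter_upwards [hae] with z hz
      have h1 : |(q k).eval z.1| ≤ ‖f‖ + 1 := by
        have h2 := hq k z.1 (Ioo_subset_Icc_self hz)
        have h3 : 1 / ((k : ℝ) + 1) ≤ 1 := by
          rw [div_le_one (by positivity)]; linarith [(Nat.cast_nonneg k : (0 : ℝ) ≤ k)]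
        have h4 : |f z.1| ≤ ‖f‖ := f.norm_coe_le_norm z.1
        calc |(q k).eval z.1| = |((q k).eval z.1 - f z.1) + f z.1| := by ring_nf
          _ ≤ _ := (abs_add_le _ _).trans (by linarith)
      have h5 : |mollify k g z.2| ≤ ‖g‖ :=
        abs_mollify_le k (Eventually.of_forall fun x => g.norm_coe_le_norm x) z.2
      rw [hφ, Real.norm_eq_abs, abs_mul, abs_mul]
      have := abs_timeCutoff_le_two T k z.1
      gcongr
    · filter_upwards [hae] with z hz
      have h1 : Tendsto (fun k => (q k).eval z.1) atTop (𝓝 (f z.1)) := by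
        rw [tendsto_iff_dist_tendsto_zero]
        refine squeeze_zero (fun _ => dist_nonneg)
          (fun k => (hq k z.1 (Ioo_subset_Icc_self hz)).le) tendsto_one_div_add_atTop_nhds_zero_nat
      simpa using ((tendsto_timeCutoff hT hz).mul h1).mul
        (tendsto_mollify_of_continuous g.continuous z.2)
  refine tendsto_nhds_unique (key P inferInstance hP) ?_
  simp only [h _ (hφt _)]
  exact key N inferInstance hN

/-- The Jordan parts are, up to sign, restrictions of `σ` to Hahn sets, so they are carried by the
strip; the hypothesis says that they agree on test functions. -/
theorem signedMeasure_eq_zero_of_isInteriorTest {T : ℝ} (hT : 0 < T)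
    {σ : SignedMeasure (ℝ × Torus d)}
    (hσ : ∀ A, MeasurableSet A → A ⊆ (Ioo 0 T ×ˢ univ)ᶜ → σ A = 0)
    (h : ∀ φ : ℝ → Torus d → ℝ, IsInteriorTest T φ → ∫ᵛ z, φ z.1 z.2 ∂•σ = 0) : σ = 0 := by
  have hstrip : MeasurableSet (Ioo 0 T ×ˢ univ : Set (ℝ × Torus d))ᶜ :=
    (measurableSet_Ioo.prod MeasurableSet.univ).compl
  obtain ⟨B, hB, hB1, hB2, hpos, hneg⟩ := σ.toJordanDecomposition_spec
  set P := σ.toJordanDecomposition.posPart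
  set N := σ.toJordanDecomposition.negPart
  have hP : P (Ioo 0 T ×ˢ univ)ᶜ = 0 := by
    rw [← measureReal_eq_zero_iff, hpos, SignedMeasure.toMeasureOfZeroLE_real_apply _ hB1 hB hstrip,
      hσ _ (hB.inter hstrip) inter_subset_right]
  have hN : N (Ioo 0 T ×ˢ univ)ᶜ = 0 := by
    rw [← measureReal_eq_zero_iff, hneg,
      SignedMeasure.toMeasureOfLEZero_real_apply _ hB2 hB.compl hstrip,
      hσ _ (hB.compl.inter hstrip) inter_subset_right, neg_zero]
  have hσeq : σ = P.toSignedMeasure - N.toSignedMeasure :=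
    σ.toSignedMeasure_toJordanDecomposition.symm
  have hPN : P = N := by
    refine measure_ext_of_isInteriorTest hT hP hN fun φ hφ => ?_
    obtain ⟨C, hC⟩ := hφ.exists_bound
    have hi : ∀ M : Measure (ℝ × Torus d), IsFiniteMeasure M →
        Integrable (fun z : ℝ × Torus d => φ z.1 z.2) M := fun M _ =>
      Integrable.of_bound hφ.1.continuous.aestronglyMeasurable C
        (Eventually.of_forall fun z => hC _ _)
    have := h φ hφ
    rw [hσeq, vectorIntegral_toSignedMeasure_sub (hi P inferInstance) (hi N inferInstance)] at this
    exact sub_eq_zero.1 this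
  rw [hσeq]
  simp only [hPN, sub_self]

theorem spaceTime_eq_restrict (T : ℝ) :
    spaceTime d T = (volume : Measure (ℝ × Torus d)).restrict (Ioo 0 T ×ˢ univ) := by
  rw [spaceTime, Measure.volume_eq_prod, ← Measure.prod_restrict, Measure.restrict_univ]

theorem integral_spaceTime {T : ℝ} (hT : 0 ≤ T) {f : ℝ × Torus d → ℝ}
    (hf : Integrable f (spaceTime d T)) :
    ∫ z, f z ∂(spaceTime d T) = ∫ t in (0)..T, ∫ x, f (t, x) := by
  rw [spaceTime, integral_prod _ hf, intervalIntegral.integral_of_le hT,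
    integral_Ioc_eq_integral_Ioo]

/-- Both `μ i j` and the measure with density `½ (G i j + G j i)`, cut off outside the strip,
represent the same distribution there and hence coincide. Uniqueness of the Lebesgue decomposition,
with singular part zero, identifies the density. -/
theorem IsSymGradientMeasure.acDensity_ae_eq {T : ℝ} (hT : 0 < T)
    {v : ℝ → Torus d → Fin d → ℝ}
    {μ : Matrix (Fin d) (Fin d) (SignedMeasure (ℝ × Torus d))}
    (hμ : IsSymGradientMeasure T v μ) {G : ℝ → Torus d → Matrix (Fin d) (Fin d) ℝ}
    (hGi : ∀ i j, Integrable (fun z : ℝ × Torus d => G z.1 z.2 i j) (spaceTime d T))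
    (hG : IsWeakGradient T v G) :
    ∀ᵐ z ∂(spaceTime d T), acDensity μ z = symPart (G z.1 z.2) := by
  have hstrip : MeasurableSet (Ioo 0 T ×ˢ univ : Set (ℝ × Torus d)) :=
    measurableSet_Ioo.prod MeasurableSet.univ
  have main : ∀ i j, ∀ᵐ z ∂(spaceTime d T), (μ i j).rnDeriv volume z =
      1 / 2 * (G z.1 z.2 i j + G z.1 z.2 j i) := by
    intro i j
    set g : ℝ × Torus d → ℝ := fun z => 1 / 2 * (G z.1 z.2 i j + G z.1 z.2 j i) with hg
    have hgi : Integrable g (spaceTime d T) := ((hGi i j).add (hGi j i)).const_mul _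
    have hind : Integrable ((Ioo 0 T ×ˢ univ).indicator g) volume := by
      rw [integrable_indicator_iff hstrip, IntegrableOn, ← spaceTime_eq_restrict]
      exact hgi
    have hμg : μ i j = volume.withDensityᵥ ((Ioo 0 T ×ˢ univ).indicator g) := by
      rw [← sub_eq_zero]
      refine signedMeasure_eq_zero_of_isInteriorTest hT (fun A hA hsub => ?_) fun φ hφ => ?_
      · have h1 : μ i j A = 0 := SignedMeasure.null_of_totalVariation_zero _
          (measure_mono_null hsub (hμ.carried i j))
        have h2 : ∫ z in A, (Ioo 0 T ×ˢ univ).indicator g z = 0 :=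
          setIntegral_eq_zero_of_forall_eq_zero fun z hz => indicator_of_notMem (hsub hz) _
        rw [sub_apply, h1, withDensityᵥ_apply hind hA, h2, sub_zero]
      · obtain ⟨C, hC⟩ := hφ.exists_bound
        have hφm : ∀ M : Measure (ℝ × Torus d),
            AEStronglyMeasurable (fun z : ℝ × Torus d => φ z.1 z.2) M :=
          fun M => hφ.1.continuous.aestronglyMeasurable
        have hφi : ∀ ν : SignedMeasure (ℝ × Torus d),
            ν.Integrable (fun z : ℝ × Torus d => φ z.1 z.2) := fun ν =>
          MeasureTheory.Integrable.of_bound (hφm _) C (Eventually.of_forall fun z => hC _ _)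
        rw [VectorMeasure.integral_sub_vectorMeasure (hφi _) (hφi _),
          vectorIntegral_withDensity hind (hφm _) (fun z => hC _ _), hμ.deriv_eq i j φ hφ]
        have h1 : ∫ z, (Ioo 0 T ×ˢ univ).indicator g z * φ z.1 z.2 =
            ∫ z, g z * φ z.1 z.2 ∂(spaceTime d T) := by
          rw [spaceTime_eq_restrict, ← integral_indicator hstrip]
          congr 1; funext z
          by_cases hz : z ∈ (Ioo 0 T ×ˢ univ : Set (ℝ × Torus d)) <;> simp [hz]
        rw [h1, integral_spaceTime hT.le
          (hgi.mul_bdd (c := C) (hφm _) (Eventually.of_forall fun z => hC _ _)),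
          ← intervalIntegral.integral_neg, sub_eq_zero, intervalIntegral.integral_of_le hT.le,
          intervalIntegral.integral_of_le hT.le, integral_Ioc_eq_integral_Ioo,
          integral_Ioc_eq_integral_Ioo]
        refine integral_congr_ae ?_
        filter_upwards [hG] with t ht
        have hs : TorusSmooth (φ t) := hφ.1.slice t
        have hp : ∀ k, Continuous (pderiv k (φ t)) := fun k => hs.one.continuous_pderiv k
        have hi1 : Integrable fun x => v t x i * pderiv j (φ t) x := by
          simpa only [mul_comm] using integrable_continuous_mul (hp j) (ht i j).1
        have hi2 : Integrable fun x => v t x j * pderiv i (φ t) x := by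
          simpa only [mul_comm] using integrable_continuous_mul (hp i) (ht j i).1
        have hi3 : Integrable fun x => G t x i j * φ t x := by
          simpa only [mul_comm] using integrable_continuous_mul hs.one.continuous (ht i j).2.1
        have hi4 : Integrable fun x => G t x j i * φ t x := by
          simpa only [mul_comm] using integrable_continuous_mul hs.one.continuous (ht j i).2.1
        simp only [hg]
        rw [integral_const_mul, integral_add hi1 hi2, (ht i j).2.2 _ hs, (ht j i).2.2 _ hs]
        simp only [mul_assoc, add_mul]
        rw [integral_const_mul, integral_add hi3 hi4]
        ring
    have h := SignedMeasure.eq_rnDeriv (s := μ i j) (μ := volume) 0 _ hind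
      VectorMeasure.MutuallySingular.zero_left (by rw [zero_add, hμg])
    rw [spaceTime_eq_restrict]
    filter_upwards [ae_restrict_of_ae h, ae_restrict_mem hstrip] with z hz hzs
    rw [← hz, indicator_of_mem hzs]
  have := ae_all_iff.2 fun i => ae_all_iff.2 (main i)
  filter_upwards [this] with z hz
  ext i j
  simp [acDensity, symPart, hz]

/-! ### The potential and its conjugate -/

theorem symPart_isSymm (A : Matrix (Fin d) (Fin d) ℝ) : (symPart A).IsSymm := by
  ext i j
  simp only [symPart, Matrix.transpose_apply, Matrix.smul_apply, Matrix.add_apply, add_comm]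

theorem frob_symPart {S : Matrix (Fin d) (Fin d) ℝ} (hS : S.IsSymm)
    (G : Matrix (Fin d) (Fin d) ℝ) : frob S (symPart G) = ∑ i, ∑ j, S i j * G i j := by
  have h : ∑ i, ∑ j, S i j * G j i = ∑ i, ∑ j, S i j * G i j := by
    rw [Finset.sum_comm]
    simp only [hS.apply]
  calc frob S (symPart G)
      = 1 / 2 * ∑ i, ∑ j, S i j * G i j + 1 / 2 * ∑ i, ∑ j, S i j * G j i := by
        simp only [frob, symPart, Matrix.smul_apply, Matrix.add_apply, Matrix.transpose_apply,
          smul_eq_mul, Finset.mul_sum, ← Finset.sum_add_distrib]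
        refine Finset.sum_congr rfl fun i _ => Finset.sum_congr rfl fun j _ => ?_
        ring
    _ = _ := by rw [h]; ring

/-- A finite convex function on a finite-dimensional space is continuous. Composition with the
symmetric part makes the domain open, `F` being controlled only on symmetric matrices. -/
theorem IsPotential.continuous_symPart {F : Matrix (Fin d) (Fin d) ℝ → ℝ} (hF : IsPotential F) :
    Continuous fun A : Fin d → Fin d → ℝ => F (symPart (Matrix.of A)) := by
  have hc : ConvexOn ℝ univ fun A : Fin d → Fin d → ℝ => F (symPart (Matrix.of A)) := by
    refine ⟨convex_univ, fun A _ B _ a b ha hb hab => ?_⟩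
    have h := hF.convex.2 (symPart_isSymm (Matrix.of A)) (symPart_isSymm (Matrix.of B)) ha hb hab
    have he : symPart (Matrix.of (a • A + b • B)) =
        a • symPart (Matrix.of A) + b • symPart (Matrix.of B) := by
      ext i j
      simp [symPart]
      ring
    simpa only [he] using h
  exact continuousOn_univ.1 (hc.continuousOn isOpen_univ)

/-- A supremum of continuous functions is lower semicontinuous. -/
theorem measurable_conjugate (F : Matrix (Fin d) (Fin d) ℝ → ℝ) :
    Measurable fun A : Fin d → Fin d → ℝ => conjugate F (Matrix.of A) := by
  refine LowerSemicontinuous.measurable (lowerSemicontinuous_biSup fun D _ => ?_)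
  refine Continuous.lowerSemicontinuous (continuous_coe_real_ereal.comp ?_)
  simp only [frob, Matrix.of_apply]
  fun_prop

theorem frob_sub_le_conjugate (F : Matrix (Fin d) (Fin d) ℝ → ℝ) (S : Matrix (Fin d) (Fin d) ℝ)
    {D : Matrix (Fin d) (Fin d) ℝ} (hD : D.IsSymm) :
    ((frob S D - F D : ℝ) : EReal) ≤ conjugate F S :=
  le_iSup₂_of_le (f := fun (D : Matrix (Fin d) (Fin d) ℝ)
    (_ : D ∈ {D : Matrix (Fin d) (Fin d) ℝ | D.IsSymm}) => ((frob S D - F D : ℝ) : EReal))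
    D hD le_rfl

theorem IsPotential.conjugate_nonneg {F : Matrix (Fin d) (Fin d) ℝ → ℝ} (hF : IsPotential F)
    (S : Matrix (Fin d) (Fin d) ℝ) : 0 ≤ conjugate F S := by
  have h := frob_sub_le_conjugate F S (D := 0) Matrix.isSymm_zero
  have h0 : frob S 0 = 0 := by simp [frob]
  rw [h0, hF.map_zero] at h
  simpa using h

theorem IsPotential.coe_toReal_conjugate {F : Matrix (Fin d) (Fin d) ℝ → ℝ} (hF : IsPotential F)
    {S : Matrix (Fin d) (Fin d) ℝ} (h : (conjugate F S).toENNReal < ⊤) :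
    (((conjugate F S).toENNReal.toReal : ℝ) : EReal) = conjugate F S := by
  rw [EReal.coe_ennreal_toReal h.ne, EReal.coe_toENNReal (hF.conjugate_nonneg S)]

/-- An integrated Fenchel-Young inequality, with the case of equality. -/
theorem IsPotential.integral_frob_le {α : Type*} {mα : MeasurableSpace α} {P : Measure α}
    {F : Matrix (Fin d) (Fin d) ℝ → ℝ} (hF : IsPotential F)
    {S G : α → Matrix (Fin d) (Fin d) ℝ}
    (hS : ∀ i j, AEMeasurable (fun z => S z i j) P) (hG : ∀ i j, AEMeasurable (fun z => G z i j) P)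
    (hsymm : ∀ᵐ z ∂P, (S z).IsSymm)
    (hSG : Integrable (fun z => ∑ i, ∑ j, S z i j * G z i j) P)
    (hfin : ∫⁻ z, ENNReal.ofReal (F (symPart (G z))) ∂P +
      ∫⁻ z, (conjugate F (S z)).toENNReal ∂P ≠ ⊤) :
    ∫ z, ∑ i, ∑ j, S z i j * G z i j ∂P ≤ (∫⁻ z, ENNReal.ofReal (F (symPart (G z))) ∂P +
      ∫⁻ z, (conjugate F (S z)).toENNReal ∂P).toReal ∧
    ((∫⁻ z, ENNReal.ofReal (F (symPart (G z))) ∂P +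
      ∫⁻ z, (conjugate F (S z)).toENNReal ∂P).toReal ≤ ∫ z, ∑ i, ∑ j, S z i j * G z i j ∂P →
      ∀ᵐ z ∂P, ((frob (S z) (symPart (G z)) : ℝ) : EReal) =
        (F (symPart (G z)) : EReal) + conjugate F (S z)) := by
  obtain ⟨hfa, hfb⟩ := ENNReal.add_ne_top.1 hfin
  have hFm : AEMeasurable (fun z => F (symPart (G z))) P :=
    hF.continuous_symPart.measurable.comp_aemeasurable
      (aemeasurable_pi_lambda (fun z i j => G z i j) fun i => aemeasurable_pi_lambda _ fun j => hG i j)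
  have hCm : AEMeasurable (fun z => (conjugate F (S z)).toENNReal) P :=
    measurable_ereal_toENNReal.comp_aemeasurable
      ((measurable_conjugate F).comp_aemeasurable
        (aemeasurable_pi_lambda (fun z i j => S z i j)
          fun i => aemeasurable_pi_lambda _ fun j => hS i j))
  have hFn : ∀ z, 0 ≤ F (symPart (G z)) := fun z => hF.nonneg _ (symPart_isSymm _)
  have hFi : Integrable (fun z => F (symPart (G z))) P :=
    ⟨hFm.aestronglyMeasurable, by
      rw [hasFiniteIntegral_iff_ofReal (Eventually.of_forall hFn)]
      exact hfa.lt_top⟩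
  have hCi : Integrable (fun z => (conjugate F (S z)).toENNReal.toReal) P :=
    integrable_toReal_of_lintegral_ne_top hCm hfb
  have hCfin : ∀ᵐ z ∂P, (conjugate F (S z)).toENNReal < ⊤ := ae_lt_top' hCm hfb
  have heq : (∫⁻ z, ENNReal.ofReal (F (symPart (G z))) ∂P +
      ∫⁻ z, (conjugate F (S z)).toENNReal ∂P).toReal =
      ∫ z, (F (symPart (G z)) + (conjugate F (S z)).toENNReal.toReal) ∂P := by
    rw [ENNReal.toReal_add hfa hfb, integral_add hFi hCi, integral_toReal hCm hCfin,
      integral_eq_lintegral_of_nonneg_ae (Eventually.of_forall hFn) hFm.aestronglyMeasurable]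
  have hle : ∀ᵐ z ∂P, ∑ i, ∑ j, S z i j * G z i j ≤
      F (symPart (G z)) + (conjugate F (S z)).toENNReal.toReal := by
    filter_upwards [hsymm, hCfin] with z hz hz2
    have h := frob_sub_le_conjugate F (S z) (symPart_isSymm (G z))
    rw [← hF.coe_toReal_conjugate hz2, EReal.coe_le_coe_iff, frob_symPart hz] at h
    linarith
  rw [heq]
  refine ⟨integral_mono_ae hSG (hFi.add hCi) hle, fun h => ?_⟩
  have hi := (hFi.add hCi).sub hSG
  -- In the case of equality the pointwise nonnegative Fenchel-Young defect has integral zero, so it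
  -- vanishes almost everywhere.
  have h0 : ∫ z, (F (symPart (G z)) + (conjugate F (S z)).toENNReal.toReal -
      ∑ i, ∑ j, S z i j * G z i j) ∂P = 0 := by
    refine (integral_sub (hFi.add hCi) hSG).trans ?_
    exact sub_eq_zero.2 (le_antisymm h (integral_mono_ae hSG (hFi.add hCi) hle))
  have h1 := (integral_eq_zero_iff_of_nonneg_ae
    (by filter_upwards [hle] with z hz using sub_nonneg.2 hz) hi).1 h0
  filter_upwards [h1, hsymm, hCfin] with z hz hz1 hz2
  rw [← hF.coe_toReal_conjugate hz2, frob_symPart hz1, ← EReal.coe_add, EReal.coe_eq_coe_iff]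
  exact (sub_eq_zero.1 hz).symm

/-! ### Solenoidality and the initial datum -/

theorem TorusContDiff.spaceTime {n : WithTop ℕ∞} {f : Torus d → ℝ} (hf : TorusContDiff n f) :
    SpaceTimeContDiff n (fun _ : ℝ => f) := by
  simpa using! spaceTimeContDiff_mul (χ := fun _ => 1) contDiff_const hf

/-- Test functions `χ(t) ψ(x)` localize the space-time identity to almost every time. The space
integral is continuous in time, so it vanishes at all times, endpoints included; the time `0` is
needed for the initial datum. -/
theorem integral_sum_mul_pderiv_eq_zero {T : ℝ} (hT : 0 < T) {v : ℝ → Torus d → Fin d → ℝ}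
    (hv : ∀ i, L2ContinuousOn (fun t x => v t x i) (Icc 0 T))
    (hinc : ∀ φ : ℝ → Torus d → ℝ, SpaceTimeContDiff 1 φ →
      ∫ t in (0)..T, ∫ x, ∑ i, v t x i * pderiv i (φ t) x = 0)
    {ψ : Torus d → ℝ} (hψ : TorusContDiff 1 ψ) {t : ℝ} (ht : t ∈ Icc 0 T) :
    ∫ x, ∑ i, v t x i * pderiv i ψ x = 0 := by
  set g : ℝ → ℝ := fun t => ∫ x, ∑ i, v t x i * pderiv i ψ x with hg
  have hψc : ∀ i, Continuous (pderiv i ψ) := fun i => hψ.continuous_pderiv i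
  have hgc : ContinuousOn g (Icc 0 T) := by
    have h : ContinuousOn (fun t => ∑ i, ∫ x, v t x i * pderiv i ψ x) (Icc 0 T) :=
      continuousOn_finsetSum _ fun i _ =>
        (hv i).continuousOn_integral_mul_continuous (φ := fun _ => pderiv i ψ)
          ((hψc i).comp continuous_snd)
    refine h.congr fun t ht => ?_
    rw [hg]
    refine integral_finsetSum _ fun i _ => ?_
    simpa only [mul_comm] using
      integrable_continuous_mul (hψc i) (integrable_of_memLp_two ((hv i).1 t ht))
  have hae : ∀ᵐ t, t ∈ Ioo 0 T → g t = 0 := by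
    refine IsOpen.ae_eq_zero_of_integral_contDiff_smul_eq_zero (E := ℝ) (f := g) isOpen_Ioo
      ((hgc.mono Ioo_subset_Icc_self).locallyIntegrableOn measurableSet_Ioo) fun χ hχ _ hsub => ?_
    have h1 := hinc (fun t x => χ t * ψ x)
      (spaceTimeContDiff_mul (hχ.of_le (by norm_num)) hψ)
    rw [intervalIntegral.integral_of_le hT.le, integral_Ioc_eq_integral_Ioo] at h1
    rw [← setIntegral_eq_integral_of_forall_compl_eq_zero (s := Ioo 0 T)]
    · refine Eq.trans ?_ h1
      refine integral_congr_ae (Eventually.of_forall fun t => ?_)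
      simp only [hg, smul_eq_mul, ← integral_const_mul, Finset.mul_sum, pderiv_const_mul _ hψ]
      congr 1; funext x
      exact Finset.sum_congr rfl fun i _ => by ring
    · intro t ht
      rw [image_eq_zero_of_notMem_tsupport fun h => ht (hsub h), zero_smul]
  have h0 : g =ᵐ[volume.restrict (Icc 0 T)] fun _ => 0 := by
    rw [← restrict_Ioo_eq_restrict_Icc]
    exact (ae_restrict_iff' measurableSet_Ioo).2 hae
  exact Measure.eqOn_Icc_of_ae_eq _ hT.ne h0 hgc continuousOn_const ht

theorem WeaklyDivFree.sub {u w : Torus d → Fin d → ℝ} (hu : WeaklyDivFree u)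
    (hw : WeaklyDivFree w) : WeaklyDivFree fun x i => u x i - w x i := by
  refine ⟨fun i => (hu.1 i).sub (hw.1 i), fun φ hφ => ?_⟩
  have hi : ∀ {f : Torus d → Fin d → ℝ}, WeaklyDivFree f →
      Integrable fun x => ∑ i, f x i * pderiv i φ x := fun hf =>
    integrable_finsetSum _ fun i _ => by
      simpa only [mul_comm] using
        integrable_continuous_mul (hφ.one.continuous_pderiv i) (hf.1 i)
  simp only [sub_mul, Finset.sum_sub_distrib]
  rw [integral_sub (hi hu) (hi hw), hu.2 φ hφ, hw.2 φ hφ, sub_zero]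

/-- Mollifications converge in `L²`, so the limit of the hypothesis is `∑ ∫ u_i² = 0`. -/
theorem ae_eq_zero_of_integral_mul_mollify_eq_zero {u : Torus d → Fin d → ℝ}
    (hu : ∀ i, MemLp (fun x => u x i) 2 volume)
    (h : ∀ n, ∫ x, ∑ i, u x i * mollify n (fun y => u y i) x = 0) (i : Fin d) :
    (fun x => u x i) =ᵐ[volume] 0 := by
  have hlim : Tendsto (fun n => ∫ x, ∑ i, u x i * mollify n (fun y => u y i) x) atTop
      (𝓝 (∑ i, ∫ x, u x i * u x i)) := by
    have : ∀ n, ∫ x, ∑ i, u x i * mollify n (fun y => u y i) x =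
        ∑ i, ∫ x, u x i * mollify n (fun y => u y i) x := fun n =>
      integral_finsetSum _ fun i _ => by
        simpa only [mul_comm] using integrable_continuous_mul
          (continuous_mollify n (integrable_of_memLp_two (hu i))) (integrable_of_memLp_two (hu i))
    simp only [this]
    exact tendsto_finsetSum _ fun i _ => tendsto_integral_mollify_mul (hu i) (hu i)
  simp only [h] at hlim
  have h0 := tendsto_nhds_unique hlim tendsto_const_nhds
  have h1 := (Finset.sum_eq_zero_iff_of_nonneg
    (fun i _ => integral_nonneg fun x => mul_self_nonneg (u x i))).1 h0 i (Finset.mem_univ i)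
  have h2 := (integral_eq_zero_iff_of_nonneg (fun x => mul_self_nonneg (u x i))
    ((hu i).integrable_mul (hu i))).1 h1
  filter_upwards [h2] with x hx
  exact mul_self_eq_zero.1 hx

/-- At `τ = 0` the momentum equation says that `v 0 - v₀` is orthogonal to all solenoidal test
fields. The difference is itself solenoidal, so its own mollification is one of them. -/
theorem IsDissipativeSolution.ae_eq_initial {F : Matrix (Fin d) (Fin d) ℝ → ℝ} {T : ℝ}
    (hT : 0 < T) {v₀ : Torus d → Fin d → ℝ} {v : ℝ → Torus d → Fin d → ℝ}
    {S : ℝ → Torus d → Matrix (Fin d) (Fin d) ℝ}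
    {R : ℝ → Matrix (Fin d) (Fin d) (SignedMeasure (Torus d))}
    (hsol : IsDissipativeSolution F T v₀ v S R) (hdiv : WeaklyDivFree v₀)
    (hv0 : WeaklyDivFree (v 0)) (i : Fin d) :
    (fun x => v 0 x i) =ᵐ[volume] fun x => v₀ x i := by
  have h0 : (0 : ℝ) ∈ Icc 0 T := left_mem_Icc.2 hT.le
  have hu : ∀ i, MemLp (fun x => v 0 x i - v₀ x i) 2 volume := fun i =>
    (hsol.weakly_continuous.memLp 0 h0 i).sub (hsol.initial_memLp i)
  have h := ae_eq_zero_of_integral_mul_mollify_eq_zero (u := fun x i => v 0 x i - v₀ x i) hu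
    (fun n => ?_) i
  · filter_upwards [h] with x hx using sub_eq_zero.1 hx
  · have hm : ∀ i, TorusSmooth (mollify n fun y => v 0 y i - v₀ y i) := fun i =>
      torusSmooth_mollify n (integrable_of_memLp_two (hu i))
    have hmom := hsol.momentum 0 h0 (fun _ x i => mollify n (fun y => v 0 y i - v₀ y i) x)
      ⟨fun i => (hm i).one.spaceTime, fun t _ x => (hv0.sub hdiv).sum_pderiv_mollify n x⟩
    simp only [intervalIntegral.integral_same, sub_zero, add_zero] at hmom
    have hi : ∀ f : Torus d → Fin d → ℝ, (∀ i, Integrable fun x => f x i) →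
        Integrable fun x => ∑ i, f x i * mollify n (fun y => v 0 y i - v₀ y i) x :=
      fun f hf => integrable_finsetSum _ fun i _ => by
        simpa only [mul_comm] using integrable_continuous_mul (hm i).one.continuous (hf i)
    rw [← integral_sub (hi _ hv0.1) (hi _ hdiv.1)] at hmom
    simpa only [sub_mul, Finset.sum_sub_distrib] using hmom

/-! ### Mollified fields as test functions -/

theorem integrable_slice_of_spaceTime {T : ℝ} {f : ℝ × Torus d → ℝ}
    (hf : Integrable f (spaceTime d T)) :
    ∀ᵐ t ∂(volume.restrict (Ioo 0 T)), Integrable fun x => f (t, x) :=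
  hf.prod_right_ae

theorem intervalIntegrable_integral_mul {T : ℝ} {f : ℝ × Torus d → ℝ}
    (hf : Integrable f (spaceTime d T)) {b : Torus d → ℝ} (hb : Continuous b) {τ : ℝ}
    (hτ : τ ∈ Icc 0 T) : IntervalIntegrable (fun t => ∫ x, f (t, x) * b x) volume 0 τ := by
  obtain ⟨C, -, hC⟩ := exists_bound_of_continuous hb
  have h := (hf.mul_bdd (c := C) (hb.comp continuous_snd).aestronglyMeasurable
    (Eventually.of_forall fun z => hC z.2)).integral_prod_left
  rw [intervalIntegrable_iff_integrableOn_Ioo_of_le hτ.1]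
  exact IntegrableOn.mono_set h (Ioo_subset_Ioo_right hτ.2)

theorem integral_sum_sum_mul_sum {ι : Type} [Fintype ι] {W : Fin d → Fin d → Torus d → ℝ}
    (hW : ∀ i j, Integrable (W i j)) {b : ι → Fin d → Torus d → ℝ}
    (hb : ∀ m j, Continuous (b m j)) (σ : ι → Fin d → ℝ) :
    ∫ x, ∑ i, ∑ j, W i j x * ∑ m, σ m i * b m j x =
      ∑ i, ∑ j, ∑ m, σ m i * ∫ x, W i j x * b m j x := by
  have hi : ∀ i j m, Integrable fun x => W i j x * (σ m i * b m j x) := fun i j m => by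
    simpa only [mul_comm] using
      integrable_continuous_mul (f := fun x => σ m i * b m j x)
        (continuous_const.mul (hb m j)) (hW i j)
  simp only [Finset.mul_sum]
  rw [integral_finsetSum _ fun i _ => integrable_finsetSum _ fun j _ =>
    integrable_finsetSum _ fun m _ => hi i j m]
  refine Finset.sum_congr rfl fun i _ => ?_
  rw [integral_finsetSum _ fun j _ => integrable_finsetSum _ fun m _ => hi i j m]
  refine Finset.sum_congr rfl fun j _ => ?_
  rw [integral_finsetSum _ fun m _ => hi i j m]
  refine Finset.sum_congr rfl fun m _ => ?_
  rw [← integral_const_mul]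
  congr 1; funext x; ring

theorem integral_sum_mul_sum {ι : Type} [Fintype ι] {w : Fin d → Torus d → ℝ}
    (hw : ∀ i, Integrable (w i)) {b : ι → Torus d → ℝ} (hb : ∀ m, Continuous (b m))
    (σ : ι → Fin d → ℝ) :
    ∫ x, ∑ i, w i x * ∑ m, σ m i * b m x = ∑ i, ∑ m, σ m i * ∫ x, w i x * b m x := by
  have hi : ∀ i m, Integrable fun x => w i x * (σ m i * b m x) := fun i m => by
    simpa only [mul_comm] using
      integrable_continuous_mul (f := fun x => σ m i * b m x)
        (continuous_const.mul (hb m)) (hw i)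
  simp only [Finset.mul_sum]
  rw [integral_finsetSum _ fun i _ => integrable_finsetSum _ fun m _ => hi i m]
  refine Finset.sum_congr rfl fun i _ => ?_
  rw [integral_finsetSum _ fun m _ => hi i m]
  refine Finset.sum_congr rfl fun m _ => ?_
  rw [← integral_const_mul]
  congr 1; funext x; ring

/-- The coefficient `∫ v_i a` of a field, extended from `[0,T]` to all times by constants. -/
def coeff {T : ℝ} (hT : 0 ≤ T) (v : ℝ → Torus d → Fin d → ℝ) (a : Torus d → ℝ) (i : Fin d)
    (t : ℝ) : ℝ := ∫ y, v (projIcc 0 T hT t) y i * a y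

section Coefficients

variable {T : ℝ} {hT : 0 ≤ T} {v : ℝ → Torus d → Fin d → ℝ}

theorem coeff_of_mem {a : Torus d → ℝ} {i : Fin d} {t : ℝ} (ht : t ∈ Icc 0 T) :
    coeff hT v a i t = ∫ y, v t y i * a y := by
  rw [coeff, projIcc_of_mem hT ht]

theorem continuous_coeff (hv : ∀ i, L2ContinuousOn (fun t x => v t x i) (Icc 0 T))
    {a : Torus d → ℝ} (ha : Continuous a) (i : Fin d) : Continuous (coeff hT v a i) :=
  ((hv i).continuousOn_integral_mul_continuous (φ := fun _ => a)
    (ha.comp continuous_snd)).comp_continuous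
    (continuous_subtype_val.comp continuous_projIcc) fun t => (projIcc 0 T hT t).2

theorem exists_bound_coeff (hv : ∀ i, L2ContinuousOn (fun t x => v t x i) (Icc 0 T))
    {a : Torus d → ℝ} (ha : Continuous a) (i : Fin d) : ∃ C, ∀ t, |coeff hT v a i t| ≤ C := by
  obtain ⟨C, hC⟩ := (isCompact_Icc (a := 0) (b := T)).exists_bound_of_continuousOn
    (continuous_coeff (hT := hT) hv ha i).continuousOn
  refine ⟨C, fun t => ?_⟩
  have h := hC (projIcc 0 T hT t) (projIcc 0 T hT t).2
  rwa [coeff, projIcc_val] at h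

variable {ι : Type} [Fintype ι] {a : ι → Torus d → ℝ}

variable (hT v a) in
/-- The Steklov average in time of the mollification in space of `v`. -/
def steklovField (h t : ℝ) (x : Torus d) (i : Fin d) : ℝ :=
  ∑ m, steklov (coeff hT v (a m) i) h t * a m x

theorem pderiv_steklovField (ha : ∀ m, TorusSmooth (a m)) (h t : ℝ) (i j : Fin d) (x : Torus d) :
    pderiv j (fun y => steklovField hT v a h t y i) x =
      ∑ m, steklov (coeff hT v (a m) i) h t * pderiv j (a m) x := by
  rw [show (fun y => steklovField hT v a h t y i) =
    fun y => ∑ m, steklov (coeff hT v (a m) i) h t * a m y from rfl,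
    pderiv_sum (fun m _ => TorusContDiff.mul (torusContDiff_const _) (ha m).one)]
  exact Finset.sum_congr rfl fun m _ => pderiv_const_mul _ (ha m).one j x

/-- The gradient of the test field is a time average of gradients of mollifications of `v`; it
therefore inherits their bound `M` and their vanishing divergence. -/
theorem pderiv_steklovField_eq {n : ℕ} (hk : ∀ x y, kernel n (x - y) = ∑ m, a m x * a m y)
    (hv : ∀ i, L2ContinuousOn (fun t x => v t x i) (Icc 0 T))
    (ha : ∀ m, TorusSmooth (a m)) (h t : ℝ) (i j : Fin d) (x : Torus d) :
    pderiv j (fun y => steklovField hT v a h t y i) x =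
      steklov (fun s => pderiv j (mollify n fun y => v (projIcc 0 T hT s) y i) x) h t := by
  rw [pderiv_steklovField ha,
    ← steklov_sum_mul fun m => continuous_coeff hv (ha m).one.continuous i]
  congr 1; funext s
  rw [pderiv_mollify_eq_sum ha hk
    (integrable_of_memLp_two ((hv i).1 _ (projIcc 0 T hT s).2))]
  rfl

end Coefficients

/-! ### From Steklov averages to the mollified field -/

theorem intervalIntegrable_sum {κ : Type*} [Fintype κ] {f : κ → ℝ → ℝ} {α β : ℝ}
    (hf : ∀ k, IntervalIntegrable (f k) volume α β) :
    IntervalIntegrable (fun t => ∑ k, f k t) volume α β := by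
  have h := IntervalIntegrable.sum Finset.univ fun k _ => hf k
  rwa [show ∑ k, f k = fun t => ∑ k, f k t from funext fun t => Finset.sum_apply _ _ _] at h

theorem tendsto_integral_steklov_mul {c : ℝ → ℝ} (hc : Continuous c) {C : ℝ}
    (hC : ∀ t, |c t| ≤ C) {b : ℝ → ℝ} {τ : ℝ} (hb : IntervalIntegrable b volume 0 τ) :
    Tendsto (fun h => ∫ t in (0)..τ, steklov c h t * b t) (𝓝[>] 0)
      (𝓝 (∫ t in (0)..τ, c t * b t)) := by
  refine intervalIntegral.tendsto_integral_filter_of_dominated_convergence (fun t => C * |b t|)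
    (Eventually.of_forall fun h =>
      (contDiff_steklov hc h).continuous.aestronglyMeasurable.mul hb.aestronglyMeasurable_restrict_uIoc)
    ?_ (hb.abs.const_mul C) (Eventually.of_forall fun t _ => (tendsto_steklov hc t).mul_const _)
  filter_upwards [self_mem_nhdsWithin] with h hh
  refine Eventually.of_forall fun t _ => ?_
  rw [norm_mul]
  exact mul_le_mul_of_nonneg_right (abs_steklov_le hC hh t) (norm_nonneg _)

section Field

variable {T : ℝ} {hT : 0 ≤ T} {v : ℝ → Torus d → Fin d → ℝ} {ι : Type} [Fintype ι]
  {a : ι → Torus d → ℝ} {n : ℕ}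

theorem spaceTimeContDiff_steklovField
    (hv : ∀ i, L2ContinuousOn (fun t x => v t x i) (Icc 0 T))
    (ha : ∀ m, TorusSmooth (a m)) (h : ℝ) (i : Fin d) :
    SpaceTimeContDiff 1 fun t x => steklovField hT v a h t x i :=
  ContDiff.sum fun m _ =>
    spaceTimeContDiff_mul (contDiff_steklov (continuous_coeff hv (ha m).one.continuous i) h)
      (ha m).one

theorem deriv_steklovField (hv : ∀ i, L2ContinuousOn (fun t x => v t x i) (Icc 0 T))
    (ha : ∀ m, TorusSmooth (a m)) (h t : ℝ) (x : Torus d) (i : Fin d) :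
    deriv (fun s => steklovField hT v a h s x i) t =
      ∑ m, h⁻¹ * (coeff hT v (a m) i t - coeff hT v (a m) i (t - h)) * a m x := by
  refine HasDerivAt.deriv (HasDerivAt.fun_sum fun m _ => ?_)
  exact (hasDerivAt_steklov (continuous_coeff hv (ha m).one.continuous i) h t).mul_const _

theorem isSolenoidalTest_steklovField
    (hk : ∀ x y, kernel n (x - y) = ∑ m, a m x * a m y)
    (hv : ∀ i, L2ContinuousOn (fun t x => v t x i) (Icc 0 T))
    (ha : ∀ m, TorusSmooth (a m)) (hdiv : ∀ t ∈ Icc 0 T, WeaklyDivFree (v t)) (h : ℝ) :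
    IsSolenoidalTest T (steklovField hT v a h) := by
  refine ⟨spaceTimeContDiff_steklovField hv ha h, fun t _ x => ?_⟩
  have hc : ∀ i, Continuous fun s => pderiv i (mollify n fun y => v (projIcc 0 T hT s) y i) x := by
    intro i
    have : (fun s => pderiv i (mollify n fun y => v (projIcc 0 T hT s) y i) x) =
        fun s => ∑ m, coeff hT v (a m) i s * pderiv i (a m) x := by
      funext s
      rw [pderiv_mollify_eq_sum ha hk
        (integrable_of_memLp_two ((hv i).1 _ (projIcc 0 T hT s).2))]
      rfl
    rw [this]
    exact continuous_finsetSum _ fun m _ =>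
      (continuous_coeff hv (ha m).one.continuous i).mul continuous_const
  have h1 := steklov_sum_mul hc (fun _ => 1) h t
  simp only [mul_one, (hdiv _ (projIcc 0 T hT _).2).sum_pderiv_mollify n x] at h1
  simp only [pderiv_steklovField_eq hk hv ha, ← h1]
  simp [steklov]

/-- Testing with the Steklov averages amounts in the limit to testing with the mollified field. -/
theorem tendsto_integral_mul_pderiv_steklovField
    (hk : ∀ x y, kernel n (x - y) = ∑ m, a m x * a m y)
    (hv : ∀ i, L2ContinuousOn (fun t x => v t x i) (Icc 0 T))
    (ha : ∀ m, TorusSmooth (a m)) {W : Fin d → Fin d → ℝ × Torus d → ℝ}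
    (hW : ∀ i j, Integrable (W i j) (spaceTime d T)) {τ : ℝ} (hτ : τ ∈ Icc 0 T) :
    (∀ h, IntervalIntegrable (fun t => ∫ x, ∑ i, ∑ j, W i j (t, x) *
        pderiv j (fun y => steklovField hT v a h t y i) x) volume 0 τ) ∧
    Tendsto (fun h => ∫ t in (0)..τ, ∫ x, ∑ i, ∑ j, W i j (t, x) *
        pderiv j (fun y => steklovField hT v a h t y i) x) (𝓝[>] 0)
      (𝓝 (∫ t in (0)..τ, ∫ x, ∑ i, ∑ j, W i j (t, x) *
        pderiv j (mollify n fun y => v t y i) x)) ∧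
    IntervalIntegrable (fun t => ∫ x, ∑ i, ∑ j, W i j (t, x) *
        pderiv j (mollify n fun y => v t y i) x) volume 0 τ := by
  have hWt : ∀ᵐ t ∂(volume.restrict (Ioo 0 T)), ∀ i j, Integrable fun x => W i j (t, x) :=
    ae_all_iff.2 fun i => ae_all_iff.2 fun j => integrable_slice_of_spaceTime (hW i j)
  have hpa : ∀ m j, Continuous (pderiv j (a m)) := fun m j => (ha m).one.continuous_pderiv j
  have hb : ∀ i j m, IntervalIntegrable (fun t => ∫ x, W i j (t, x) * pderiv j (a m) x)
      volume 0 τ := fun i j m => intervalIntegrable_integral_mul (hW i j) (hpa m j) hτ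
  have hcc : ∀ i m, Continuous (coeff hT v (a m) i) := fun i m =>
    continuous_coeff hv (ha m).one.continuous i
  -- Interval integrals live on `(0, τ]` and the hypotheses on `(0, T)`; the single point `T` is
  -- discarded as a null set, which matters when `τ = T`.
  have hae : ∀ᵐ t, t ∈ uIoc (0 : ℝ) τ → t ∈ Icc 0 T ∧ ∀ i j, Integrable fun x => W i j (t, x) := by
    rw [ae_restrict_iff' measurableSet_Ioo] at hWt
    filter_upwards [hWt, Measure.ae_ne volume T] with t ht htT hmem
    rw [uIoc_of_le hτ.1] at hmem
    exact ⟨⟨hmem.1.le, hmem.2.trans hτ.2⟩,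
      ht ⟨hmem.1, lt_of_le_of_ne (hmem.2.trans hτ.2) htT⟩⟩
  -- Finite rank separates the variables: the space integral is a finite sum of a scalar Steklov
  -- average times an integrable function of time that does not depend on `h`.
  have hst : ∀ h, ∀ᵐ t, t ∈ uIoc (0 : ℝ) τ → ∫ x, ∑ i, ∑ j, W i j (t, x) *
      pderiv j (fun y => steklovField hT v a h t y i) x =
      ∑ i, ∑ j, ∑ m, steklov (coeff hT v (a m) i) h t * ∫ x, W i j (t, x) * pderiv j (a m) x := by
    intro h
    filter_upwards [hae] with t ht hmem
    simp only [pderiv_steklovField ha]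
    exact integral_sum_sum_mul_sum (ht hmem).2 hpa _
  have hmo : ∀ᵐ t, t ∈ uIoc (0 : ℝ) τ → ∫ x, ∑ i, ∑ j, W i j (t, x) *
      pderiv j (mollify n fun y => v t y i) x =
      ∑ i, ∑ j, ∑ m, coeff hT v (a m) i t * ∫ x, W i j (t, x) * pderiv j (a m) x := by
    filter_upwards [hae] with t ht hmem
    have h1 : ∀ i j x, pderiv j (mollify n fun y => v t y i) x =
        ∑ m, coeff hT v (a m) i t * pderiv j (a m) x := fun i j x => by
      simp only [coeff_of_mem (ht hmem).1]
      exact pderiv_mollify_eq_sum ha hk (integrable_of_memLp_two ((hv i).1 t (ht hmem).1)) j x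
    simp only [h1]
    exact integral_sum_sum_mul_sum (ht hmem).2 hpa _
  have hi1 : ∀ h i j m, IntervalIntegrable (fun t => steklov (coeff hT v (a m) i) h t *
      ∫ x, W i j (t, x) * pderiv j (a m) x) volume 0 τ := fun h i j m =>
    (hb i j m).continuousOn_mul (contDiff_steklov (hcc i m) h).continuous.continuousOn
  have hi2 : ∀ i j m, IntervalIntegrable (fun t => coeff hT v (a m) i t *
      ∫ x, W i j (t, x) * pderiv j (a m) x) volume 0 τ := fun i j m =>
    (hb i j m).continuousOn_mul (hcc i m).continuousOn
  have hsum : ∀ {g : Fin d → Fin d → ι → ℝ → ℝ},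
      (∀ i j m, IntervalIntegrable (g i j m) volume 0 τ) →
      IntervalIntegrable (fun t => ∑ i, ∑ j, ∑ m, g i j m t) volume 0 τ ∧
      ∫ t in (0)..τ, ∑ i, ∑ j, ∑ m, g i j m t = ∑ i, ∑ j, ∑ m, ∫ t in (0)..τ, g i j m t := by
    intro g hg
    have h1 : ∀ i j, IntervalIntegrable (fun t => ∑ m, g i j m t) volume 0 τ := fun i j =>
      intervalIntegrable_sum fun m => hg i j m
    have h2 : ∀ i, IntervalIntegrable (fun t => ∑ j, ∑ m, g i j m t) volume 0 τ := fun i =>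
      intervalIntegrable_sum fun j => h1 i j
    refine ⟨intervalIntegrable_sum fun i => h2 i, ?_⟩
    rw [intervalIntegral.integral_finsetSum fun i _ => h2 i]
    refine Finset.sum_congr rfl fun i _ => ?_
    rw [intervalIntegral.integral_finsetSum fun j _ => h1 i j]
    refine Finset.sum_congr rfl fun j _ => ?_
    rw [intervalIntegral.integral_finsetSum fun m _ => hg i j m]
  refine ⟨fun h => ?_, ?_, ?_⟩
  · refine (hsum (hi1 h)).1.congr_ae ?_
    rw [EventuallyEq, ae_restrict_iff' measurableSet_uIoc]
    filter_upwards [hst h] with t ht hmem using (ht hmem).symm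
  · rw [intervalIntegral.integral_congr_ae hmo, (hsum hi2).2]
    have : ∀ h, ∫ t in (0)..τ, ∫ x, ∑ i, ∑ j, W i j (t, x) *
        pderiv j (fun y => steklovField hT v a h t y i) x = ∑ i, ∑ j, ∑ m, ∫ t in (0)..τ,
          steklov (coeff hT v (a m) i) h t * ∫ x, W i j (t, x) * pderiv j (a m) x := fun h => by
      rw [intervalIntegral.integral_congr_ae (hst h), (hsum (hi1 h)).2]
    simp only [this]
    refine tendsto_finsetSum _ fun i _ => tendsto_finsetSum _ fun j _ =>
      tendsto_finsetSum _ fun m _ => ?_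
    obtain ⟨C, hC⟩ := exists_bound_coeff (hT := hT) hv (ha m).one.continuous i
    exact tendsto_integral_steklov_mul (hcc i m) hC (hb i j m)
  · refine (hsum hi2).1.congr_ae ?_
    rw [EventuallyEq, ae_restrict_iff' measurableSet_uIoc]
    filter_upwards [hmo] with t ht hmem using (ht hmem).symm

end Field

/-- The bound depends on `f` only through `M`, so the Reynolds term can be estimated before any
limit is taken. Measurability of the integrand in time is not needed: only the majorant has to be
integrable. -/
theorem IsReynoldsStress.abs_integral_le {T : ℝ}
    {R : ℝ → Matrix (Fin d) (Fin d) (SignedMeasure (Torus d))} (hR : IsReynoldsStress T R)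
    {f : ℝ → Fin d → Fin d → Torus d → ℝ} {M : ℝ} (hM : 0 ≤ M) (hf : ∀ t i j x, |f t i j x| ≤ M)
    {τ : ℝ} (hτ : τ ∈ Icc 0 T) :
    |∫ t in (0)..τ, ∑ i, ∑ j, ∫ᵛ x, f t i j x ∂•(R t i j)| ≤
      (d : ℝ) ^ 2 * M * ∫ t in (0)..τ, ∑ k, R t k k univ := by
  rw [← intervalIntegral.integral_const_mul]
  rw [← Real.norm_eq_abs]
  refine intervalIntegral.norm_integral_le_of_norm_le hτ.1 ?_ ?_
  · have h := hR.posSemidef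
    rw [ae_restrict_iff' measurableSet_Ioo] at h
    filter_upwards [h, Measure.ae_ne volume T] with t ht htT hmem
    exact abs_sum_vectorIntegral_le_of_posSemidef
      (ht ⟨hmem.1, lt_of_le_of_ne (hmem.2.trans hτ.2) htT⟩) (hf t) hM
  · rw [intervalIntegrable_iff_integrableOn_Ioo_of_le hτ.1]
    exact IntegrableOn.mono_set (hR.integrable_sum_diag.const_mul _) (Ioo_subset_Ioo_right hτ.2)

/-- The energy inequality, opposite to that of dissipative solutions, for the mollified field. -/
theorem IsDissipativeSolution.mollified_energy_ge {F : Matrix (Fin d) (Fin d) ℝ → ℝ} {T : ℝ}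
    (hT : 0 < T) {v₀ : Torus d → Fin d → ℝ} {v : ℝ → Torus d → Fin d → ℝ}
    {S : ℝ → Torus d → Matrix (Fin d) (Fin d) ℝ}
    {R : ℝ → Matrix (Fin d) (Fin d) (SignedMeasure (Torus d))}
    (hsol : IsDissipativeSolution F T v₀ v S R)
    (hv : ∀ i, L2ContinuousOn (fun t x => v t x i) (Icc 0 T))
    (hdiv : ∀ t ∈ Icc 0 T, WeaklyDivFree (v t))
    (hv0 : ∀ i, (fun x => v 0 x i) =ᵐ[volume] fun x => v₀ x i)
    (hvv : ∀ i j, Integrable (fun z : ℝ × Torus d => v z.1 z.2 i * v z.1 z.2 j) (spaceTime d T))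
    {M : ℝ} (hM0 : 0 ≤ M) (hM : ∀ t ∈ Icc 0 T, ∀ i j n x,
      |pderiv j (mollify n fun y => v t y i) x| ≤ M) (n : ℕ) {τ : ℝ} (hτ : τ ∈ Icc 0 T) :
    (∫ t in (0)..τ, ∫ x, ∑ i, ∑ j, v t x i * v t x j * pderiv j (mollify n fun y => v t y i) x) -
      (∫ t in (0)..τ, ∫ x, ∑ i, ∑ j, S t x i j * pderiv j (mollify n fun y => v t y i) x) -
      (d : ℝ) ^ 2 * M * ∫ t in (0)..τ, ∑ k, R t k k univ ≤
    1 / 2 * ((∫ x, ∑ i, v τ x i * mollify n (fun y => v τ y i) x) -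
      ∫ x, ∑ i, v 0 x i * mollify n (fun y => v 0 y i) x) := by
  obtain ⟨ι, _, a, ha, hk⟩ := hasFiniteRank_kernel (d := d) n
  have h0 : (0 : ℝ) ∈ Icc 0 T := left_mem_Icc.2 hT.le
  set c : ι → Fin d → ℝ → ℝ := fun m i => coeff hT.le v (a m) i with hcdef
  have hac : ∀ m, Continuous (a m) := fun m => (ha m).one.continuous
  have hpa : ∀ m j, Continuous (pderiv j (a m)) := fun m j => (ha m).one.continuous_pderiv j
  have hc : ∀ m i, Continuous (c m i) := fun m i => continuous_coeff hv (hac m) i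
  have hvi : ∀ t ∈ Icc 0 T, ∀ i, Integrable fun x => v t x i := fun t ht i =>
    integrable_of_memLp_two ((hv i).1 t ht)
  have hcm : ∀ {t}, t ∈ Icc 0 T → ∀ m i, ∫ y, v t y i * a m y = c m i t := fun ht m i =>
    (coeff_of_mem ht).symm
  -- Because the same `a_m` occur in both variables of the kernel, pairing `v` with its
  -- mollification gives the sum of the squared coefficients.
  have hquad : ∀ {t}, t ∈ Icc 0 T → ∫ x, ∑ i, v t x i * mollify n (fun y => v t y i) x =
      ∑ i, ∑ m, c m i t * c m i t := by
    intro t ht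
    simp only [fun i => mollify_eq_sum ha hk (hvi t ht i), hcm ht]
    rw [integral_sum_mul_sum (hvi t ht) hac]
    simp only [hcm ht]
  have htest : ∀ h, ∀ {t}, t ∈ Icc 0 T →
      ∫ x, ∑ i, v t x i * steklovField hT.le v a h t x i =
        ∑ i, ∑ m, steklov (c m i) h t * c m i t := by
    intro h t ht
    simp only [steklovField]
    rw [integral_sum_mul_sum (hvi t ht) hac]
    simp only [hcm ht]
    rfl
  have hQ := tendsto_integral_mul_pderiv_steklovField (hT := hT.le) hk hv ha hvv hτ
  have hSS := tendsto_integral_mul_pderiv_steklovField (hT := hT.le) hk hv ha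
    (W := fun i j z => S z.1 z.2 i j) hsol.stress_integrable hτ
  -- This is the momentum equation tested with the averaged field, with the time-derivative term
  -- bounded below by `le_integral_mul_deriv_steklov` and the Reynolds term by the uniform gradient
  -- bound.
  have hineq : ∀ h > 0,
      (1 / 2 * ∑ i, ∑ m, (steklov (fun t => c m i t ^ 2) h τ - steklov (fun t => c m i t ^ 2) h 0) +
        ∫ t in (0)..τ, ∫ x, ∑ i, ∑ j, v t x i * v t x j *
          pderiv j (fun y => steklovField hT.le v a h t y i) x) -
      (∫ t in (0)..τ, ∫ x, ∑ i, ∑ j, S t x i j *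
          pderiv j (fun y => steklovField hT.le v a h t y i) x) -
      (d : ℝ) ^ 2 * M * ∫ t in (0)..τ, ∑ k, R t k k univ ≤
      ∑ i, ∑ m, steklov (c m i) h τ * c m i τ - ∑ i, ∑ m, steklov (c m i) h 0 * c m i 0 := by
    intro h hh
    have hmom := hsol.momentum τ hτ (steklovField hT.le v a h)
      (isSolenoidalTest_steklovField hk hv ha hdiv h)
    have hinit : ∫ x, ∑ i, v₀ x i * steklovField hT.le v a h 0 x i =
        ∫ x, ∑ i, v 0 x i * steklovField hT.le v a h 0 x i := by
      refine integral_congr_ae ?_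
      filter_upwards [ae_all_iff.2 hv0] with x hx
      simp only [hx]
    rw [hinit, htest h hτ, htest h h0] at hmom
    have hdc : ∀ m i, Continuous fun t => c m i t * (h⁻¹ * (c m i t - c m i (t - h))) :=
      fun m i => by have := hc m i; fun_prop
    have hconv : ∫ t in (0)..τ, ∫ x, ((∑ i, v t x i *
          deriv (fun s => steklovField hT.le v a h s x i) t) +
        ∑ i, ∑ j, v t x i * v t x j * pderiv j (fun y => steklovField hT.le v a h t y i) x) =
        ∑ i, ∑ m, (∫ t in (0)..τ, c m i t * (h⁻¹ * (c m i t - c m i (t - h)))) +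
        ∫ t in (0)..τ, ∫ x, ∑ i, ∑ j, v t x i * v t x j *
          pderiv j (fun y => steklovField hT.le v a h t y i) x := by
      have hpt : ∀ t ∈ uIcc 0 τ, ∫ x, ((∑ i, v t x i *
            deriv (fun s => steklovField hT.le v a h s x i) t) +
          ∑ i, ∑ j, v t x i * v t x j * pderiv j (fun y => steklovField hT.le v a h t y i) x) =
          ∑ i, ∑ m, c m i t * (h⁻¹ * (c m i t - c m i (t - h))) +
          ∫ x, ∑ i, ∑ j, v t x i * v t x j *
            pderiv j (fun y => steklovField hT.le v a h t y i) x := by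
        intro t ht
        rw [uIcc_of_le hτ.1] at ht
        have htT : t ∈ Icc 0 T := ⟨ht.1, ht.2.trans hτ.2⟩
        have hcont := spaceTimeContDiff_steklovField (hT := hT.le) hv ha h
        have hcd : ∀ i, Continuous fun x =>
            deriv (fun s => steklovField hT.le v a h s x i) t := fun i =>
          (hcont i).continuous_deriv_time.comp (continuous_const.prodMk continuous_id)
        rw [integral_add]
        · congr 1
          simp only [deriv_steklovField hv ha]
          rw [integral_sum_mul_sum (hvi t htT) hac
            (fun m i => h⁻¹ * (coeff hT.le v (a m) i t - coeff hT.le v (a m) i (t - h)))]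
          simp only [hcm htT, hcdef, mul_comm]
        · exact integrable_finsetSum _ fun i _ => by
            simpa only [mul_comm] using integrable_continuous_mul (hcd i) (hvi t htT i)
        · refine integrable_finsetSum _ fun i _ => integrable_finsetSum _ fun j _ => ?_
          have h1 : Integrable fun x => v t x i * v t x j :=
            ((hv i).1 t htT).integrable_mul ((hv j).1 t htT)
          have h2 := integrable_continuous_mul (((hcont i).slice t).continuous_pderiv j) h1
          exact h2.congr (Eventually.of_forall fun x => mul_comm _ _)
      rw [intervalIntegral.integral_congr hpt, intervalIntegral.integral_add
        (Continuous.intervalIntegrable (continuous_finsetSum _ fun i _ =>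
          continuous_finsetSum _ fun m _ => hdc m i) _ _) (hQ.1 h)]
      congr 1
      rw [intervalIntegral.integral_finsetSum fun i _ => Continuous.intervalIntegrable
        (continuous_finsetSum _ fun m _ => hdc m i) _ _]
      refine Finset.sum_congr rfl fun i _ => ?_
      rw [intervalIntegral.integral_finsetSum fun m _ => (hdc m i).intervalIntegrable _ _]
    have hlow : 1 / 2 * ∑ i, ∑ m, (steklov (fun t => c m i t ^ 2) h τ -
        steklov (fun t => c m i t ^ 2) h 0) ≤
        ∑ i, ∑ m, (∫ t in (0)..τ, c m i t * (h⁻¹ * (c m i t - c m i (t - h)))) := by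
      simp only [Finset.mul_sum]
      exact Finset.sum_le_sum fun i _ => Finset.sum_le_sum fun m _ =>
        le_integral_mul_deriv_steklov (hc m i) hh hτ.1
    have hRb := hsol.reynolds.abs_integral_le hM0
      (f := fun t i j x => pderiv j (fun y => steklovField hT.le v a h t y i) x)
      (fun t i j x => by
        rw [pderiv_steklovField_eq hk hv ha]
        exact abs_steklov_le (fun s => hM _ (projIcc 0 T hT.le s).2 i j n x) hh t) hτ
    rw [hconv] at hmom
    have := neg_le_of_abs_le hRb
    linarith
  have hst : ∀ t, Tendsto (fun h => ∑ i, ∑ m, steklov (c m i) h t * c m i t) (𝓝[>] 0)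
      (𝓝 (∑ i, ∑ m, c m i t * c m i t)) := fun t =>
    tendsto_finsetSum _ fun i _ => tendsto_finsetSum _ fun m _ =>
      (tendsto_steklov (hc m i) t).mul_const _
  have hsq : Tendsto (fun h => ∑ i, ∑ m, (steklov (fun t => c m i t ^ 2) h τ -
      steklov (fun t => c m i t ^ 2) h 0)) (𝓝[>] 0)
      (𝓝 (∑ i, ∑ m, (c m i τ ^ 2 - c m i 0 ^ 2))) :=
    tendsto_finsetSum _ fun i _ => tendsto_finsetSum _ fun m _ =>
      (tendsto_steklov ((hc m i).pow 2) τ).sub (tendsto_steklov ((hc m i).pow 2) 0)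
  -- As `h → 0` the boundary terms tend to `∑ c²` with weight `1` on the right and weight `1/2` on
  -- the left, which leaves the kinetic energy with its factor `1/2`.
  have hfinal := le_of_tendsto_of_tendsto
    ((((hsq.const_mul (1 / 2)).add hQ.2.1).sub hSS.2.1).sub_const
      ((d : ℝ) ^ 2 * M * ∫ t in (0)..τ, ∑ k, R t k k univ))
    ((hst τ).sub (hst 0)) (by filter_upwards [self_mem_nhdsWithin] with h hh using hineq h hh)
  rw [hquad hτ, hquad h0]
  simp only [Finset.sum_sub_distrib, pow_two] at hfinal
  simp only [pow_two]
  linarith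

/-! ### Removing the mollification -/

theorem ae_uIoc_of_ae_restrict_Ioo {T τ : ℝ} (hτ : τ ∈ Icc 0 T) {P : ℝ → Prop}
    (h : ∀ᵐ t ∂(volume.restrict (Ioo 0 T)), P t) :
    ∀ᵐ t, t ∈ uIoc (0 : ℝ) τ → t ∈ Ioo 0 T ∧ P t := by
  rw [ae_restrict_iff' measurableSet_Ioo] at h
  filter_upwards [h, Measure.ae_ne volume T] with t ht htT hmem
  rw [uIoc_of_le hτ.1] at hmem
  have hmem' : t ∈ Ioo 0 T := ⟨hmem.1, lt_of_le_of_ne (hmem.2.trans hτ.2) htT⟩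
  exact ⟨hmem', ht hmem'⟩

theorem integrable_mul_continuous {f g : Torus d → ℝ} (hf : Integrable f) (hg : Continuous g) :
    Integrable fun x => f x * g x := by
  simpa only [mul_comm] using integrable_continuous_mul hg hf

theorem tendsto_integral_mul_pderiv_mollify {T : ℝ} (hT : 0 ≤ T) {v : ℝ → Torus d → Fin d → ℝ}
    (hv : ∀ i, L2ContinuousOn (fun t x => v t x i) (Icc 0 T))
    {M : ℝ} (hM : ∀ t ∈ Icc 0 T, ∀ i j n x, |pderiv j (mollify n fun y => v t y i) x| ≤ M)
    {W : Fin d → Fin d → ℝ × Torus d → ℝ} (hW : ∀ i j, Integrable (W i j) (spaceTime d T))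
    {L : ℝ → ℝ} (hL : ∀ᵐ t ∂(volume.restrict (Ioo 0 T)),
      Tendsto (fun n => ∫ x, ∑ i, ∑ j, W i j (t, x) * pderiv j (mollify n fun y => v t y i) x)
        atTop (𝓝 (L t))) {τ : ℝ} (hτ : τ ∈ Icc 0 T) :
    Tendsto (fun n => ∫ t in (0)..τ, ∫ x, ∑ i, ∑ j, W i j (t, x) *
      pderiv j (mollify n fun y => v t y i) x) atTop (𝓝 (∫ t in (0)..τ, L t)) := by
  have hWt : ∀ᵐ t ∂(volume.restrict (Ioo 0 T)), ∀ i j, Integrable fun x => W i j (t, x) :=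
    ae_all_iff.2 fun i => ae_all_iff.2 fun j => integrable_slice_of_spaceTime (hW i j)
  -- The majorant in time is `M` times the sum of the `L¹` norms of the `W i j (t, ·)`; the factor
  -- `1` only puts it in the form of `intervalIntegrable_integral_mul`.
  refine intervalIntegral.tendsto_integral_filter_of_dominated_convergence
    (fun t => ∑ i, ∑ j, (∫ x, |W i j (t, x)| * 1) * M) (Eventually.of_forall fun n => ?_)
    (Eventually.of_forall fun n => ?_) ?_ ?_
  · obtain ⟨ι, _, a, ha, hk⟩ := hasFiniteRank_kernel (d := d) n
    exact (tendsto_integral_mul_pderiv_steklovField (hT := hT) hk hv ha hW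
      hτ).2.2.aestronglyMeasurable_restrict_uIoc
  · filter_upwards [ae_uIoc_of_ae_restrict_Ioo hτ hWt] with t ht hmem
    obtain ⟨htT, hti⟩ := ht hmem
    have htT' := Ioo_subset_Icc_self htT
    have hpc : ∀ i j, Continuous (pderiv j (mollify n fun y => v t y i)) := fun i j =>
      (torusSmooth_mollify n
        (integrable_of_memLp_two ((hv i).1 t htT'))).one.continuous_pderiv j
    have hi : ∀ i j, Integrable fun x => W i j (t, x) *
        pderiv j (mollify n fun y => v t y i) x := fun i j =>
      integrable_mul_continuous (hti i j) (hpc i j)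
    rw [integral_finsetSum _ fun i _ => integrable_finsetSum _ fun j _ => hi i j]
    refine (norm_sum_le _ _).trans (Finset.sum_le_sum fun i _ => ?_)
    rw [integral_finsetSum _ fun j _ => hi i j]
    refine (norm_sum_le _ _).trans (Finset.sum_le_sum fun j _ => ?_)
    refine (norm_integral_le_integral_norm _).trans ?_
    rw [← integral_mul_const]
    simp only [mul_one]
    refine integral_mono (hi i j).norm ((hti i j).abs.mul_const M) fun x => ?_
    simp only [norm_mul, Real.norm_eq_abs]
    exact mul_le_mul_of_nonneg_left (hM t htT' i j n x) (abs_nonneg _)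
  · exact intervalIntegrable_sum fun i => intervalIntegrable_sum fun j =>
      (intervalIntegrable_integral_mul (hW i j).abs continuous_const hτ).mul_const M
  · filter_upwards [ae_uIoc_of_ae_restrict_Ioo hτ hL] with t ht hmem using (ht hmem).2

/-- Here `A` is merely integrable, so `L²` convergence of the gradients would not suffice. The
symmetric mollifier is moved onto `A`, whose mollifications converge in `L¹`, and `G` is bounded by
`M` as a limit of mollifications with that bound. -/
theorem tendsto_integral_stress_mul_pderiv_mollify {u : Torus d → Fin d → ℝ}
    {A G : Torus d → Matrix (Fin d) (Fin d) ℝ} (hA : ∀ i j, Integrable fun x => A x i j)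
    (hG : ∀ i j, HasWeakDeriv j (fun x => u x i) fun x => G x i j)
    {M : ℝ} (hM : ∀ i j n x, |pderiv j (mollify n fun y => u y i) x| ≤ M) :
    Tendsto (fun n => ∫ x, ∑ i, ∑ j, A x i j * pderiv j (mollify n fun y => u y i) x) atTop
      (𝓝 (∫ x, ∑ i, ∑ j, A x i j * G x i j)) := by
  have hGM : ∀ i j, ∀ᵐ x, |G x i j| ≤ M := fun i j =>
    ae_abs_le_of_abs_mollify_le (hG i j).2.1 fun n x => by
      rw [← (hG i j).pderiv_mollify]; exact hM i j n x
  have hmul : ∀ i j {f : Torus d → ℝ}, Integrable f → Integrable fun x => f x * G x i j :=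
    fun i j f hf => hf.mul_bdd (c := M) (hG i j).2.1.1 (hGM i j)
  have hmA : ∀ n i j, Integrable (mollify n fun y => A y i j) := fun n i j =>
    integrable_of_continuous (continuous_mollify n (hA i j))
  simp only [fun n i j x => (hG i j).pderiv_mollify n x]
  have hi : ∀ n i j, Integrable fun x => A x i j * mollify n (fun y => G y i j) x := fun n i j =>
    integrable_mul_continuous (hA i j) (continuous_mollify n (hG i j).2.1)
  have h1 : ∀ n, ∫ x, ∑ i, ∑ j, A x i j * mollify n (fun y => G y i j) x =
      ∑ i, ∑ j, ∫ x, mollify n (fun y => A y i j) x * G x i j := by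
    intro n
    rw [integral_finsetSum _ fun i _ => integrable_finsetSum _ fun j _ => hi n i j]
    refine Finset.sum_congr rfl fun i _ => ?_
    rw [integral_finsetSum _ fun j _ => hi n i j]
    exact Finset.sum_congr rfl fun j _ => (integral_mollify_mul n (hA i j) (hG i j).2.1).symm
  rw [integral_finsetSum _ fun i _ => integrable_finsetSum _ fun j _ => hmul i j (hA i j)]
  simp only [h1, fun i => integral_finsetSum Finset.univ fun j _ => hmul i j (hA i j)]
  refine tendsto_finsetSum _ fun i _ => tendsto_finsetSum _ fun j _ => ?_
  have h2 := tendsto_integral_mul_of_bounded (tendsto_integral_abs_mollify_sub (hA i j))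
    (fun n => (hmA n i j).sub (hA i j)) (b := fun _ x => G x i j) (fun _ => hGM i j)
  rw [← tendsto_sub_nhds_zero_iff]
  refine h2.congr fun n => ?_
  rw [← integral_sub (hmul i j (hmA n i j)) (hmul i j (hA i j))]
  simp only [sub_mul]

/-- The convective term does not contribute to the energy balance. -/
theorem tendsto_integral_convection {u : Torus d → Fin d → ℝ}
    (hu : ∀ i, MemLp (fun x => u x i) 2 volume)
    (hdiv : ∀ ψ : Torus d → ℝ, TorusContDiff 1 ψ → ∫ x, ∑ i, u x i * pderiv i ψ x = 0)
    {M : ℝ} (hM : ∀ i j n x, |pderiv j (mollify n fun y => u y i) x| ≤ M) :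
    Tendsto (fun n => ∫ x, ∑ i, ∑ j, u x i * u x j * pderiv j (mollify n fun y => u y i) x) atTop
      (𝓝 0) := by
  have hui : ∀ i, Integrable fun x => u x i := fun i => integrable_of_memLp_two (hu i)
  have hsm : ∀ n i, TorusSmooth (mollify n fun y => u y i) := fun n i =>
    torusSmooth_mollify n (hui i)
  have hpc : ∀ n i j, Continuous (pderiv j (mollify n fun y => u y i)) := fun n i j =>
    (hsm n i).one.continuous_pderiv j
  have hdi : ∀ n i j, Integrable fun x => u x j * (mollify n (fun y => u y i) x - u x i) :=
    fun n i j => (hu j).integrable_mul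
      ((memLp_two_of_continuous (hsm n i).one.continuous).sub (hu i))
  have hlim : Tendsto (fun n => ∑ i, ∑ j, ∫ x, u x j * (mollify n (fun y => u y i) x - u x i) *
      pderiv j (mollify n fun y => u y i) x) atTop (𝓝 (∑ i : Fin d, ∑ j : Fin d, 0)) :=
    tendsto_finsetSum _ fun i _ => tendsto_finsetSum _ fun j _ =>
      tendsto_integral_mul_of_bounded (tendsto_integral_abs_mul_mollify_sub (hu i) (hu j))
        (fun n => hdi n i j) fun n => Eventually.of_forall (hM i j n)
  simp only [Finset.sum_const_zero] at hlim
  rw [← neg_zero]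
  refine hlim.neg.congr fun n => ?_
  have hi1 : ∀ i j, Integrable fun x => u x j * (mollify n (fun y => u y i) x - u x i) *
      pderiv j (mollify n fun y => u y i) x := fun i j =>
    integrable_mul_continuous (hdi n i j) (hpc n i j)
  have hi2 : ∀ i j, Integrable fun x => u x i * u x j * pderiv j (mollify n fun y => u y i) x :=
    fun i j => integrable_mul_continuous ((hu i).integrable_mul (hu j)) (hpc n i j)
  -- Write `u_i = u_i^n - (u_i^n - u_i)`. The first part yields `u · ∇(½ |u^n|²)`, which integrates
  -- to zero since `|u^n|²` is a smooth test function for the divergence. The rest is a product of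
  -- `u_j (u_i^n - u_i)`, which tends to `0` in `L¹`, with a bounded gradient.
  have hz := hdiv (fun x => ∑ i, mollify n (fun y => u y i) x * mollify n (fun y => u y i) x)
    (TorusContDiff.sum fun i _ => (hsm n i).one.mul (hsm n i).one)
  have hpd : ∀ j x, pderiv j
      (fun x => ∑ i, mollify n (fun y => u y i) x * mollify n (fun y => u y i) x) x =
      ∑ i, 2 * (mollify n (fun y => u y i) x * pderiv j (mollify n fun y => u y i) x) := by
    intro j x
    rw [pderiv_sum fun i _ => (hsm n i).one.mul (hsm n i).one]
    refine Finset.sum_congr rfl fun i _ => ?_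
    rw [pderiv_mul (hsm n i).one (hsm n i).one]
    ring
  simp only [hpd] at hz
  have hs1 : ∑ i, ∑ j, ∫ x, u x j * (mollify n (fun y => u y i) x - u x i) *
      pderiv j (mollify n fun y => u y i) x = ∫ x, ∑ i, ∑ j,
        u x j * (mollify n (fun y => u y i) x - u x i) *
          pderiv j (mollify n fun y => u y i) x := by
    rw [integral_finsetSum _ fun i _ => integrable_finsetSum _ fun j _ => hi1 i j]
    exact Finset.sum_congr rfl fun i _ => (integral_finsetSum _ fun j _ => hi1 i j).symm
  have hi3 : Integrable fun x => ∑ j, u x j *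
      ∑ i, 2 * (mollify n (fun y => u y i) x * pderiv j (mollify n fun y => u y i) x) :=
    integrable_finsetSum _ fun j _ => integrable_mul_continuous (hui j) <|
      continuous_finsetSum _ fun i _ =>
        continuous_const.mul ((hsm n i).one.continuous.mul (hpc n i j))
  have hi4 : Integrable fun x => ∑ i, ∑ j, u x j * (mollify n (fun y => u y i) x - u x i) *
      pderiv j (mollify n fun y => u y i) x :=
    integrable_finsetSum _ fun i _ => integrable_finsetSum _ fun j _ => hi1 i j
  have hs2 : ∫ x, ∑ i, ∑ j, u x i * u x j * pderiv j (mollify n fun y => u y i) x =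
      1 / 2 * (∫ x, ∑ j, u x j *
        ∑ i, 2 * (mollify n (fun y => u y i) x * pderiv j (mollify n fun y => u y i) x)) -
      ∫ x, ∑ i, ∑ j, u x j * (mollify n (fun y => u y i) x - u x i) *
        pderiv j (mollify n fun y => u y i) x := by
    rw [← integral_const_mul, ← integral_sub (hi3.const_mul _) hi4]
    congr 1; funext x
    simp only [Finset.mul_sum]
    rw [Finset.sum_comm (f := fun j i => 1 / 2 * (u x j * _))]
    simp only [← Finset.sum_sub_distrib]
    refine Finset.sum_congr rfl fun i _ => Finset.sum_congr rfl fun j _ => ?_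
    ring
  rw [hs1, hs2, hz]
  ring

/-- The energy inequality opposite to that of dissipative solutions, with the Reynolds stress as
an error term. -/
theorem IsDissipativeSolution.energy_ge {F : Matrix (Fin d) (Fin d) ℝ → ℝ} {T : ℝ}
    (hT : 0 < T) {v₀ : Torus d → Fin d → ℝ} {v : ℝ → Torus d → Fin d → ℝ}
    {S : ℝ → Torus d → Matrix (Fin d) (Fin d) ℝ}
    {R : ℝ → Matrix (Fin d) (Fin d) (SignedMeasure (Torus d))}
    (hsol : IsDissipativeSolution F T v₀ v S R)
    (hv : ∀ i, L2ContinuousOn (fun t x => v t x i) (Icc 0 T))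
    (hdiv : ∀ t ∈ Icc 0 T, ∀ ψ : Torus d → ℝ, TorusContDiff 1 ψ →
      ∫ x, ∑ i, v t x i * pderiv i ψ x = 0)
    (hv0 : ∀ i, (fun x => v 0 x i) =ᵐ[volume] fun x => v₀ x i)
    (hvv : ∀ i j, Integrable (fun z : ℝ × Torus d => v z.1 z.2 i * v z.1 z.2 j) (spaceTime d T))
    {M : ℝ} (hM0 : 0 ≤ M) (hM : ∀ t ∈ Icc 0 T, ∀ i j n x,
      |pderiv j (mollify n fun y => v t y i) x| ≤ M)
    {G : ℝ → Torus d → Matrix (Fin d) (Fin d) ℝ} (hG : IsWeakGradient T v G)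
    {τ : ℝ} (hτ : τ ∈ Icc 0 T) :
    (∫ x, 1 / 2 * ∑ i, v₀ x i ^ 2) - (∫ x, 1 / 2 * ∑ i, v τ x i ^ 2) ≤
      (∫ t in (0)..τ, ∫ x, ∑ i, ∑ j, S t x i j * G t x i j) +
        (d : ℝ) ^ 2 * M * ∫ t in (0)..τ, ∑ k, R t k k univ := by
  have h0 : (0 : ℝ) ∈ Icc 0 T := left_mem_Icc.2 hT.le
  have hvi : ∀ t ∈ Icc 0 T, ∀ i, Integrable fun x => v t x i := fun t ht i =>
    integrable_of_memLp_two ((hv i).1 t ht)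
  have hwdiv : ∀ t ∈ Icc 0 T, WeaklyDivFree (v t) := fun t ht =>
    ⟨hvi t ht, fun φ hφ => hdiv t ht φ hφ.one⟩
  have hquad : ∀ t ∈ Icc 0 T,
      Tendsto (fun n => ∫ x, ∑ i, v t x i * mollify n (fun y => v t y i) x) atTop
        (𝓝 (∫ x, ∑ i, v t x i ^ 2)) := by
    intro t ht
    have h1 : ∀ n, ∫ x, ∑ i, v t x i * mollify n (fun y => v t y i) x =
        ∑ i, ∫ x, v t x i * mollify n (fun y => v t y i) x := fun n =>
      integral_finsetSum _ fun i _ =>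
        integrable_mul_continuous (hvi t ht i) (continuous_mollify n (hvi t ht i))
    have h2 : ∫ x, ∑ i, v t x i ^ 2 = ∑ i, ∫ x, v t x i * v t x i := by
      simp only [pow_two]
      exact integral_finsetSum _ fun i _ => ((hv i).1 t ht).integrable_mul ((hv i).1 t ht)
    simp only [h1, h2]
    exact tendsto_finsetSum _ fun i _ => tendsto_integral_mollify_mul ((hv i).1 t ht) ((hv i).1 t ht)
  have hconv := tendsto_integral_mul_pderiv_mollify hT.le hv hM hvv (L := fun _ => 0)
    ((ae_restrict_iff' measurableSet_Ioo).2 (Eventually.of_forall fun t ht =>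
      tendsto_integral_convection (fun i => (hv i).1 t (Ioo_subset_Icc_self ht))
        (hdiv t (Ioo_subset_Icc_self ht)) (hM t (Ioo_subset_Icc_self ht)))) hτ
  have hstress := tendsto_integral_mul_pderiv_mollify hT.le hv hM
    (W := fun i j z => S z.1 z.2 i j) hsol.stress_integrable
    (L := fun t => ∫ x, ∑ i, ∑ j, S t x i j * G t x i j) (by
      have hSt : ∀ᵐ t ∂(volume.restrict (Ioo 0 T)), ∀ i j, Integrable fun x => S t x i j :=
        ae_all_iff.2 fun i => ae_all_iff.2 fun j =>
          integrable_slice_of_spaceTime (hsol.stress_integrable i j)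
      filter_upwards [hSt, hG, ae_restrict_mem measurableSet_Ioo] with t hSt hGt ht
      exact tendsto_integral_stress_mul_pderiv_mollify hSt hGt
        (hM t (Ioo_subset_Icc_self ht))) hτ
  have hlim := le_of_tendsto_of_tendsto'
    ((hconv.sub hstress).sub_const ((d : ℝ) ^ 2 * M * ∫ t in (0)..τ, ∑ k, R t k k univ))
    (((hquad τ hτ).sub (hquad 0 h0)).const_mul (1 / 2))
    fun n => hsol.mollified_energy_ge hT hv hwdiv hv0 hvv hM0 hM n hτ
  have hinit : ∫ x, ∑ i, v 0 x i ^ 2 = ∫ x, ∑ i, v₀ x i ^ 2 := by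
    refine integral_congr_ae ?_
    filter_upwards [ae_all_iff.2 hv0] with x hx
    simp only [hx]
  rw [hinit] at hlim
  simp only [intervalIntegral.integral_zero] at hlim
  simp only [integral_const_mul]
  linarith

/-! ### Vanishing of the Reynolds stress and the constitutive relation -/

theorem spaceTime_mono {τ T : ℝ} (h : τ ≤ T) : spaceTime d τ ≤ spaceTime d T := by
  rw [spaceTime_eq_restrict, spaceTime_eq_restrict]
  exact Measure.restrict_mono (prod_mono (Ioo_subset_Ioo_right h) subset_rfl) le_rfl

/-- Null slices give a null set by Tonelli, which is why joint measurability of `f` is assumed. -/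
theorem ae_spaceTime_eq_zero {T : ℝ} {f : ℝ × Torus d → ℝ}
    (hf : AEStronglyMeasurable f (spaceTime d T))
    (h : ∀ᵐ t ∂(volume.restrict (Ioo 0 T)), ∀ᵐ x, f (t, x) = 0) :
    ∀ᵐ z ∂(spaceTime d T), f z = 0 := by
  have h1 : ∫⁻ z, ‖f z‖ₑ ∂(spaceTime d T) = 0 := by
    rw [spaceTime, lintegral_prod _ hf.enorm]
    refine (lintegral_congr_ae (g := fun _ => 0) ?_).trans lintegral_zero
    filter_upwards [h] with t ht
    refine (lintegral_congr_ae (g := fun _ => 0) ?_).trans lintegral_zero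
    filter_upwards [ht] with x hx
    simp [hx]
  filter_upwards [(lintegral_eq_zero_iff' hf.enorm).1 h1] with z hz
  simpa using hz

theorem ae_spaceTime_abs_le {T : ℝ} {f : ℝ × Torus d → ℝ} {M : ℝ}
    (hf : AEStronglyMeasurable f (spaceTime d T))
    (h : ∀ᵐ t ∂(volume.restrict (Ioo 0 T)), ∀ᵐ x, |f (t, x)| ≤ M) :
    ∀ᵐ z ∂(spaceTime d T), |f z| ≤ M := by
  have h1 := ae_spaceTime_eq_zero (f := fun z => max (|f z| - M) 0)
    (((hf.norm.sub aestronglyMeasurable_const).sup aestronglyMeasurable_const)) (by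
      filter_upwards [h] with t ht
      filter_upwards [ht] with x hx
      exact max_eq_right (by linarith))
  filter_upwards [h1] with z hz
  have := le_max_left (|f z| - M) 0
  linarith

/-- Almost every `τ` is admissible, so one exists in each interval `(T - T/(k+1), T)`; the
corresponding strips exhaust `(0,T)`. -/
theorem ae_spaceTime_of_ae {T : ℝ} (hT : 0 < T) {Q : ℝ × Torus d → Prop}
    (h : ∀ᵐ τ ∂(volume.restrict (Ioo 0 T)), ∀ᵐ z ∂(spaceTime d τ), Q z) :
    ∀ᵐ z ∂(spaceTime d T), Q z := by
  rw [ae_restrict_iff' measurableSet_Ioo] at h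
  have hex : ∀ k : ℕ, ∃ τ ∈ Ioo (T - T / (k + 1)) T, ∀ᵐ z ∂(spaceTime d τ), Q z := by
    intro k
    have hpos : 0 < T / ((k : ℝ) + 1) := by positivity
    have hle : T / ((k : ℝ) + 1) ≤ T :=
      div_le_self hT.le (by linarith [(Nat.cast_nonneg k : (0 : ℝ) ≤ k)])
    by_contra hno
    have h2 : ∀ᵐ τ, τ ∉ Ioo (T - T / ((k : ℝ) + 1)) T := by
      filter_upwards [h] with τ hτ hmem
      exact hno ⟨τ, hmem, hτ ⟨by linarith [hmem.1], hmem.2⟩⟩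
    have h3 : volume (Ioo (T - T / ((k : ℝ) + 1)) T) = 0 := measure_eq_zero_iff_ae_notMem.2 h2
    rw [Real.volume_Ioo, ENNReal.ofReal_eq_zero] at h3
    linarith
  choose τ hτ hQ using hex
  have hunion : (Ioo 0 T ×ˢ univ : Set (ℝ × Torus d)) ⊆ ⋃ k, Ioo 0 (τ k) ×ˢ univ := by
    rintro ⟨t, x⟩ ⟨ht, -⟩
    have hlim : Tendsto (fun k : ℕ => T / ((k : ℝ) + 1)) atTop (𝓝 0) :=
      tendsto_const_nhds.div_atTop (tendsto_atTop_add_const_right _ _ tendsto_natCast_atTop_atTop)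
    obtain ⟨k, hk⟩ := (hlim.eventually_lt_const (sub_pos.2 ht.2)).exists
    exact mem_iUnion.2 ⟨k, ⟨ht.1, by have := (hτ k).1; simp only at hk ⊢; linarith⟩, mem_univ x⟩
  rw [spaceTime_eq_restrict]
  refine ae_restrict_of_ae_restrict_of_subset hunion ?_
  rw [ae_restrict_iUnion_iff]
  intro k
  rw [← spaceTime_eq_restrict]
  exact hQ k

theorem IsWeakGradient.ae_abs_le {T : ℝ} {v : ℝ → Torus d → Fin d → ℝ}
    {G : ℝ → Torus d → Matrix (Fin d) (Fin d) ℝ} (hG : IsWeakGradient T v G)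
    (hGm : ∀ i j, AEStronglyMeasurable (fun z : ℝ × Torus d => G z.1 z.2 i j) (spaceTime d T))
    {M : ℝ} (hM : ∀ t ∈ Icc 0 T, ∀ i j n x, |pderiv j (mollify n fun y => v t y i) x| ≤ M)
    (i j : Fin d) : ∀ᵐ z ∂(spaceTime d T), |G z.1 z.2 i j| ≤ M := by
  refine ae_spaceTime_abs_le (hGm i j) ?_
  filter_upwards [hG, ae_restrict_mem measurableSet_Ioo] with t ht hmem
  refine ae_abs_le_of_abs_mollify_le (ht i j).2.1 fun n x => ?_
  rw [← (ht i j).pderiv_mollify]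
  exact hM t (Ioo_subset_Icc_self hmem) i j n x

/-- The assumed energy inequality and its converse from `energy_ge` are compared; Fenchel-Young
closes the estimate of the Reynolds trace by its own time integral. -/
theorem IsDissipativeSolution.reynolds_eq_zero_and_constitutive
    {F : Matrix (Fin d) (Fin d) ℝ → ℝ} (hF : IsPotential F) {T : ℝ}
    (hT : 0 < T) {v₀ : Torus d → Fin d → ℝ} {v : ℝ → Torus d → Fin d → ℝ}
    {S : ℝ → Torus d → Matrix (Fin d) (Fin d) ℝ}
    {R : ℝ → Matrix (Fin d) (Fin d) (SignedMeasure (Torus d))}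
    (hsol : IsDissipativeSolution F T v₀ v S R)
    (hv : ∀ i, L2ContinuousOn (fun t x => v t x i) (Icc 0 T))
    (hdiv : ∀ t ∈ Icc 0 T, ∀ ψ : Torus d → ℝ, TorusContDiff 1 ψ →
      ∫ x, ∑ i, v t x i * pderiv i ψ x = 0)
    (hv0 : ∀ i, (fun x => v 0 x i) =ᵐ[volume] fun x => v₀ x i)
    (hvv : ∀ i j, Integrable (fun z : ℝ × Torus d => v z.1 z.2 i * v z.1 z.2 j) (spaceTime d T))
    {M : ℝ} (hM0 : 0 ≤ M) (hM : ∀ t ∈ Icc 0 T, ∀ i j n x,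
      |pderiv j (mollify n fun y => v t y i) x| ≤ M)
    {G : ℝ → Torus d → Matrix (Fin d) (Fin d) ℝ}
    (hGi : ∀ i j, Integrable (fun z : ℝ × Torus d => G z.1 z.2 i j) (spaceTime d T))
    (hG : IsWeakGradient T v G) :
    (∀ᵐ t ∂(volume.restrict (Ioo 0 T)), ∀ i j, R t i j = 0) ∧
    ∀ᵐ z ∂(spaceTime d T), ((frob (S z.1 z.2) (symPart (G z.1 z.2)) : ℝ) : EReal) =
      (F (symPart (G z.1 z.2)) : EReal) + conjugate F (S z.1 z.2) := by
  obtain ⟨μ, hμ, henergy⟩ := hsol.energy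
  set r : ℝ → ℝ := fun t => ∑ k, R t k k univ with hr
  have hr0 : ∀ᵐ t ∂(volume.restrict (Ioo 0 T)), 0 ≤ r t := by
    filter_upwards [hsol.reynolds.posSemidef] with t ht using sum_diag_nonneg_of_posSemidef ht
  have hSGi : Integrable (fun z : ℝ × Torus d => ∑ i, ∑ j, S z.1 z.2 i j * G z.1 z.2 i j)
      (spaceTime d T) :=
    integrable_finsetSum _ fun i _ => integrable_finsetSum _ fun j _ =>
      (hsol.stress_integrable i j).mul_bdd (c := M) (hGi i j).1
        (hG.ae_abs_le (fun i j => (hGi i j).1) hM i j)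
  have hac := hμ.acDensity_ae_eq hT hGi hG
  -- The second clause is conditional because the trace is known to vanish only after Gronwall,
  -- which needs the first clause for almost every `τ`. Both come from the same comparison of
  -- energies.
  have key : ∀ᵐ τ ∂(volume.restrict (Ioo 0 T)), r τ ≤ 2 * ((d : ℝ) ^ 2 * M) * (∫ t in (0)..τ, r t) ∧
      ((∫ t in (0)..τ, r t) = 0 → ∀ᵐ z ∂(spaceTime d τ),
        ((frob (S z.1 z.2) (symPart (G z.1 z.2)) : ℝ) : EReal) =
          (F (symPart (G z.1 z.2)) : EReal) + conjugate F (S z.1 z.2)) := by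
    filter_upwards [henergy, hr0, ae_restrict_mem measurableSet_Ioo] with τ hτe hrτ hτ
    have hle : spaceTime d τ ≤ spaceTime d T := spaceTime_mono hτ.2.le
    have hae := ae_mono hle
    set L : ℝ≥0∞ := ∫⁻ z, ENNReal.ofReal (F (symPart (G z.1 z.2))) ∂(spaceTime d τ) +
      ∫⁻ z, (conjugate F (S z.1 z.2)).toENNReal ∂(spaceTime d τ) with hL
    -- Only a lower bound for the dissipation is needed, so the nonnegative singular part of `F(μ)`
    -- is discarded.
    have hLle : L ≤ convexMass F μ (Ioo 0 τ ×ˢ univ)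
          + ∫⁻ z in Ioo 0 τ ×ˢ univ, (conjugate F (S z.1 z.2)).toENNReal := by
      rw [hL, ← spaceTime_eq_restrict]
      refine add_le_add ?_ le_rfl
      rw [convexMass, ← spaceTime_eq_restrict]
      refine le_add_right (le_of_eq (lintegral_congr_ae ?_))
      filter_upwards [hae hac] with z hz
      rw [hz]
    have hen := (add_le_add_right hLle _).trans hτe
    have hEτ : 0 ≤ ∫ x, 1 / 2 * ∑ i, v τ x i ^ 2 :=
      integral_nonneg fun x => by positivity
    have hE0 : 0 ≤ ∫ x, 1 / 2 * ∑ i, v₀ x i ^ 2 :=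
      integral_nonneg fun x => by positivity
    have hLfin : L ≠ ⊤ := by
      refine ne_top_of_le_ne_top ENNReal.ofReal_ne_top ((le_add_left le_rfl).trans hen)
    have hreal : (∫ x, 1 / 2 * ∑ i, v τ x i ^ 2) + 1 / 2 * r τ + L.toReal ≤
        ∫ x, 1 / 2 * ∑ i, v₀ x i ^ 2 := by
      have h1 := ENNReal.toReal_mono ENNReal.ofReal_ne_top hen
      rwa [ENNReal.toReal_add (by finiteness) hLfin, ENNReal.toReal_add (by finiteness)
        (by finiteness), ENNReal.toReal_ofReal hEτ, ENNReal.toReal_ofReal (by positivity),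
        ENNReal.toReal_ofReal hE0] at h1
    have hge := hsol.energy_ge hT hv hdiv hv0 hvv hM0 hM hG (Ioo_subset_Icc_self hτ)
    rw [← integral_spaceTime (f := fun z : ℝ × Torus d =>
      ∑ i, ∑ j, S z.1 z.2 i j * G z.1 z.2 i j) hτ.1.le (hSGi.mono_measure hle)] at hge
    have hFY := hF.integral_frob_le (P := spaceTime d τ)
      (S := fun z => S z.1 z.2) (G := fun z => G z.1 z.2)
      (fun i j => ((hsol.stress_integrable i j).mono_measure hle).1.aemeasurable)
      (fun i j => ((hGi i j).mono_measure hle).1.aemeasurable) (hae hsol.stress_symm)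
      (hSGi.mono_measure hle) hLfin
    -- The two energy inequalities give `½ r(τ) + L ≤ ∫∫ S : G + d² M ∫ r`. With `∫∫ S : G ≤ L` this
    -- is the first clause, the factor `2` coming from the `½`. If `∫ r = 0` it gives `L ≤ ∫∫ S :
    -- G`, the case of equality in Fenchel-Young.
    refine ⟨by linarith [hFY.1], fun h0 => hFY.2 ?_⟩
    rw [h0, mul_zero] at hge
    linarith
  have hrzero := eq_zero_of_le_integral hT.le (K := 2 * ((d : ℝ) ^ 2 * M)) (by positivity)
    ((intervalIntegrable_iff_integrableOn_Ioo_of_le hT.le).2 hsol.reynolds.integrable_sum_diag)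
    hr0 (by filter_upwards [key] with τ hτ using hτ.1)
  refine ⟨?_, ae_spaceTime_of_ae hT ?_⟩
  · filter_upwards [hrzero, hsol.reynolds.posSemidef] with t ht hpos
    exact eq_zero_of_posSemidef hpos ht
  · filter_upwards [key, ae_restrict_mem measurableSet_Ioo] with τ hτ hmem
    refine hτ.2 ?_
    refine (intervalIntegral.integral_congr_ae (g := fun _ => 0) ?_).trans
      intervalIntegral.integral_zero
    filter_upwards [ae_uIoc_of_ae_restrict_Ioo (Ioo_subset_Icc_self hmem) hrzero] with t ht hm
      using (ht hm).2

/-! ### Integration by parts in time -/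

theorem l2ContinuousOn_const {a : Torus d → ℝ} (ha : Continuous a) (I : Set ℝ) :
    L2ContinuousOn (fun _ : ℝ => a) I :=
  ⟨fun _ _ => memLp_two_of_continuous ha, fun _ _ => by simpa using tendsto_const_nhds⟩

theorem continuous_integral_mul {g : ℝ → Torus d → ℝ}
    (hg : Continuous fun z : ℝ × Torus d => g z.1 z.2) {a : Torus d → ℝ} (ha : Continuous a) :
    Continuous fun t => ∫ x, g t x * a x := by
  have h := (l2ContinuousOn_const ha univ).continuousOn_integral_mul_continuous hg
  simpa only [mul_comm] using continuousOn_univ.1 h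

theorem hasDerivAt_integral_mul {φ : ℝ → Torus d → ℝ} (hφ : SpaceTimeContDiff 1 φ)
    {a : Torus d → ℝ} (ha : Continuous a) (t : ℝ) :
    HasDerivAt (fun t => ∫ x, φ t x * a x) (∫ x, deriv (fun s => φ s x) t * a x) t := by
  have hs : ∀ t, Continuous (φ t) := fun t => (hφ.slice t).continuous
  have hd : ∀ t, Continuous fun x => deriv (fun s => φ s x) t := fun t =>
    hφ.continuous_deriv_time.comp (continuous_const.prodMk continuous_id)
  obtain ⟨C, hC⟩ := ((isCompact_closedBall t 1).prod
    (isCompact_univ (X := Torus d))).exists_bound_of_continuousOn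
    (hφ.continuous_deriv_time.mul (ha.comp continuous_snd)).continuousOn
  refine (hasDerivAt_integral_of_dominated_loc_of_deriv_le (Metric.ball_mem_nhds t one_pos)
    (Eventually.of_forall fun s => ((hs s).mul ha).aestronglyMeasurable)
    (integrable_of_continuous ((hs t).mul ha)) ((hd t).mul ha).aestronglyMeasurable
    (bound := fun _ => C) (Eventually.of_forall fun x s hs => ?_) (integrable_const _)
    (Eventually.of_forall fun x s _ => (hφ.hasDerivAt_time s x).mul_const _)).2
  exact hC (s, x) ⟨Metric.ball_subset_closedBall hs, mem_univ x⟩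

theorem contDiff_integral_mul {φ : ℝ → Torus d → ℝ} (hφ : SpaceTimeContDiff 1 φ)
    {a : Torus d → ℝ} (ha : Continuous a) : ContDiff ℝ 1 fun t => ∫ x, φ t x * a x := by
  rw [contDiff_one_iff_deriv]
  refine ⟨fun t => (hasDerivAt_integral_mul hφ ha t).differentiableAt, ?_⟩
  rw [show deriv (fun t => ∫ x, φ t x * a x) = fun t => ∫ x, deriv (fun s => φ s x) t * a x from
    funext fun t => (hasDerivAt_integral_mul hφ ha t).deriv]
  exact continuous_integral_mul hφ.continuous_deriv_time ha

theorem integral_mul_mollify_eq_sum {n : ℕ} {ι : Type} [Fintype ι] {a : ι → Torus d → ℝ}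
    (ha : ∀ m, TorusSmooth (a m)) (hk : ∀ x y, kernel n (x - y) = ∑ m, a m x * a m y)
    {u g : Torus d → ℝ} (hu : Integrable u) (hg : Integrable g) :
    ∫ x, u x * mollify n g x = ∑ m, (∫ x, u x * a m x) * ∫ x, g x * a m x := by
  simp only [mollify_eq_sum ha hk hg, Finset.mul_sum]
  rw [integral_finsetSum]
  · refine Finset.sum_congr rfl fun m _ => ?_
    rw [← integral_mul_const]
    congr 1; funext x; ring
  · exact fun m _ => integrable_mul_continuous hu (continuous_const.mul (ha m).one.continuous)

theorem intervalIntegrable_integral_mul_mollify {T : ℝ} {u : ℝ × Torus d → ℝ}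
    (hu : Integrable u (spaceTime d T)) {g : ℝ → Torus d → ℝ}
    (hg : Continuous fun z : ℝ × Torus d => g z.1 z.2) {n : ℕ} {ι : Type} [Fintype ι]
    {a : ι → Torus d → ℝ} (ha : ∀ m, TorusSmooth (a m))
    (hk : ∀ x y, kernel n (x - y) = ∑ m, a m x * a m y) {τ : ℝ} (hτ : τ ∈ Icc 0 T) :
    (∀ m, IntervalIntegrable (fun t => (∫ x, u (t, x) * a m x) * ∫ x, g t x * a m x)
      volume 0 τ) ∧
    ∀ᵐ t, t ∈ uIoc (0 : ℝ) τ → ∫ x, u (t, x) * mollify n (g t) x =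
      ∑ m, (∫ x, u (t, x) * a m x) * ∫ x, g t x * a m x := by
  refine ⟨fun m => (intervalIntegrable_integral_mul hu (ha m).one.continuous hτ).mul_continuousOn
    (continuous_integral_mul hg (ha m).one.continuous).continuousOn, ?_⟩
  filter_upwards [ae_uIoc_of_ae_restrict_Ioo hτ (integrable_slice_of_spaceTime hu)] with t ht hmem
  exact integral_mul_mollify_eq_sum ha hk (ht hmem).2
    (integrable_of_continuous (hg.comp (continuous_const.prodMk continuous_id)))

/-- For fixed time the mollifier is moved from `g` to the integrable `u`, which converges in `L¹`
while `g` is bounded; dominated convergence then handles the time integral. -/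
theorem tendsto_integral_mul_mollify {T : ℝ} {u : ℝ × Torus d → ℝ}
    (hu : Integrable u (spaceTime d T)) {g : ℝ → Torus d → ℝ}
    (hg : Continuous fun z : ℝ × Torus d => g z.1 z.2) {τ : ℝ} (hτ : τ ∈ Icc 0 T) :
    Tendsto (fun n => ∫ t in (0)..τ, ∫ x, u (t, x) * mollify n (g t) x) atTop
      (𝓝 (∫ t in (0)..τ, ∫ x, u (t, x) * g t x)) := by
  have hgt : ∀ t, Continuous (g t) := fun t => hg.comp (continuous_const.prodMk continuous_id)
  obtain ⟨C, hC⟩ := ((isCompact_Icc (a := 0) (b := T)).prod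
    (isCompact_univ (X := Torus d))).exists_bound_of_continuousOn hg.continuousOn
  have hae := ae_uIoc_of_ae_restrict_Ioo hτ (integrable_slice_of_spaceTime hu)
  refine intervalIntegral.tendsto_integral_filter_of_dominated_convergence
    (fun t => (∫ x, |u (t, x)| * 1) * C) (Eventually.of_forall fun n => ?_)
    (Eventually.of_forall fun n => ?_)
    ((intervalIntegrable_integral_mul hu.abs continuous_const hτ).mul_const C) ?_
  · obtain ⟨ι, _, a, ha, hk⟩ := hasFiniteRank_kernel (d := d) n
    obtain ⟨h1, h2⟩ := intervalIntegrable_integral_mul_mollify hu hg ha hk hτ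
    refine ((intervalIntegrable_sum h1).congr_ae ?_).aestronglyMeasurable_restrict_uIoc
    rw [EventuallyEq, ae_restrict_iff' measurableSet_uIoc]
    filter_upwards [h2] with t ht hmem using (ht hmem).symm
  · filter_upwards [hae] with t ht hmem
    obtain ⟨htT, hut⟩ := ht hmem
    refine (norm_integral_le_integral_norm _).trans ?_
    rw [← integral_mul_const]
    simp only [mul_one]
    refine integral_mono (integrable_mul_continuous hut
      (continuous_mollify n (integrable_of_continuous (hgt t)))).norm (hut.abs.mul_const C)
      fun x => ?_
    simp only [norm_mul, Real.norm_eq_abs]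
    exact mul_le_mul_of_nonneg_left (abs_mollify_le n
      (Eventually.of_forall fun y => hC (t, y) ⟨Ioo_subset_Icc_self htT, mem_univ y⟩) x)
      (abs_nonneg _)
  · filter_upwards [hae] with t ht hmem
    obtain ⟨htT, hut⟩ := ht hmem
    have hm : ∀ n, Integrable (mollify n fun x => u (t, x)) := fun n =>
      integrable_of_continuous (continuous_mollify n hut)
    obtain ⟨C', -, hC'⟩ := exists_bound_of_continuous (hgt t)
    have h2 := tendsto_integral_mul_of_bounded (tendsto_integral_abs_mollify_sub hut)
      (fun n => (hm n).sub hut) (b := fun _ => g t) (fun _ => Eventually.of_forall hC')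
    rw [← tendsto_sub_nhds_zero_iff]
    refine h2.congr fun n => ?_
    rw [← integral_mollify_mul n hut (integrable_of_continuous (hgt t)),
      ← integral_sub (integrable_mul_continuous (hm n) (hgt t))
        (integrable_mul_continuous hut (hgt t))]
    simp only [sub_mul]

/-- The weak time derivative admits only smooth test functions supported inside `(0,T)`, while `φ`
is `C¹` and does not vanish at the ends. Mollifying `φ` in space with the finite-rank kernel reduces
the claim to scalar coefficients, where `integral_mul_deriv_of_weak_deriv` supplies the boundary
terms; then `n → ∞`. -/
theorem integral_mul_deriv_time {T : ℝ} (hT : 0 < T) {u w : ℝ → Torus d → ℝ}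
    (hu : L2ContinuousOn u (Icc 0 T))
    (hui : Integrable (fun z : ℝ × Torus d => u z.1 z.2) (spaceTime d T))
    (hwi : Integrable (fun z : ℝ × Torus d => w z.1 z.2) (spaceTime d T))
    (h : ∀ φ : ℝ → Torus d → ℝ, IsInteriorTest T φ →
      ∫ t in (0)..T, ∫ x, u t x * deriv (fun s => φ s x) t =
        - ∫ t in (0)..T, ∫ x, w t x * φ t x)
    {φ : ℝ → Torus d → ℝ} (hφ : SpaceTimeContDiff 1 φ) :
    ∫ t in (0)..T, ∫ x, u t x * deriv (fun s => φ s x) t =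
      (∫ x, u T x * φ T x) - (∫ x, u 0 x * φ 0 x) - ∫ t in (0)..T, ∫ x, w t x * φ t x := by
  have hTm : T ∈ Icc 0 T := right_mem_Icc.2 hT.le
  have h0m : (0 : ℝ) ∈ Icc 0 T := left_mem_Icc.2 hT.le
  have hut : ∀ t ∈ Icc 0 T, Integrable (u t) := fun t ht => integrable_of_memLp_two (hu.1 t ht)
  have hφt : ∀ t, Integrable (φ t) := fun t => integrable_of_continuous (hφ.slice t).continuous
  have hn : ∀ n, ∫ t in (0)..T, ∫ x, u t x * mollify n (fun x => deriv (fun s => φ s x) t) x =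
      (∫ x, u T x * mollify n (φ T) x) - (∫ x, u 0 x * mollify n (φ 0) x) -
        ∫ t in (0)..T, ∫ x, w t x * mollify n (φ t) x := by
    intro n
    obtain ⟨ι, _, a, ha, hk⟩ := hasFiniteRank_kernel (d := d) n
    have hac : ∀ m, Continuous (a m) := fun m => (ha m).one.continuous
    obtain ⟨h1, h2⟩ := intervalIntegrable_integral_mul_mollify hui
      (g := fun t x => deriv (fun s => φ s x) t) hφ.continuous_deriv_time ha hk hTm
    obtain ⟨h3, h4⟩ := intervalIntegrable_integral_mul_mollify hwi hφ.continuous ha hk hTm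
    rw [intervalIntegral.integral_congr_ae h2, intervalIntegral.integral_congr_ae h4,
      integral_mul_mollify_eq_sum ha hk (hut T hTm) (hφt T),
      integral_mul_mollify_eq_sum ha hk (hut 0 h0m) (hφt 0),
      intervalIntegral.integral_finsetSum fun m _ => h1 m,
      intervalIntegral.integral_finsetSum fun m _ => h3 m, ← Finset.sum_sub_distrib,
      ← Finset.sum_sub_distrib]
    refine Finset.sum_congr rfl fun m _ => ?_
    simp only [← (hasDerivAt_integral_mul hφ (hac m) _).deriv]
    refine integral_mul_deriv_of_weak_deriv (a := fun t => ∫ x, u t x * a m x)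
      (b := fun t => ∫ x, w t x * a m x) (f := fun t => ∫ x, φ t x * a m x) hT
      (hu.continuousOn_integral_mul_continuous (φ := fun _ => a m) ((hac m).comp continuous_snd))
      (intervalIntegrable_integral_mul hwi (hac m) hTm) (fun χ hχ hsupp => ?_)
      (contDiff_integral_mul hφ (hac m))
    obtain ⟨α, β, hα, hβ, hχ0⟩ := hsupp
    have htest := h (fun t x => χ t * a m x) ⟨spaceTimeContDiff_mul hχ (ha m).contDiff, α, β, hα, hβ,
      fun t ht x => by simp only [hχ0 t ht, zero_mul]⟩
    have hd : ∀ t x, deriv (fun s => χ s * a m x) t = deriv χ t * a m x := fun t x =>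
      (((hχ.differentiable (by simp)) t).hasDerivAt.mul_const _).deriv
    simp only [hd] at htest
    convert htest using 2
    · funext t
      rw [← integral_mul_const]
      congr 1; funext x; ring
    · refine intervalIntegral.integral_congr fun t _ => ?_
      rw [← integral_mul_const]
      congr 1; funext x; ring
  have hslice : ∀ t ∈ Icc 0 T, Tendsto (fun n => ∫ x, u t x * mollify n (φ t) x) atTop
      (𝓝 (∫ x, u t x * φ t x)) := fun t ht =>
    tendsto_integral_mollify_mul (memLp_two_of_continuous (hφ.slice t).continuous) (hu.1 t ht)
  have hl := tendsto_integral_mul_mollify hui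
    (g := fun t x => deriv (fun s => φ s x) t) hφ.continuous_deriv_time hTm
  simp only [hn] at hl
  exact tendsto_nhds_unique hl (((hslice T hTm).sub (hslice 0 h0m)).sub
    (tendsto_integral_mul_mollify hwi hφ.continuous hTm))

/-! ### The strong form of the equations -/

/-- The divergence condition is tested with `∑ u_i^n φ_i`, where `u^n` is the mollified field. The
product rule gives `∫ u_j (∂_j u_i^n φ_i + u_i^n ∂_j φ_i) = 0` after summation, and both terms pass
to the limit in `L²`. -/
theorem integral_convection_mul_pderiv {u : Torus d → Fin d → ℝ}
    (hu : ∀ i, MemLp (fun x => u x i) 2 volume)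
    (hdiv : ∀ ψ : Torus d → ℝ, TorusContDiff 1 ψ → ∫ x, ∑ i, u x i * pderiv i ψ x = 0)
    {G : Torus d → Matrix (Fin d) (Fin d) ℝ}
    (hG : ∀ i j, HasWeakDeriv j (fun x => u x i) fun x => G x i j)
    (hG2 : ∀ i j, MemLp (fun x => G x i j) 2 volume)
    {φ : Torus d → Fin d → ℝ} (hφ : ∀ i, TorusContDiff 1 fun x => φ x i) :
    ∫ x, ∑ i, ∑ j, u x i * u x j * pderiv j (fun y => φ y i) x =
      - ∫ x, ∑ i, (∑ j, u x j * G x i j) * φ x i := by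
  have hui : ∀ i, Integrable fun x => u x i := fun i => integrable_of_memLp_two (hu i)
  have hsm : ∀ n i, TorusSmooth (mollify n fun y => u y i) := fun n i =>
    torusSmooth_mollify n (hui i)
  have hφc : ∀ i, Continuous fun x => φ x i := fun i => (hφ i).continuous
  have hφp : ∀ i j, Continuous (pderiv j fun x => φ x i) := fun i j => (hφ i).continuous_pderiv j
  have h1 : ∀ i j, MemLp (fun x => φ x i * u x j) 2 volume := fun i j =>
    memLp_two_continuous_mul (hφc i) (hu j)
  have h2 : ∀ i j, MemLp (fun x => pderiv j (fun y => φ y i) x * u x j) 2 volume := fun i j =>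
    memLp_two_continuous_mul (hφp i j) (hu j)
  have hlim : Tendsto (fun n => ∑ i, ∑ j, ((∫ x, φ x i * u x j * mollify n (fun y => G y i j) x) +
      ∫ x, pderiv j (fun y => φ y i) x * u x j * mollify n (fun y => u y i) x)) atTop
      (𝓝 (∑ i, ∑ j, ((∫ x, φ x i * u x j * G x i j) +
        ∫ x, pderiv j (fun y => φ y i) x * u x j * u x i))) :=
    tendsto_finsetSum _ fun i _ => tendsto_finsetSum _ fun j _ =>
      (tendsto_integral_mollify_mul (hG2 i j) (h1 i j)).add
        (tendsto_integral_mollify_mul (hu i) (h2 i j))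
  have hzero : ∀ n, ∑ i, ∑ j, ((∫ x, φ x i * u x j * mollify n (fun y => G y i j) x) +
      ∫ x, pderiv j (fun y => φ y i) x * u x j * mollify n (fun y => u y i) x) = 0 := by
    intro n
    have hi1 : ∀ i j, Integrable fun x => φ x i * u x j * mollify n (fun y => G y i j) x :=
      fun i j => integrable_mul_continuous (integrable_of_memLp_two (h1 i j))
        (continuous_mollify n (hG i j).2.1)
    have hi2 : ∀ i j, Integrable fun x =>
        pderiv j (fun y => φ y i) x * u x j * mollify n (fun y => u y i) x :=
      fun i j => integrable_mul_continuous (integrable_of_memLp_two (h2 i j))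
        (continuous_mollify n (hui i))
    rw [← hdiv (fun x => ∑ i, mollify n (fun y => u y i) x * φ x i)
      (TorusContDiff.sum fun i _ => (hsm n i).one.mul (hφ i))]
    have hpd : ∀ j x, pderiv j (fun x => ∑ i, mollify n (fun y => u y i) x * φ x i) x =
        ∑ i, (mollify n (fun y => G y i j) x * φ x i +
          mollify n (fun y => u y i) x * pderiv j (fun y => φ y i) x) := by
      intro j x
      rw [pderiv_sum fun i _ => (hsm n i).one.mul (hφ i)]
      refine Finset.sum_congr rfl fun i _ => ?_
      rw [pderiv_mul (hsm n i).one (hφ i), (hG i j).pderiv_mollify]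
    simp only [hpd, ← integral_add (hi1 _ _) (hi2 _ _)]
    have hi3 : ∀ i j, Integrable fun x => φ x i * u x j * mollify n (fun y => G y i j) x +
        pderiv j (fun y => φ y i) x * u x j * mollify n (fun y => u y i) x := fun i j =>
      (hi1 i j).add (hi2 i j)
    rw [← Finset.sum_congr rfl fun i _ => integral_finsetSum Finset.univ fun j _ => hi3 i j,
      ← integral_finsetSum _ fun i _ => integrable_finsetSum _ fun j _ => hi3 i j]
    congr 1; funext x
    rw [Finset.sum_comm]
    refine Finset.sum_congr rfl fun j _ => ?_
    rw [Finset.mul_sum]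
    refine Finset.sum_congr rfl fun i _ => ?_
    ring
  simp only [hzero] at hlim
  have h0 := tendsto_nhds_unique hlim tendsto_const_nhds
  have hi3 : ∀ i j, Integrable fun x => φ x i * u x j * G x i j := fun i j =>
    (h1 i j).integrable_mul (hG2 i j)
  have hi4 : ∀ i j, Integrable fun x => pderiv j (fun y => φ y i) x * u x j * u x i := fun i j =>
    (h2 i j).integrable_mul (hu i)
  have hA : ∫ x, ∑ i, ∑ j, u x i * u x j * pderiv j (fun y => φ y i) x =
      ∑ i, ∑ j, ∫ x, pderiv j (fun y => φ y i) x * u x j * u x i := by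
    rw [← Finset.sum_congr rfl fun i _ => integral_finsetSum Finset.univ fun j _ => hi4 i j,
      ← integral_finsetSum _ fun i _ => integrable_finsetSum _ fun j _ => hi4 i j]
    congr 1; funext x
    exact Finset.sum_congr rfl fun i _ => Finset.sum_congr rfl fun j _ => by ring
  have hB : ∫ x, ∑ i, (∑ j, u x j * G x i j) * φ x i =
      ∑ i, ∑ j, ∫ x, φ x i * u x j * G x i j := by
    rw [← Finset.sum_congr rfl fun i _ => integral_finsetSum Finset.univ fun j _ => hi3 i j,
      ← integral_finsetSum _ fun i _ => integrable_finsetSum _ fun j _ => hi3 i j]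
    congr 1; funext x
    refine Finset.sum_congr rfl fun i _ => ?_
    rw [Finset.sum_mul]
    exact Finset.sum_congr rfl fun j _ => by ring
  rw [hA, hB]
  simp only [Finset.sum_add_distrib] at h0
  linarith

/-- The mollified trace is the divergence of the mollified field, which is zero; so the bound with
`M = 0` applies to the trace itself. -/
theorem WeaklyDivFree.ae_trace_eq_zero {u : Torus d → Fin d → ℝ} (hu : WeaklyDivFree u)
    {G : Torus d → Matrix (Fin d) (Fin d) ℝ}
    (hG : ∀ i j, HasWeakDeriv j (fun x => u x i) fun x => G x i j) :
    ∀ᵐ x, (G x).trace = 0 := by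
  have hi : Integrable fun x => (G x).trace := by
    simp only [Matrix.trace, Matrix.diag_apply]
    exact integrable_finsetSum _ fun i _ => (hG i i).2.1
  have h := ae_abs_le_of_abs_mollify_le hi (M := 0) fun n x => by
    have h1 : mollify n (fun x => (G x).trace) x = ∑ i, mollify n (fun y => G y i i) x := by
      simp only [mollify, Matrix.trace, Matrix.diag_apply, Finset.mul_sum]
      exact integral_finsetSum _ fun i _ => integrable_kernel_mul n x (hG i i).2.1
    have h2 := hu.sum_pderiv_mollify n x
    simp only [fun i => (hG i i).pderiv_mollify n x] at h2
    rw [h1, h2, abs_zero]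
  filter_upwards [h] with x hx
  exact abs_nonpos_iff.1 hx

instance isFiniteMeasure_spaceTime (T : ℝ) : IsFiniteMeasure (spaceTime d T) := by
  unfold spaceTime; infer_instance

theorem integrable_spaceTime_mul_continuous {T : ℝ} {f : ℝ × Torus d → ℝ}
    (hf : Integrable f (spaceTime d T)) {g : ℝ → Torus d → ℝ}
    (hg : Continuous fun z : ℝ × Torus d => g z.1 z.2) :
    Integrable (fun z => f z * g z.1 z.2) (spaceTime d T) := by
  obtain ⟨C, hC⟩ := ((isCompact_Icc (a := 0) (b := T)).prod
    (isCompact_univ (X := Torus d))).exists_bound_of_continuousOn hg.continuousOn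
  refine hf.mul_bdd (c := C) hg.aestronglyMeasurable ?_
  rw [spaceTime_eq_restrict]
  filter_upwards [ae_restrict_mem (measurableSet_Ioo.prod MeasurableSet.univ)] with z hz
  exact hC z ⟨Ioo_subset_Icc_self hz.1, mem_univ _⟩

/-- The momentum equation in strong form, for vanishing Reynolds stress. -/
theorem IsDissipativeSolution.integral_strong_momentum
    {F : Matrix (Fin d) (Fin d) ℝ → ℝ} {T : ℝ}
    (hT : 0 < T) {v₀ : Torus d → Fin d → ℝ} {v : ℝ → Torus d → Fin d → ℝ}
    {S : ℝ → Torus d → Matrix (Fin d) (Fin d) ℝ}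
    {R : ℝ → Matrix (Fin d) (Fin d) (SignedMeasure (Torus d))}
    (hsol : IsDissipativeSolution F T v₀ v S R)
    (hR : ∀ᵐ t ∂(volume.restrict (Ioo 0 T)), ∀ i j, R t i j = 0)
    (hv : ∀ i, L2ContinuousOn (fun t x => v t x i) (Icc 0 T))
    (hdiv : ∀ t ∈ Icc 0 T, ∀ ψ : Torus d → ℝ, TorusContDiff 1 ψ →
      ∫ x, ∑ i, v t x i * pderiv i ψ x = 0)
    (hv0 : ∀ i, (fun x => v 0 x i) =ᵐ[volume] fun x => v₀ x i)
    (hvv : ∀ i j, Integrable (fun z : ℝ × Torus d => v z.1 z.2 i * v z.1 z.2 j) (spaceTime d T))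
    {M : ℝ} (hM : ∀ t ∈ Icc 0 T, ∀ i j n x,
      |pderiv j (mollify n fun y => v t y i) x| ≤ M)
    {G : ℝ → Torus d → Matrix (Fin d) (Fin d) ℝ}
    (hGi : ∀ i j, Integrable (fun z : ℝ × Torus d => G z.1 z.2 i j) (spaceTime d T))
    (hG : IsWeakGradient T v G) {w : ℝ → Torus d → Fin d → ℝ} (hw : IsWeakTimeDeriv T v w)
    {φ : ℝ → Torus d → Fin d → ℝ} (hφ : IsSolenoidalTest T φ) :
    (∫ t in (0)..T, ∫ x, ∑ i, (w t x i + ∑ j, v t x j * G t x i j) * φ t x i) =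
      - ∫ t in (0)..T, ∫ x, ∑ i, ∑ j, S t x i j * pderiv j (fun y => φ t y i) x := by
  have hTm : T ∈ Icc 0 T := right_mem_Icc.2 hT.le
  have h0m : (0 : ℝ) ∈ Icc 0 T := left_mem_Icc.2 hT.le
  have hφc : ∀ t i, Continuous fun x => φ t x i := fun t i => ((hφ.1 i).slice t).continuous
  have hmom := hsol.momentum T hTm φ hφ
  have hRz : ∫ t in (0)..T, ∑ i, ∑ j, ∫ᵛ x, pderiv j (fun y => φ t y i) x ∂•(R t i j) = 0 := by
    refine (intervalIntegral.integral_congr_ae (g := fun _ => 0) ?_).trans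
      intervalIntegral.integral_zero
    filter_upwards [ae_uIoc_of_ae_restrict_Ioo hTm hR] with t ht hmem
    simp [(ht hmem).2]
  have hinit : ∫ x, ∑ i, v₀ x i * φ 0 x i = ∫ x, ∑ i, v 0 x i * φ 0 x i := by
    refine integral_congr_ae ?_
    filter_upwards [ae_all_iff.2 hv0] with x hx
    simp only [hx]
  have hend : ∀ t ∈ Icc 0 T, ∫ x, ∑ i, v t x i * φ t x i = ∑ i, ∫ x, v t x i * φ t x i :=
    fun t ht => integral_finsetSum _ fun i _ =>
      integrable_mul_continuous (integrable_of_memLp_two ((hv i).1 t ht)) (hφc t i)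
  have hf1 : ∀ i, Integrable (fun z : ℝ × Torus d =>
      v z.1 z.2 i * deriv (fun s => φ s z.2 i) z.1) (spaceTime d T) := fun i =>
    integrable_spaceTime_mul_continuous (hw i).1 (g := fun t x => deriv (fun s => φ s x i) t)
      (hφ.1 i).continuous_deriv_time
  have hf2 : Integrable (fun z : ℝ × Torus d => ∑ i, ∑ j, v z.1 z.2 i * v z.1 z.2 j *
      pderiv j (fun y => φ z.1 y i) z.2) (spaceTime d T) :=
    integrable_finsetSum _ fun i _ => integrable_finsetSum _ fun j _ =>
      integrable_spaceTime_mul_continuous (hvv i j) (g := fun t x => pderiv j (fun y => φ t y i) x)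
        ((hφ.1 i).continuous_pderiv j)
  have hf3 : ∀ i, Integrable (fun z : ℝ × Torus d => w z.1 z.2 i * φ z.1 z.2 i)
      (spaceTime d T) := fun i =>
    integrable_spaceTime_mul_continuous (hw i).2.1 (g := fun t x => φ t x i) (hφ.1 i).continuous
  have hf4 : Integrable (fun z : ℝ × Torus d => ∑ i, (∑ j, v z.1 z.2 j * G z.1 z.2 i j) *
      φ z.1 z.2 i) (spaceTime d T) :=
    integrable_finsetSum _ fun i _ => integrable_spaceTime_mul_continuous (g := fun t x => φ t x i)
      (integrable_finsetSum _ fun j _ => (hw j).1.mul_bdd (c := M) (hGi i j).1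
        (hG.ae_abs_le (fun i j => (hGi i j).1) hM i j)) (hφ.1 i).continuous
  have hlhs : (∫ t in (0)..T, ∫ x, ∑ i, (w t x i + ∑ j, v t x j * G t x i j) * φ t x i) =
      (∑ i, ∫ t in (0)..T, ∫ x, w t x i * φ t x i) +
        ∫ t in (0)..T, ∫ x, ∑ i, (∑ j, v t x j * G t x i j) * φ t x i := by
    have h1 := integral_spaceTime hT.le ((integrable_finsetSum Finset.univ fun i _ => hf3 i).add hf4)
    have h2 := integral_add (integrable_finsetSum Finset.univ fun i _ => hf3 i) hf4
    rw [integral_finsetSum _ fun i _ => hf3 i, integral_spaceTime hT.le hf4] at h2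
    simp only [fun i => integral_spaceTime hT.le (hf3 i)] at h2
    rw [← h2]
    refine Eq.trans ?_ h1.symm
    simp only [Pi.add_apply, add_mul, Finset.sum_add_distrib]
  have hrhs : (∫ t in (0)..T, ∫ x, ((∑ i, v t x i * deriv (fun s => φ s x i) t) +
        ∑ i, ∑ j, v t x i * v t x j * pderiv j (fun y => φ t y i) x)) =
      (∑ i, ∫ t in (0)..T, ∫ x, v t x i * deriv (fun s => φ s x i) t) +
        ∫ t in (0)..T, ∫ x, ∑ i, ∑ j, v t x i * v t x j * pderiv j (fun y => φ t y i) x := by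
    have h1 := integral_spaceTime hT.le ((integrable_finsetSum Finset.univ fun i _ => hf1 i).add hf2)
    have h2 := integral_add (integrable_finsetSum Finset.univ fun i _ => hf1 i) hf2
    rw [integral_finsetSum _ fun i _ => hf1 i, integral_spaceTime hT.le hf2] at h2
    simp only [fun i => integral_spaceTime hT.le (hf1 i)] at h2
    rw [← h2]
    exact h1.symm
  have htime : ∀ i, ∫ t in (0)..T, ∫ x, v t x i * deriv (fun s => φ s x i) t =
      (∫ x, v T x i * φ T x i) - (∫ x, v 0 x i * φ 0 x i) -
        ∫ t in (0)..T, ∫ x, w t x i * φ t x i := fun i =>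
    integral_mul_deriv_time hT (hv i) (hw i).1 (hw i).2.1 (hw i).2.2 (hφ.1 i)
  have hconv : ∫ t in (0)..T, ∫ x, ∑ i, ∑ j, v t x i * v t x j * pderiv j (fun y => φ t y i) x =
      - ∫ t in (0)..T, ∫ x, ∑ i, (∑ j, v t x j * G t x i j) * φ t x i := by
    rw [← intervalIntegral.integral_neg]
    refine intervalIntegral.integral_congr_ae ?_
    filter_upwards [ae_uIoc_of_ae_restrict_Ioo hTm hG] with t ht hmem
    obtain ⟨htT, hGt⟩ := ht hmem
    have htT' := Ioo_subset_Icc_self htT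
    refine integral_convection_mul_pderiv (fun i => (hv i).1 t htT') (hdiv t htT') hGt
      (fun i j => MemLp.of_bound (hGt i j).2.1.1 M ?_) fun i => (hφ.1 i).slice t
    refine ae_abs_le_of_abs_mollify_le (hGt i j).2.1 fun n x => ?_
    rw [← (hGt i j).pderiv_mollify]
    exact hM t htT' i j n x
  rw [hRz, hinit, hend T hTm, hend 0 h0m, hrhs, hconv] at hmom
  simp only [htime, Finset.sum_sub_distrib] at hmom
  rw [hlhs]
  linarith

end DissipativeFluid

end


/-! ### The theorem -/

theorem theorem2p3 (d : ℕ) (hd : d = 2 ∨ d = 3) (p T : ℝ) (hp : (d : ℝ) + 2 < p) (hT : 0 < T)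
    (F : Matrix (Fin d) (Fin d) ℝ → ℝ) (hF : DissipativeFluid.IsPotential F)
    (v₀ : DissipativeFluid.Torus d → Fin d → ℝ)
    (hv₀ : ∀ i, DissipativeFluid.MemTraceSpace p (fun x => v₀ x i))
    (hdiv : DissipativeFluid.WeaklyDivFree v₀)
    (v : ℝ → DissipativeFluid.Torus d → Fin d → ℝ)
    (S : ℝ → DissipativeFluid.Torus d → Matrix (Fin d) (Fin d) ℝ)
    (R : ℝ → Matrix (Fin d) (Fin d) (SignedMeasure (DissipativeFluid.Torus d)))
    (hsol : DissipativeFluid.IsDissipativeSolution F T v₀ v S R)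
    (hreg : DissipativeFluid.InRegularityClass p T v) :
    (∀ᵐ t ∂(volume.restrict (Ioo 0 T)), ∀ i j, R t i j = 0) ∧
    (∀ G : ℝ → DissipativeFluid.Torus d → Matrix (Fin d) (Fin d) ℝ,
      (∀ i j, MemLp (fun z : ℝ × DissipativeFluid.Torus d => G z.1 z.2 i j) (ENNReal.ofReal p)
        (DissipativeFluid.spaceTime d T)) →
      DissipativeFluid.IsWeakGradient T v G →
      ∀ᵐ z ∂(DissipativeFluid.spaceTime d T),
        ((DissipativeFluid.frob (S z.1 z.2) (DissipativeFluid.symPart (G z.1 z.2)) : ℝ) : EReal) =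
          (F (DissipativeFluid.symPart (G z.1 z.2)) : EReal) +
            DissipativeFluid.conjugate F (S z.1 z.2)) ∧
    DissipativeFluid.IsStrongSolution F p T v₀ v S := by
  have hp0 : (0 : ℝ) ≤ d := Nat.cast_nonneg d
  have hp1 : 1 ≤ ENNReal.ofReal p := by rw [ENNReal.one_le_ofReal]; linarith
  have hp2 : 2 ≤ ENNReal.ofReal p := by
    rw [← ENNReal.ofReal_ofNat 2]; exact ENNReal.ofReal_le_ofReal (by linarith)
  have hv := hreg.l2ContinuousOn hp
  obtain ⟨M, hM0, hM⟩ := hreg.exists_bound_pderiv_mollify hp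
  have hvdiv : ∀ t ∈ Icc 0 T, ∀ ψ : DissipativeFluid.Torus d → ℝ,
      DissipativeFluid.TorusContDiff 1 ψ →
      ∫ x, ∑ i, v t x i * DissipativeFluid.pderiv i ψ x = 0 := fun t ht ψ hψ =>
    DissipativeFluid.integral_sum_mul_pderiv_eq_zero hT hv hsol.incompressible hψ ht
  have hwdiv : ∀ t ∈ Icc 0 T, DissipativeFluid.WeaklyDivFree (v t) := fun t ht =>
    ⟨fun i => hreg.integrable hp ht i, fun φ hφ => hvdiv t ht φ hφ.one⟩
  have hv0 := hsol.ae_eq_initial hT hdiv (hwdiv 0 (left_mem_Icc.2 hT.le))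
  obtain ⟨G, H, hvp, hGp, -, hG, -⟩ := hreg.second_derivs
  obtain ⟨w, hwp, hw⟩ := hreg.time_deriv
  have hvv : ∀ i j, Integrable (fun z : ℝ × DissipativeFluid.Torus d =>
      v z.1 z.2 i * v z.1 z.2 j) (DissipativeFluid.spaceTime d T) := fun i j =>
    ((hvp i).mono_exponent hp2).integrable_mul ((hvp j).mono_exponent hp2)
  -- The bound `M` belongs to `v` and not to a particular gradient, so the conclusion is available
  -- for every weak gradient in `L^p`.
  have main : ∀ {G : ℝ → DissipativeFluid.Torus d → Matrix (Fin d) (Fin d) ℝ},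
      (∀ i j, MemLp (fun z : ℝ × DissipativeFluid.Torus d => G z.1 z.2 i j) (ENNReal.ofReal p)
        (DissipativeFluid.spaceTime d T)) →
      DissipativeFluid.IsWeakGradient T v G → _ := fun hGp hG =>
    hsol.reynolds_eq_zero_and_constitutive hF hT hv hvdiv hv0 hvv hM0 hM
      (fun i j => (hGp i j).integrable hp1) hG
  refine ⟨(main hGp hG).1, fun G hGp hG => (main hGp hG).2, hreg, hv0, w, G, hwp, hGp, hw, hG, ?_,
    fun φ hφ => hsol.integral_strong_momentum hT (main hGp hG).1 hv hvdiv hv0 hvv hM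
      (fun i j => (hGp i j).integrable hp1) hG hw hφ, (main hGp hG).2⟩
  refine DissipativeFluid.ae_spaceTime_eq_zero (f := fun z => (G z.1 z.2).trace) ?_ ?_
  · simp only [Matrix.trace, Matrix.diag_apply]
    exact Finset.aestronglyMeasurable_fun_sum _ fun i _ => (hGp i i).1
  · filter_upwards [hG, ae_restrict_mem measurableSet_Ioo] with t hGt ht
    exact (hwdiv t (Ioo_subset_Icc_self ht)).ae_trace_eq_zero hGt
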